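/- Let $\Gamma\subset\mathrm{SL}_2(\mathbb Q)$ be a congruence subgroup, i.e. a subgroup containing some principal congruence subgroup $\Gamma(N)$, $N\ge1$, with finite index. Let $\mathfrak g=\mathfrak{sl}_2(\mathbb R)$, $K=\mathrm{SO}(2)=\{r(\theta)=\left(\begin{smallmatrix}\cos\theta&\sin\theta\\-\sin\theta&\cos\theta\end{smallmatrix}\right)\}$, and let $L=\frac12\left(\begin{smallmatrix}1&-i\\-i&-1\end{smallmatrix}\right)\in\mathfrak g_{\mathbb C}=\mathfrak{sl}_2(\mathbb C)$ be the weight-lowering element. Let $\mathcal A(\Gamma)^\circ$ be the space of cuspidal automorphic forms on $\mathrm{SL}_2(\mathbb R)$ with respect to $\Gamma$: the functions $\Phi:\mathrm{SL}_2(\mathbb R)\to\mathbb C$ that are smooth, left $\Gamma$-invariant, right $K$-finite, finite under the center $\mathcal Z$ of the universal enveloping algebra of $\mathfrak g_{\mathbb C}$, slowly increasing, and satisfy $\int_{(\Gamma\cap U)\backslash U}\Phi(ug)\,du=0$ for every $g\in\mathrm{SL}_2(\mathbb R)$ and every unipotent radical $U$ of a proper parabolic $\mathbb Q$-subgroup of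 $\mathrm{SL}_2$. Here $\mathfrak g_{\mathbb C}$ and $K$ act by right translation. Let $\mathcal A(\Gamma)^\circ_{\mathfrak n\text{-fin}}$ be the subspace of those $\Phi$ with $L^v\Phi=0$ for some $v\ge0$. For an integer $p\ge0$ let $\mathcal D_{p,+}$ be the irreducible $(\mathfrak g,K)$-module with weights $p+1,p+3,p+5,\ldots$, each of multiplicity one (discrete series for $p\ge1$, limit of discrete series for $p=0$). Let $S_\ell(\Gamma)$ be the space of holomorphic cusp forms of weight $\ell$ with respect to $\Gamma$, and let $(f|_\ell g)(\tau)=(c\tau+d)^{-\ell}f\big(\frac{a\tau+b}{c\tau+d}\big)$ for $g=\left(\begin{smallmatrix}a&b\\c&d\end{smallmatrix}\right)\in\mathrm{SL}_2(\mathbb R)$. Then $S_\ell(\Gamma)$ is finite-dimensional for every $\ell\ge1$, the space $\mathcal A(\Gamma)^\circ_{\mathfrak n\text{-fin}}$ is a $(\mathfrak g,K)$-module, and as $(\mathfrak g,K)$-modules $$\mathcal A(\Gamma)^\circ_{\mathfrak n\text{-fin}}\;\cong\;\bigoplus_{\ell=1}^\infty n_\ell\,\mathcal D_{\ell-1,+},\qquad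 n_\ell=\dim S_\ell(\Gamma).$$ Moreover, for every $\ell\ge1$, let $V_\ell$ be the isotypical component of type $\mathcal D_{\ell-1,+}$, i.e. the sum of all $(\mathfrak g,K)$-submodules of $\mathcal A(\Gamma)^\circ_{\mathfrak n\text{-fin}}$ isomorphic to $\mathcal D_{\ell-1,+}$. Then the map $\Phi\mapsto\tilde\Phi$, $$\tilde\Phi(x+iy)=y^{-\ell/2}\,\Phi\Big(\begin{pmatrix}1&x\\0&1\end{pmatrix}\begin{pmatrix}y^{1/2}&0\\0&y^{-1/2}\end{pmatrix}\Big),$$ is a linear isomorphism from the space of lowest weight vectors of $V_\ell$ (the $\Phi\in V_\ell$ of weight $\ell$ with $L\Phi=0$, including $0$) onto $S_\ell(\Gamma)$, and it satisfies $(\tilde\Phi|_\ell g)(i)=\Phi(g)$ for all $g\in\mathrm{SL}_2(\mathbb R)$. -/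

import Mathlib

open scoped MatrixGroups ModularForm DirectSum

attribute [local instance 100] LieRing.ofAssociativeRing

namespace AutSL2

open Matrix

/-! ### The group `SL₂(ℝ)`, its Lie algebra, and smooth functions -/

/-- The real Lie algebra `𝔤 = 𝔰𝔩₂(ℝ)`. -/
abbrev sl2R : LieSubalgebra ℝ (Matrix (Fin 2) (Fin 2) ℝ) := LieAlgebra.SpecialLinear.sl (Fin 2) ℝ

/-- The complexified Lie algebra `𝔤_ℂ = 𝔰𝔩₂(ℂ)`. -/
abbrev sl2C : LieSubalgebra ℂ (Matrix (Fin 2) (Fin 2) ℂ) := LieAlgebra.SpecialLinear.sl (Fin 2) ℂ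

theorem mem_sl2R {X : Matrix (Fin 2) (Fin 2) ℝ} : X ∈ sl2R ↔ X 0 0 + X 1 1 = 0 := by
  rw [← trace_fin_two]; exact Iff.rfl

theorem mem_sl2C {Z : Matrix (Fin 2) (Fin 2) ℂ} : Z ∈ sl2C ↔ Z 0 0 + Z 1 1 = 0 := by
  rw [← trace_fin_two]; exact Iff.rfl

/-- The element `H = -i (0 1; -1 0)`. -/
noncomputable def Hel : sl2C :=
  ⟨!![0, -Complex.I; Complex.I, 0], mem_sl2C.2 (by simp)⟩

/-- The element `R = ½ (1 i; i -1)`. -/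
noncomputable def Rel : sl2C :=
  ⟨!![1 / 2, Complex.I / 2; Complex.I / 2, -1 / 2], mem_sl2C.2 (by simp; ring)⟩

/-- The element `L = ½ (1 -i; -i -1)`. -/
noncomputable def Lel : sl2C :=
  ⟨!![1 / 2, -Complex.I / 2; -Complex.I / 2, -1 / 2], mem_sl2C.2 (by simp; ring)⟩

/-- The real part of an element of `𝔰𝔩₂(ℂ)`, so that `Z = reSl Z + i · imSl Z`. -/
def reSl (Z : sl2C) : sl2R :=
  ⟨Z.1.map Complex.re, mem_sl2R.2 (by simpa using congrArg Complex.re (mem_sl2C.1 Z.2))⟩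

/-- The imaginary part of an element of `𝔰𝔩₂(ℂ)`. -/
def imSl (Z : sl2C) : sl2R :=
  ⟨Z.1.map Complex.im, mem_sl2R.2 (by simpa using congrArg Complex.im (mem_sl2C.1 Z.2))⟩

section Exp

open scoped Matrix.Norms.Operator

theorem hasDerivAt_exp_entry (X : Matrix (Fin 2) (Fin 2) ℝ) (s : ℝ) (i j : Fin 2) :
    HasDerivAt (fun u : ℝ => NormedSpace.exp (u • X) i j)
      ((NormedSpace.exp (s • X) * X) i j) s := by
  have h := hasDerivAt_exp_smul_const (𝕂 := ℝ) X s
  let ev : Matrix (Fin 2) (Fin 2) ℝ →L[ℝ] ℝ :=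
    LinearMap.toContinuousLinearMap (Matrix.entryLinearMap ℝ ℝ i j)
  exact ev.hasFDerivAt.comp_hasDerivAt s h

end Exp

theorem det_exp_smul (X : sl2R) (t : ℝ) :
    (NormedSpace.exp (t • (X : Matrix (Fin 2) (Fin 2) ℝ))).det = 1 := by
  have hd : ∀ s : ℝ, HasDerivAt
      (fun u : ℝ => (NormedSpace.exp (u • (X : Matrix (Fin 2) (Fin 2) ℝ))).det) 0 s := by
    intro s
    have he := hasDerivAt_exp_entry (X : Matrix (Fin 2) (Fin 2) ℝ) s
    simp only [det_fin_two]
    refine (((he 0 0).mul (he 1 1)).sub ((he 0 1).mul (he 1 0))).congr_deriv ?_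
    have h11 : X.1 1 1 = - X.1 0 0 := by linarith [mem_sl2R.1 X.2]
    simp only [Matrix.mul_apply, Fin.sum_univ_two, h11]
    ring
  have hc := is_const_of_deriv_eq_zero (fun s => (hd s).differentiableAt)
    (fun s => (hd s).deriv) t 0
  simpa using hc

/-- The exponential map `𝔰𝔩₂(ℝ) → SL₂(ℝ)`. -/
noncomputable def expSL (X : sl2R) : SL(2, ℝ) :=
  ⟨NormedSpace.exp (X : Matrix (Fin 2) (Fin 2) ℝ), by simpa using det_exp_smul X 1⟩

/-- The space of real `2 × 2` matrices as a normed space (with the maximum norm). -/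
abbrev M2 : Type := Fin 2 → Fin 2 → ℝ

/-- The open set `GL₂(ℝ)⁺` in the space of matrices. -/
def posDet : Set M2 := {A | 0 < (of A).det}

/-- The retraction `A ↦ det(A)^{-1/2} A` of `GL₂(ℝ)⁺` onto `SL₂(ℝ)` (a junk value elsewhere). -/
noncomputable def normalize (A : M2) : SL(2, ℝ) :=
  if h : 0 < (of A).det then ⟨(Real.sqrt (of A).det)⁻¹ • of A, by
    rw [det_smul, Fintype.card_fin, inv_pow, Real.sq_sqrt h.le, inv_mul_cancel₀ h.ne']⟩ else 1

theorem normalize_val {A : M2} (h : 0 < (of A).det) :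
    (normalize A).1 = (Real.sqrt (of A).det)⁻¹ • of A :=
  congrArg Subtype.val (dif_pos h)

/-- The composition of a function on `SL₂(ℝ)` with the retraction `GL₂(ℝ)⁺ → SL₂(ℝ)`. -/
noncomputable def ext (Φ : SL(2, ℝ) → ℂ) (A : M2) : ℂ := Φ (normalize A)

/-- The space of smooth complex functions on `SL₂(ℝ)`. As `A ↦ det(A)^{-1/2} A` is a smooth
retraction of the open set `GL₂(ℝ)⁺` of `M₂(ℝ)` onto the submanifold `SL₂(ℝ)`, a function on
`SL₂(ℝ)` is smooth if and only if its composition with the retraction is smooth. -/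
def Smooth : Submodule ℂ (SL(2, ℝ) → ℂ) where
  carrier := {Φ | ContDiffOn ℝ ((⊤ : ℕ∞) : WithTop ℕ∞) (ext Φ) posDet}
  add_mem' h h' := ContDiffOn.add h h'
  zero_mem' := contDiffOn_const
  smul_mem' _ _ h := contDiffOn_const.smul h

theorem isOpen_posDet : IsOpen posDet := by
  have : Continuous fun A : M2 => (of A).det := by
    simp only [det_fin_two, of_apply]
    fun_prop
  exact isOpen_lt continuous_const this

/-- An element of `SL₂(ℝ)` as a point of the space of matrices. -/
def pt (g : SL(2, ℝ)) : M2 := fun i j => g.1 i j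

theorem pt_mem (g : SL(2, ℝ)) : pt g ∈ posDet := by
  change 0 < g.1.det
  rw [g.2]
  exact one_pos

theorem normalize_pt (g : SL(2, ℝ)) : normalize (pt g) = g := by
  have h : (of (pt g)).det = 1 := g.2
  apply Subtype.ext
  rw [normalize_val (by rw [h]; exact one_pos), h, Real.sqrt_one, inv_one, one_smul]
  rfl

theorem pt_normalize {A : M2} (h : A ∈ posDet) :
    pt (normalize A) = (Real.sqrt (of A).det)⁻¹ • A := by
  change of.symm (normalize A).1 = _
  rw [normalize_val h]
  rfl

theorem smul_mem_posDet {A : M2} (h : A ∈ posDet) {c : ℝ} (hc : 0 < c) : c • A ∈ posDet := by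
  have h' : 0 < (of A).det := h
  change 0 < (c • of A).det
  rw [det_smul]
  positivity

theorem normalize_smul {A : M2} (h : A ∈ posDet) {c : ℝ} (hc : 0 < c) :
    normalize (c • A) = normalize A := by
  have hp : pt (normalize (c • A)) = pt (normalize A) := by
    have hd : (of (c • A)).det = c ^ 2 * (of A).det := by
      change (c • of A).det = _
      rw [det_smul, Fintype.card_fin]
    rw [pt_normalize h, pt_normalize (smul_mem_posDet h hc), hd, Real.sqrt_mul (by positivity),
      Real.sqrt_sq hc.le, smul_smul]
    congr 1
    field_simp
  exact Subtype.ext hp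

/-- Right multiplication by a matrix, as a continuous linear map. -/
noncomputable def mulR (X : Matrix (Fin 2) (Fin 2) ℝ) : M2 →L[ℝ] M2 :=
  LinearMap.toContinuousLinearMap
    { toFun := fun A i j => (of A * X) i j
      map_add' := fun A B => by funext i j; simp [Matrix.mul_apply, add_mul]; ring
      map_smul' := fun c A => by funext i j; simp [Matrix.mul_apply]; ring }

theorem mulR_apply (X : Matrix (Fin 2) (Fin 2) ℝ) (A : M2) (i j : Fin 2) :
    mulR X A i j = A i 0 * X 0 j + A i 1 * X 1 j := by
  change (of A * X) i j = _
  simp [Matrix.mul_apply]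

theorem differentiableAt_ext (Φ : Smooth) {A : M2} (h : A ∈ posDet) :
    DifferentiableAt ℝ (ext Φ) A :=
  (Φ.2.contDiffAt (isOpen_posDet.mem_nhds h)).differentiableAt (by simp)

theorem fderiv_ext_smul (Φ : Smooth) {A : M2} (h : A ∈ posDet) {c : ℝ} (hc : 0 < c) (M : M2) :
    fderiv ℝ (ext Φ) (c • A) (c • M) = fderiv ℝ (ext Φ) A M := by
  have hd := differentiableAt_ext Φ (smul_mem_posDet h hc)
  have h1 : HasFDerivAt (fun B : M2 => ext Φ (c • B))
      ((fderiv ℝ (ext Φ) (c • A)).comp (c • ContinuousLinearMap.id ℝ M2)) A :=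
    HasFDerivAt.comp A hd.hasFDerivAt ((hasFDerivAt_id A).const_smul c)
  have h2 : (fun B : M2 => ext Φ (c • B)) =ᶠ[nhds A] ext Φ := by
    filter_upwards [isOpen_posDet.mem_nhds h] with B hB
    simp only [ext, normalize_smul hB hc]
  rw [(h2.hasFDerivAt_iff.1 h1).fderiv]
  rfl

/-- The derivative of `Φ` along the left invariant vector field attached to `X ∈ 𝔰𝔩₂(ℝ)`, that is
`(X.Φ)(g) = d/dt Φ(g exp(tX))` at `t = 0`. -/
noncomputable def lieDeriv (X : sl2R) (Φ : SL(2, ℝ) → ℂ) (g : SL(2, ℝ)) : ℂ :=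
  deriv (fun t : ℝ => Φ (g * expSL (t • X))) 0

theorem lieDeriv_eq (X : sl2R) (Φ : Smooth) (g : SL(2, ℝ)) :
    lieDeriv X Φ g = fderiv ℝ (ext Φ) (pt g) (mulR X (pt g)) := by
  have h0 : HasDerivAt (fun t : ℝ => pt (g * expSL (t • X))) (mulR X (pt g)) 0 := by
    refine hasDerivAt_pi.2 fun i => hasDerivAt_pi.2 fun j => ?_
    have he := fun k => hasDerivAt_exp_entry (X : Matrix (Fin 2) (Fin 2) ℝ) 0 k j
    have h1 := ((he 0).const_mul (g.1 i 0)).add ((he 1).const_mul (g.1 i 1))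
    have h2 : (fun t : ℝ => pt (g * expSL (t • X)) i j) = (fun t : ℝ =>
        g.1 i 0 * NormedSpace.exp (t • (X : Matrix (Fin 2) (Fin 2) ℝ)) 0 j) + (fun t : ℝ =>
        g.1 i 1 * NormedSpace.exp (t • (X : Matrix (Fin 2) (Fin 2) ℝ)) 1 j) := by
      funext t
      change (g.1 * NormedSpace.exp (t • (X : Matrix (Fin 2) (Fin 2) ℝ))) i j = _
      simp [Matrix.mul_apply]
    rw [h2]
    refine h1.congr_deriv ?_
    rw [mulR_apply]
    simp [pt]
  have hv : pt (g * expSL ((0 : ℝ) • X)) = pt g := by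
    have he : expSL ((0 : ℝ) • X) = 1 := Subtype.ext (by simp [expSL])
    rw [he, mul_one]
  have hd : HasFDerivAt (ext Φ) (fderiv ℝ (ext Φ) (pt g)) (pt (g * expSL ((0 : ℝ) • X))) := by
    rw [hv]
    exact (differentiableAt_ext Φ (pt_mem g)).hasFDerivAt
  have h1 := hd.comp_hasDerivAt (0 : ℝ) h0
  have h2 : (fun t : ℝ => (Φ : SL(2, ℝ) → ℂ) (g * expSL (t • X))) =
      ext Φ ∘ fun t : ℝ => pt (g * expSL (t • X)) := by
    funext t
    simp only [Function.comp, ext, normalize_pt]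
  rw [lieDeriv, h2, h1.deriv]

theorem ext_lieDeriv (X : sl2R) (Φ : Smooth) {A : M2} (hA : A ∈ posDet) :
    ext (lieDeriv X Φ) A = fderiv ℝ (ext Φ) A (mulR X A) := by
  have hA' : 0 < (of A).det := hA
  rw [ext, lieDeriv_eq, pt_normalize hA, map_smul]
  exact fderiv_ext_smul Φ hA (by positivity) _

theorem lieDeriv_mem (X : sl2R) (Φ : Smooth) : lieDeriv X Φ ∈ Smooth := by
  have h1 : ContDiffOn ℝ ((⊤ : ℕ∞) : WithTop ℕ∞) (fderiv ℝ (ext Φ)) posDet :=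
    ContDiffOn.fderiv_of_isOpen Φ.2 isOpen_posDet (by exact_mod_cast le_rfl)
  exact (h1.clm_apply (mulR X.1).contDiff.contDiffOn).congr fun A hA => ext_lieDeriv X Φ hA

/-- `lieDeriv X` as a linear operator on smooth functions. -/
noncomputable def lieD (X : sl2R) : Module.End ℂ Smooth where
  toFun Φ := ⟨lieDeriv X Φ, lieDeriv_mem X Φ⟩
  map_add' Φ Ψ := by
    apply Subtype.ext
    funext g
    have h : ext ((Φ + Ψ : Smooth) : SL(2, ℝ) → ℂ) = ext Φ + ext Ψ := rfl
    change lieDeriv X (Φ + Ψ : Smooth) g = lieDeriv X Φ g + lieDeriv X Ψ g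
    rw [lieDeriv_eq, lieDeriv_eq, lieDeriv_eq, h,
      fderiv_add (differentiableAt_ext Φ (pt_mem g)) (differentiableAt_ext Ψ (pt_mem g))]
    rfl
  map_smul' c Φ := by
    apply Subtype.ext
    funext g
    have h : ext ((c • Φ : Smooth) : SL(2, ℝ) → ℂ) = c • ext Φ := rfl
    change lieDeriv X (c • Φ : Smooth) g = c • lieDeriv X Φ g
    rw [lieDeriv_eq, lieDeriv_eq, h, fderiv_const_smul (differentiableAt_ext Φ (pt_mem g))]
    rfl

theorem lieD_apply (X : sl2R) (Φ : Smooth) (g : SL(2, ℝ)) :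
    (lieD X Φ : SL(2, ℝ) → ℂ) g = fderiv ℝ (ext Φ) (pt g) (mulR X (pt g)) :=
  lieDeriv_eq X Φ g

theorem lieD_add (X Y : sl2R) : lieD (X + Y) = lieD X + lieD Y := by
  refine LinearMap.ext fun Φ => Subtype.ext (funext fun g => ?_)
  change (lieD (X + Y) Φ : SL(2, ℝ) → ℂ) g =
    (lieD X Φ : SL(2, ℝ) → ℂ) g + (lieD Y Φ : SL(2, ℝ) → ℂ) g
  rw [lieD_apply, lieD_apply, lieD_apply, ← map_add]
  congr 1
  funext i j
  simp [mulR_apply]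
  ring

theorem lieD_smul (c : ℝ) (X : sl2R) : lieD (c • X) = (c : ℂ) • lieD X := by
  refine LinearMap.ext fun Φ => Subtype.ext (funext fun g => ?_)
  change (lieD (c • X) Φ : SL(2, ℝ) → ℂ) g = (c : ℂ) * (lieD X Φ : SL(2, ℝ) → ℂ) g
  rw [lieD_apply, lieD_apply, ← Complex.real_smul, ← map_smul]
  congr 1
  funext i j
  simp [mulR_apply]
  ring

theorem lieD_lieD_apply (X Y : sl2R) (Φ : Smooth) (g : SL(2, ℝ)) :
    (lieD X (lieD Y Φ) : SL(2, ℝ) → ℂ) g =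
      fderiv ℝ (fderiv ℝ (ext Φ)) (pt g) (mulR X (pt g)) (mulR Y (pt g)) +
      fderiv ℝ (ext Φ) (pt g) (mulR Y (mulR X (pt g))) := by
  have hU := isOpen_posDet.mem_nhds (pt_mem g)
  have h1 : DifferentiableAt ℝ (fderiv ℝ (ext Φ)) (pt g) :=
    ((ContDiffOn.fderiv_of_isOpen (m := 1) Φ.2 isOpen_posDet
      (by norm_cast)).contDiffAt hU).differentiableAt (by simp)
  have h3 := h1.hasFDerivAt.clm_apply ((mulR Y.1).hasFDerivAt (x := pt g))
  have h4 : ext (lieD Y Φ : SL(2, ℝ) → ℂ) =ᶠ[nhds (pt g)]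
      fun A => fderiv ℝ (ext Φ) A (mulR Y A) := by
    filter_upwards [hU] with A hA
    exact ext_lieDeriv Y Φ hA
  rw [lieD_apply, (h4.hasFDerivAt_iff.2 h3).fderiv]
  exact add_comm _ _

theorem lieD_lie (X Y : sl2R) : lieD ⁅X, Y⁆ = lieD X * lieD Y - lieD Y * lieD X := by
  refine LinearMap.ext fun Φ => Subtype.ext (funext fun g => ?_)
  change (lieD ⁅X, Y⁆ Φ : SL(2, ℝ) → ℂ) g =
    (lieD X (lieD Y Φ) : SL(2, ℝ) → ℂ) g - (lieD Y (lieD X Φ) : SL(2, ℝ) → ℂ) g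
  have hs : IsSymmSndFDerivAt ℝ (ext Φ) (pt g) :=
    (Φ.2.contDiffAt (isOpen_posDet.mem_nhds (pt_mem g))).isSymmSndFDerivAt (by
      simp only [minSmoothness_of_isRCLikeNormedField]
      exact WithTop.coe_le_coe.2 le_top)
  rw [lieD_apply, lieD_lieD_apply, lieD_lieD_apply, hs (mulR X (pt g)) (mulR Y (pt g)),
    add_sub_add_left_eq_sub, ← map_sub]
  congr 1
  funext i j
  simp [mulR_apply, LieRing.of_associative_ring_bracket, Matrix.mul_apply]
  ring

theorem aux_smul {A : Type} [Ring A] [Algebra ℂ A] (c : ℂ) (a b : A) :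
    (c.re : ℂ) • a + ((-c.im : ℝ) : ℂ) • b + Complex.I • ((c.re : ℂ) • b + (c.im : ℂ) • a) =
      c • (a + Complex.I • b) := by
  conv_rhs => rw [← Complex.re_add_im c]
  have h : ∀ x : A, Complex.I • Complex.I • x = -x := fun x => by
    rw [smul_smul, Complex.I_mul_I, neg_one_smul]
  simp only [add_smul, mul_smul, smul_add, h, Complex.ofReal_neg, neg_smul, smul_neg]
  rw [smul_comm Complex.I (c.re : ℂ) b, smul_comm Complex.I (c.im : ℂ) a]
  abel

theorem aux_lie {A : Type} [Ring A] [Algebra ℂ A] (a b c d : A) :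
    (a * c - c * a) + ((-1 : ℝ) : ℂ) • (b * d - d * b) +
      Complex.I • ((a * d - d * a) + (b * c - c * b)) =
      (a + Complex.I • b) * (c + Complex.I • d) - (c + Complex.I • d) * (a + Complex.I • b) := by
  have h : ∀ x : A, Complex.I • Complex.I • x = -x := fun x => by
    rw [smul_smul, Complex.I_mul_I, neg_one_smul]
  simp only [mul_add, add_mul, smul_mul_assoc, mul_smul_comm, h, Complex.ofReal_neg,
    Complex.ofReal_one, neg_smul, one_smul, smul_add, smul_sub]
  abel

/-- The action of `Z = X + iY ∈ 𝔰𝔩₂(ℂ)` on smooth functions, `Z.Φ = X.Φ + i (Y.Φ)`. -/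
noncomputable def cLieD (Z : sl2C) : Module.End ℂ Smooth :=
  lieD (reSl Z) + Complex.I • lieD (imSl Z)

theorem reSl_add (Z W : sl2C) : reSl (Z + W) = reSl Z + reSl W := by
  apply Subtype.ext; ext i j; simp [reSl]

theorem imSl_add (Z W : sl2C) : imSl (Z + W) = imSl Z + imSl W := by
  apply Subtype.ext; ext i j; simp [imSl]

theorem reSl_smul (c : ℂ) (Z : sl2C) : reSl (c • Z) = c.re • reSl Z + (-c.im) • imSl Z := by
  apply Subtype.ext; ext i j; simp [reSl, imSl]; ring

theorem imSl_smul (c : ℂ) (Z : sl2C) : imSl (c • Z) = c.re • imSl Z + c.im • reSl Z := by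
  apply Subtype.ext; ext i j; simp [reSl, imSl]

theorem reSl_lie (Z W : sl2C) :
    reSl ⁅Z, W⁆ = ⁅reSl Z, reSl W⁆ + (-1 : ℝ) • ⁅imSl Z, imSl W⁆ := by
  apply Subtype.ext; ext i j
  simp [reSl, imSl, LieRing.of_associative_ring_bracket, Matrix.mul_apply]; ring

theorem imSl_lie (Z W : sl2C) : imSl ⁅Z, W⁆ = ⁅reSl Z, imSl W⁆ + ⁅imSl Z, reSl W⁆ := by
  apply Subtype.ext; ext i j
  simp [reSl, imSl, LieRing.of_associative_ring_bracket, Matrix.mul_apply]; ring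

/-- The action of `𝔰𝔩₂(ℂ)` on smooth functions as a homomorphism of Lie algebras. -/
noncomputable def cLieHom : sl2C →ₗ⁅ℂ⁆ Module.End ℂ Smooth where
  toFun := cLieD
  map_add' Z W := by
    simp only [cLieD, reSl_add, imSl_add, lieD_add, smul_add]
    abel
  map_smul' c Z := by
    simp only [cLieD, reSl_smul, imSl_smul, lieD_add, lieD_smul]
    exact aux_smul c (lieD (reSl Z)) (lieD (imSl Z))
  map_lie' := by
    intro Z W
    simp only [cLieD, reSl_lie, imSl_lie, lieD_add, lieD_smul, lieD_lie]
    exact aux_lie (lieD (reSl Z)) (lieD (imSl Z)) (lieD (reSl W)) (lieD (imSl W))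

noncomputable instance : LieRingModule sl2C Smooth := LieRingModule.compLieHom Smooth cLieHom

noncomputable instance : LieModule ℂ sl2C Smooth := LieModule.compLieHom Smooth cLieHom

theorem lie_smooth_apply (Z : sl2C) (Φ : Smooth) (g : SL(2, ℝ)) :
    (⁅Z, Φ⁆ : Smooth).1 g = lieDeriv (reSl Z) Φ g + Complex.I * lieDeriv (imSl Z) Φ g := rfl

theorem rightTrans_mem (h : SL(2, ℝ)) (Φ : Smooth) : (fun g => Φ.1 (g * h)) ∈ Smooth := by
  have hd : ∀ A : M2, (of (mulR h.1 A)).det = (of A).det := fun A => by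
    have : (of A * h.1).det = (of A).det := by rw [det_mul, h.2, mul_one]
    exact this
  have hm : Set.MapsTo (mulR h.1) posDet posDet := fun A hA => by
    change 0 < (of (mulR h.1 A)).det
    rw [hd]
    exact hA
  refine (Φ.2.comp (mulR h.1).contDiff.contDiffOn hm).congr fun A hA => ?_
  have hA' : 0 < (of A).det := hA
  change Φ.1 (normalize A * h) = Φ.1 (normalize (mulR h.1 A))
  have he : normalize A * h = normalize (mulR h.1 A) := by
    apply Subtype.ext
    rw [normalize_val (by rw [hd]; exact hA'), hd]
    change (normalize A).1 * h.1 = _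
    rw [normalize_val hA', Matrix.smul_mul]
    rfl
  rw [he]

/-- Right translation of smooth functions, `(h.Φ)(g) = Φ(gh)`. -/
def rightTrans : Representation ℂ SL(2, ℝ) Smooth where
  toFun h :=
    { toFun := fun Φ => ⟨fun g => Φ.1 (g * h), rightTrans_mem h Φ⟩
      map_add' := fun _ _ => rfl
      map_smul' := fun _ _ => rfl }
  map_one' := by
    refine LinearMap.ext fun Φ => Subtype.ext (funext fun g => ?_)
    change Φ.1 (g * 1) = Φ.1 g
    rw [mul_one]
  map_mul' h h' := by
    refine LinearMap.ext fun Φ => Subtype.ext (funext fun g => ?_)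
    change Φ.1 (g * (h * h')) = Φ.1 (g * h * h')
    rw [mul_assoc]

/-! ### `(𝔤, K)`-modules -/

/-- The maximal compact subgroup `K = SO(2)`. -/
def SO2 : Subgroup SL(2, ℝ) where
  carrier := {g | g.1 * g.1ᵀ = 1}
  one_mem' := by simp
  mul_mem' {a b} ha hb := by
    change (a.1 * b.1) * (a.1 * b.1)ᵀ = 1
    have hb' : b.1 * b.1ᵀ = 1 := hb
    rw [transpose_mul, mul_assoc, ← mul_assoc b.1, hb', one_mul]
    exact ha
  inv_mem' {a} ha := by
    have h1 : a.1 * (a⁻¹).1 = 1 := congrArg Subtype.val (mul_inv_cancel a)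
    have h2 : a.1ᵀ * a.1 = 1 := mul_eq_one_comm.1 ha
    have h3 : (a⁻¹).1 = a.1ᵀ := by
      calc (a⁻¹).1 = (a.1ᵀ * a.1) * (a⁻¹).1 := by rw [h2, one_mul]
        _ = a.1ᵀ := by rw [mul_assoc, h1, mul_one]
    change (a⁻¹).1 * (a⁻¹).1ᵀ = 1
    rw [h3, transpose_transpose, h2]

/-- The rotation `r(θ) = (cos θ, sin θ; -sin θ, cos θ)`. -/
noncomputable def rot (θ : ℝ) : SO2 :=
  ⟨⟨!![Real.cos θ, Real.sin θ; -Real.sin θ, Real.cos θ], by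
    rw [det_fin_two_of]; nlinarith [Real.sin_sq_add_cos_sq θ]⟩, by
    change !![Real.cos θ, Real.sin θ; -Real.sin θ, Real.cos θ] *
      !![Real.cos θ, Real.sin θ; -Real.sin θ, Real.cos θ]ᵀ = 1
    have h := Real.sin_sq_add_cos_sq θ
    ext i j
    fin_cases i <;> fin_cases j <;> simp [Matrix.mul_apply] <;> nlinarith⟩

/-- The adjoint action of `SL₂(ℝ)` on `𝔰𝔩₂(ℂ)`, `Ad(g) Z = g Z g⁻¹`. -/
def Ad (g : SL(2, ℝ)) (Z : sl2C) : sl2C :=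
  ⟨g.1.map Complex.ofReal * Z.1 * (g⁻¹).1.map Complex.ofReal, by
    have h : (g⁻¹).1.map Complex.ofReal * g.1.map Complex.ofReal = 1 := by
      have h1 : (g⁻¹).1 * g.1 = 1 := congrArg Subtype.val (inv_mul_cancel g)
      have h2 := congrArg (fun M : Matrix (Fin 2) (Fin 2) ℝ => M.map Complex.ofRealHom) h1
      simp only [Matrix.map_mul, Matrix.map_one _ (map_zero Complex.ofRealHom)
        (map_one Complex.ofRealHom)] at h2
      exact h2
    rw [mem_sl2C, ← trace_fin_two, trace_mul_comm, ← mul_assoc, h, one_mul, trace_fin_two]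
    exact mem_sl2C.1 Z.2⟩

/-- A complex vector space `V` with a representation of the Lie algebra `𝔤_ℂ = 𝔰𝔩₂(ℂ)` and a
representation `ρ` of `K = SO(2)` is a `(𝔤, K)`-module if every vector is `K`-finite, the two
actions are compatible with the adjoint action of `K` on `𝔤_ℂ`, and `K` acts differentiably with
derivative the action of the Lie algebra of `K` (which is spanned by `iH = d/dθ r(θ)` at `θ = 0`).
As the span of `K v` is finite-dimensional, the derivative can be tested on linear forms. -/
structure IsGKModule {V : Type} [AddCommGroup V] [Module ℂ V] [LieRingModule sl2C V]
    [LieModule ℂ sl2C V] (ρ : Representation ℂ SO2 V) : Prop where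
  kFinite : ∀ v : V, FiniteDimensional ℂ (Submodule.span ℂ (Set.range fun k : SO2 => ρ k v))
  compat : ∀ (k : SO2) (Z : sl2C) (v : V), ρ k ⁅Z, v⁆ = ⁅Ad k Z, ρ k v⁆
  deriv : ∀ (v : V) (φ : Module.Dual ℂ V),
    HasDerivAt (fun θ : ℝ => φ (ρ (rot θ) v)) (φ ⁅Complex.I • Hel, v⁆) 0

/-- An isomorphism of `(𝔤, K)`-modules: a linear isomorphism that commutes with both actions. -/
structure GKEquiv {V W : Type} [AddCommGroup V] [Module ℂ V] [LieRingModule sl2C V]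
    [AddCommGroup W] [Module ℂ W] [LieRingModule sl2C W]
    (ρ : Representation ℂ SO2 V) (σ : Representation ℂ SO2 W) extends V ≃ₗ[ℂ] W where
  map_lie : ∀ (Z : sl2C) (v : V), toLinearEquiv ⁅Z, v⁆ = ⁅Z, toLinearEquiv v⁆
  map_K : ∀ (k : SO2) (v : V), toLinearEquiv (ρ k v) = σ k (toLinearEquiv v)

/-- A space of smooth functions on `SL₂(ℝ)` that is stable under `𝔤_ℂ` and under right translation
by `K`. -/
structure GKSubmodule extends LieSubmodule ℂ sl2C Smooth where
  K_mem : ∀ (k : SO2) (Φ : Smooth), Φ ∈ carrier → rightTrans k Φ ∈ carrier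

/-- The action of `K` on a stable space of smooth functions. -/
def GKSubmodule.rep (V : GKSubmodule) : Representation ℂ SO2 V.toLieSubmodule where
  toFun k := (rightTrans k).restrict (V.K_mem k)
  map_one' := by
    refine LinearMap.ext fun v => Subtype.ext ?_
    change rightTrans ((1 : SO2) : SL(2, ℝ)) v.1 = v.1
    rw [Subgroup.coe_one, map_one]
    rfl
  map_mul' k k' := by
    refine LinearMap.ext fun v => Subtype.ext ?_
    change rightTrans ((k * k' : SO2) : SL(2, ℝ)) v.1 = rightTrans k (rightTrans k' v.1)
    rw [Subgroup.coe_mul, map_mul]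
    rfl

/-! ### The lowest weight modules `𝒟_{p,+}` -/

/-- The underlying space of `𝒟_{p,+}` (discrete series for `p ≥ 1`, limit of discrete series for
`p = 0`), the irreducible `(𝔤, K)`-module with weights `p + 1, p + 3, p + 5, …`, each of
multiplicity one. It has the basis `v₀, v₁, v₂, …`, where `vₙ` has weight `p + 1 + 2n`. It is
irreducible because `R vₙ = v_{n+1}` and `L vₙ` is a non-zero multiple of `v_{n-1}` for `n ≥ 1`. -/
def DiscreteSeries (_p : ℕ) : Type := ℕ →₀ ℂ

namespace DiscreteSeries

noncomputable instance (p : ℕ) : AddCommGroup (DiscreteSeries p) :=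
  inferInstanceAs (AddCommGroup (ℕ →₀ ℂ))

noncomputable instance (p : ℕ) : Module ℂ (DiscreteSeries p) :=
  inferInstanceAs (Module ℂ (ℕ →₀ ℂ))

/-- The basis vector `vₙ`, as a linear map `c ↦ c vₙ`. -/
noncomputable def vec (p n : ℕ) : ℂ →ₗ[ℂ] DiscreteSeries p := Finsupp.lsingle n

/-- The linear operator with `vₙ ↦ c n • v_{s n}`. -/
noncomputable def op (p : ℕ) (c : ℕ → ℂ) (s : ℕ → ℕ) : Module.End ℂ (DiscreteSeries p) :=
  Finsupp.lsum ℂ fun n => c n • vec p (s n)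

theorem op_vec (p : ℕ) (c : ℕ → ℂ) (s : ℕ → ℕ) (n : ℕ) (z : ℂ) :
    op p c s (vec p n z) = vec p (s n) (c n * z) := by
  have : op p c s (vec p n z) = c n • vec p (s n) z := Finsupp.sum_single_index (by simp)
  rw [this, ← map_smul, smul_eq_mul]

theorem hom_ext (p : ℕ) {f g : Module.End ℂ (DiscreteSeries p)}
    (h : ∀ n, f (vec p n 1) = g (vec p n 1)) : f = g :=
  Finsupp.lhom_ext' fun n => LinearMap.ext_ring (h n)

/-- `H vₙ = (p + 1 + 2n) vₙ`. -/
noncomputable def opH (p : ℕ) : Module.End ℂ (DiscreteSeries p) :=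
  op p (fun n => (p + 1 + 2 * n : ℂ)) id

/-- `R vₙ = v_{n+1}`. -/
noncomputable def opR (p : ℕ) : Module.End ℂ (DiscreteSeries p) :=
  op p (fun _ => 1) (fun n => n + 1)

/-- `L vₙ = -n (p + n) v_{n-1}`, in particular `L v₀ = 0`. -/
noncomputable def opL (p : ℕ) : Module.End ℂ (DiscreteSeries p) :=
  op p (fun n => -(n * (p + n) : ℂ)) (fun n => n - 1)

theorem opH_opR (p : ℕ) : opH p * opR p - opR p * opH p = (2 : ℂ) • opR p := by
  refine hom_ext p fun n => ?_
  simp only [opH, opR, LinearMap.sub_apply, Module.End.mul_apply, LinearMap.smul_apply, op_vec,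
    ← map_smul, ← map_sub, id]
  congr 1
  push_cast
  simp only [smul_eq_mul]
  ring

theorem opH_opL (p : ℕ) : opH p * opL p - opL p * opH p = (-2 : ℂ) • opL p := by
  refine hom_ext p fun n => ?_
  simp only [opH, opL, LinearMap.sub_apply, Module.End.mul_apply, LinearMap.smul_apply, op_vec,
    ← map_smul, ← map_sub, id]
  congr 1
  rcases n with _ | n
  · simp
  · simp only [Nat.add_sub_cancel, smul_eq_mul]
    push_cast
    ring

theorem opR_opL (p : ℕ) : opR p * opL p - opL p * opR p = opH p := by
  refine hom_ext p fun n => ?_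
  simp only [opH, opR, opL, LinearMap.sub_apply, Module.End.mul_apply, op_vec, id]
  rcases n with _ | n
  · simp
  · simp only [Nat.add_sub_cancel, ← map_sub]
    congr 1
    push_cast
    ring

theorem aux_lie_HRL {A : Type} [Ring A] [Algebra ℂ A] {H R L : A} (h1 : H * R - R * H = (2 : ℂ) • R)
    (h2 : H * L - L * H = (-2 : ℂ) • L) (h3 : R * L - L * R = H) (a b c a' b' c' : ℂ) :
    (a • H + b • R + c • L) * (a' • H + b' • R + c' • L) -
      (a' • H + b' • R + c' • L) * (a • H + b • R + c • L) =
    (b * c' - c * b') • H + (2 * (a * b' - b * a')) • R + (-2 * (a * c' - c * a')) • L := by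
  have e : (a • H + b • R + c • L) * (a' • H + b' • R + c' • L) -
      (a' • H + b' • R + c' • L) * (a • H + b • R + c • L) =
      (a * b' - b * a') • (H * R - R * H) + (a * c' - c * a') • (H * L - L * H) +
        (b * c' - c * b') • (R * L - L * R) := by
    simp only [mul_add, add_mul, smul_mul_assoc, mul_smul_comm]
    module
  rw [e, h1, h2, h3]
  module

/-- The action of `𝔰𝔩₂(ℂ)` on `𝒟_{p,+}`: the element `a H + b R + c L` acts by
`a opH + b opR + c opL`. For `Z = (z₀₀ z₀₁; z₁₀ -z₀₀)` the coefficients are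
`a = i (z₀₁ - z₁₀) / 2`, `b = z₀₀ - i (z₀₁ + z₁₀) / 2`, `c = z₀₀ + i (z₀₁ + z₁₀) / 2`. -/
noncomputable def lieHom (p : ℕ) : sl2C →ₗ⁅ℂ⁆ Module.End ℂ (DiscreteSeries p) where
  toFun Z := (Complex.I * (Z.1 0 1 - Z.1 1 0) / 2) • opH p +
    (Z.1 0 0 - Complex.I * (Z.1 0 1 + Z.1 1 0) / 2) • opR p +
    (Z.1 0 0 + Complex.I * (Z.1 0 1 + Z.1 1 0) / 2) • opL p
  map_add' Z W := by
    have h : ∀ i j, (Z + W).1 i j = Z.1 i j + W.1 i j := fun _ _ => rfl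
    simp only [h]
    module
  map_smul' t Z := by
    have h : ∀ i j, (t • Z).1 i j = t * Z.1 i j := fun _ _ => rfl
    simp only [h, RingHom.id_apply]
    module
  map_lie' := by
    intro Z W
    have hZ : Z.1 1 1 = - Z.1 0 0 := by linear_combination mem_sl2C.1 Z.2
    have hW : W.1 1 1 = - W.1 0 0 := by linear_combination mem_sl2C.1 W.2
    refine Eq.trans ?_ (aux_lie_HRL (opH_opR p) (opH_opL p) (opR_opL p) _ _ _ _ _ _).symm
    have hI := Complex.I_mul_I
    congr 1
    · congr 1
      · congr 1
        simp [LieRing.of_associative_ring_bracket, Matrix.mul_apply, hZ, hW]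
        ring
      · congr 1
        simp [LieRing.of_associative_ring_bracket, Matrix.mul_apply, hZ, hW]
        linear_combination (Z.1 0 1 * W.1 1 0 - Z.1 1 0 * W.1 0 1) * hI
    · congr 1
      simp [LieRing.of_associative_ring_bracket, Matrix.mul_apply, hZ, hW]
      linear_combination (Z.1 0 1 * W.1 1 0 - Z.1 1 0 * W.1 0 1) * hI

theorem lieHom_Hel (p : ℕ) : lieHom p Hel = opH p := by
  change (Complex.I * (-Complex.I - Complex.I) / 2) • opH p +
    (0 - Complex.I * (-Complex.I + Complex.I) / 2) • opR p +
    (0 + Complex.I * (-Complex.I + Complex.I) / 2) • opL p = opH p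
  have h : Complex.I * (-Complex.I - Complex.I) / 2 = 1 := by
    linear_combination (-1) * Complex.I_mul_I
  simp [h]

theorem lieHom_Rel (p : ℕ) : lieHom p Rel = opR p := by
  change (Complex.I * (Complex.I / 2 - Complex.I / 2) / 2) • opH p +
    (1 / 2 - Complex.I * (Complex.I / 2 + Complex.I / 2) / 2) • opR p +
    (1 / 2 + Complex.I * (Complex.I / 2 + Complex.I / 2) / 2) • opL p = opR p
  have h1 : 1 / 2 - Complex.I * (Complex.I / 2 + Complex.I / 2) / 2 = 1 := by
    linear_combination (-1 / 2) * Complex.I_mul_I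
  have h2 : 1 / 2 + Complex.I * (Complex.I / 2 + Complex.I / 2) / 2 = 0 := by
    linear_combination (1 / 2) * Complex.I_mul_I
  rw [h1, h2]
  simp

theorem lieHom_Lel (p : ℕ) : lieHom p Lel = opL p := by
  change (Complex.I * (-Complex.I / 2 - -Complex.I / 2) / 2) • opH p +
    (1 / 2 - Complex.I * (-Complex.I / 2 + -Complex.I / 2) / 2) • opR p +
    (1 / 2 + Complex.I * (-Complex.I / 2 + -Complex.I / 2) / 2) • opL p = opL p
  have h1 : 1 / 2 - Complex.I * (-Complex.I / 2 + -Complex.I / 2) / 2 = 0 := by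
    linear_combination (1 / 2) * Complex.I_mul_I
  have h2 : 1 / 2 + Complex.I * (-Complex.I / 2 + -Complex.I / 2) / 2 = 1 := by
    linear_combination (-1 / 2) * Complex.I_mul_I
  rw [h1, h2]
  simp

noncomputable instance (p : ℕ) : LieRingModule sl2C (DiscreteSeries p) :=
  LieRingModule.compLieHom _ (lieHom p)

noncomputable instance (p : ℕ) : LieModule ℂ sl2C (DiscreteSeries p) :=
  LieModule.compLieHom _ (lieHom p)

end DiscreteSeries

theorem SO2_entries (k : SO2) : k.1.1 1 1 = k.1.1 0 0 ∧ k.1.1 1 0 = -k.1.1 0 1 := by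
  have h1 : k.1.1 * k.1.1ᵀ = 1 := k.2
  have hd := k.1.2
  rw [det_fin_two] at hd
  have e1 := congrFun (congrFun h1 0) 0
  have e2 := congrFun (congrFun h1 0) 1
  simp only [Matrix.mul_apply, Fin.sum_univ_two, transpose_apply, one_apply_eq,
    one_apply_ne (zero_ne_one : (0 : Fin 2) ≠ 1)] at e1 e2
  generalize k.1.1 0 0 = a, k.1.1 0 1 = b, k.1.1 1 0 = c, k.1.1 1 1 = d at *
  constructor
  · linear_combination (-d) * e1 + a * hd + b * e2
  · linear_combination (-c) * e1 + a * e2 - b * hd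

/-- The character `r(θ) ↦ e^{iθ}` of `SO(2)`. -/
noncomputable def chi : SO2 →* ℂ where
  toFun k := k.1.1 0 0 + Complex.I * k.1.1 0 1
  map_one' := by simp
  map_mul' k k' := by
    obtain ⟨h1, h2⟩ := SO2_entries k'
    have e : ∀ i j, (k * k').1.1 i j = k.1.1 i 0 * k'.1.1 0 j + k.1.1 i 1 * k'.1.1 1 j := by
      intro i j
      change (k.1.1 * k'.1.1) i j = _
      simp [Matrix.mul_apply]
    rw [e, e, h1, h2]
    push_cast
    linear_combination (-(k.1.1 0 1 : ℂ) * k'.1.1 0 1) * Complex.I_mul_I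

theorem chi_rot (θ : ℝ) : chi (rot θ) = Complex.exp (Complex.I * θ) := by
  change ((Real.cos θ : ℝ) : ℂ) + Complex.I * ((Real.sin θ : ℝ) : ℂ) = _
  rw [mul_comm Complex.I (θ : ℂ), Complex.exp_mul_I]
  push_cast
  ring

/-- The action of `K` on `𝒟_{p,+}`, `r(θ) vₙ = e^{i (p + 1 + 2n) θ} vₙ`. -/
noncomputable def DiscreteSeries.rep (p : ℕ) : Representation ℂ SO2 (DiscreteSeries p) where
  toFun k := op p (fun n => chi k ^ (p + 1 + 2 * n)) id
  map_one' := hom_ext p fun n => by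
    rw [op_vec, map_one, one_pow, one_mul]
    rfl
  map_mul' k k' := hom_ext p fun n => by
    rw [Module.End.mul_apply, op_vec, op_vec, op_vec, map_mul chi, mul_pow, mul_one, mul_one]
    rfl

/-- The direct sum of the `(𝔤, K)`-modules `𝒟_{p i,+}`, as a representation of `K`. (The action of
the Lie algebra on the direct sum is also defined summand by summand.) -/
noncomputable def sumRep {ι : Type} (p : ι → ℕ) :
    Representation ℂ SO2 (⨁ i, DiscreteSeries (p i)) :=
  Representation.directSum fun i => DiscreteSeries.rep (p i)

/-! ### Automorphic forms -/

/-- A congruence subgroup of `SL₂(ℚ)`: a subgroup that contains some principal congruence subgroup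
`Γ(N)`, `N ≥ 1`, with finite index. -/
def IsCongruence (Γ : Subgroup SL(2, ℚ)) : Prop :=
  ∃ N : ℕ, 0 < N ∧
    (CongruenceSubgroup.Gamma N).map (SpecialLinearGroup.map (Int.castRingHom ℚ)) ≤ Γ ∧
    ((CongruenceSubgroup.Gamma N).map (SpecialLinearGroup.map (Int.castRingHom ℚ))).relIndex Γ ≠ 0

/-- The inclusion `SL₂(ℚ) → SL₂(ℝ)`. -/
noncomputable def toReal : SL(2, ℚ) →* SL(2, ℝ) := SpecialLinearGroup.map (algebraMap ℚ ℝ)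

/-- The unipotent matrix `(1 x; 0 1)`. -/
def nMat {F : Type} [Field F] (x : F) : SL(2, F) := ⟨!![1, x; 0, 1], by simp [det_fin_two_of]⟩

/-- The diagonal matrix `(y^{1/2} 0; 0 y^{-1/2})` for `y > 0`. -/
noncomputable def aMat (y : ℝ) (hy : 0 < y) : SL(2, ℝ) :=
  ⟨!![Real.sqrt y, 0; 0, (Real.sqrt y)⁻¹], by
    rw [det_fin_two_of, mul_inv_cancel₀ (Real.sqrt_pos.2 hy).ne']; ring⟩

/-- The norm `‖g‖ = tr(gᵗ g)^{1/2}` on `SL₂(ℝ)`. -/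
noncomputable def slNorm (g : SL(2, ℝ)) : ℝ := Real.sqrt (g.1ᵀ * g.1).trace

theorem one_le_slNorm (g : SL(2, ℝ)) : 1 ≤ slNorm g := by
  have hd := g.2
  rw [det_fin_two] at hd
  rw [slNorm, Real.one_le_sqrt, trace_fin_two]
  simp only [Matrix.mul_apply, Fin.sum_univ_two, transpose_apply]
  nlinarith [sq_nonneg (g.1 0 0 - g.1 1 1), sq_nonneg (g.1 0 1 + g.1 1 0)]

/-- Left invariance under `Γ`. -/
def leftInvariant (Γ : Subgroup SL(2, ℚ)) : Submodule ℂ Smooth where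
  carrier := {Φ | ∀ γ ∈ Γ, ∀ g, Φ.1 (toReal γ * g) = Φ.1 g}
  add_mem' {Φ Ψ} h h' γ hγ g := by
    change Φ.1 _ + Ψ.1 _ = Φ.1 _ + Ψ.1 _
    rw [h γ hγ, h' γ hγ]
  zero_mem' _ _ _ := rfl
  smul_mem' c Φ h γ hγ g := by
    change c • Φ.1 _ = c • Φ.1 _
    rw [h γ hγ]

/-- The span of the translates of `Φ` under `K`. -/
def kOrbit (Φ : Smooth) : Submodule ℂ Smooth :=
  Submodule.span ℂ (Set.range fun k : SO2 => rightTrans k Φ)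

/-- `K`-finite functions. -/
def kFinite : Submodule ℂ Smooth where
  carrier := {Φ | FiniteDimensional ℂ (kOrbit Φ)}
  add_mem' {Φ Ψ} h h' := by
    have : FiniteDimensional ℂ (kOrbit Φ) := h
    have : FiniteDimensional ℂ (kOrbit Ψ) := h'
    refine Submodule.finiteDimensional_of_le (S₂ := kOrbit Φ ⊔ kOrbit Ψ) ?_
    refine Submodule.span_le.2 ?_
    rintro _ ⟨k, rfl⟩
    change rightTrans k (Φ + Ψ) ∈ _
    rw [map_add]
    exact Submodule.add_mem_sup (Submodule.subset_span ⟨k, rfl⟩) (Submodule.subset_span ⟨k, rfl⟩)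
  zero_mem' := by
    refine Submodule.finiteDimensional_of_le (S₂ := (⊥ : Submodule ℂ Smooth)) ?_
    refine Submodule.span_le.2 ?_
    rintro _ ⟨k, rfl⟩
    exact map_zero (rightTrans k)
  smul_mem' c Φ h := by
    have : FiniteDimensional ℂ (kOrbit Φ) := h
    refine Submodule.finiteDimensional_of_le (S₂ := kOrbit Φ) ?_
    refine Submodule.span_le.2 ?_
    rintro _ ⟨k, rfl⟩
    change rightTrans k (c • Φ) ∈ _
    rw [map_smul]
    exact Submodule.smul_mem _ _ (Submodule.subset_span ⟨k, rfl⟩)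

/-- The action of the universal enveloping algebra of `𝔤_ℂ` on smooth functions. -/
noncomputable def envAction :
    UniversalEnvelopingAlgebra ℂ sl2C →ₐ[ℂ] Module.End ℂ Smooth :=
  UniversalEnvelopingAlgebra.lift ℂ cLieHom

/-- The image of `Φ` under the center `𝒵` of the universal enveloping algebra of `𝔤_ℂ`. -/
noncomputable def zOrbit (Φ : Smooth) : Submodule ℂ Smooth :=
  (Subalgebra.toSubmodule (Subalgebra.center ℂ (UniversalEnvelopingAlgebra ℂ sl2C))).map
    (envAction.toLinearMap.flip Φ)

/-- `𝒵`-finite functions. -/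
noncomputable def zFinite : Submodule ℂ Smooth where
  carrier := {Φ | FiniteDimensional ℂ (zOrbit Φ)}
  add_mem' {Φ Ψ} h h' := by
    have : FiniteDimensional ℂ (zOrbit Φ) := h
    have : FiniteDimensional ℂ (zOrbit Ψ) := h'
    refine Submodule.finiteDimensional_of_le (S₂ := zOrbit Φ ⊔ zOrbit Ψ) ?_
    rintro _ ⟨z, hz, rfl⟩
    rw [map_add, LinearMap.add_apply]
    exact Submodule.add_mem_sup ⟨z, hz, rfl⟩ ⟨z, hz, rfl⟩
  zero_mem' := by
    refine Submodule.finiteDimensional_of_le (S₂ := (⊥ : Submodule ℂ Smooth)) ?_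
    rintro _ ⟨z, hz, rfl⟩
    rw [map_zero]
    exact Submodule.zero_mem _
  smul_mem' c Φ h := by
    have : FiniteDimensional ℂ (zOrbit Φ) := h
    refine Submodule.finiteDimensional_of_le (S₂ := zOrbit Φ) ?_
    rintro _ ⟨z, hz, rfl⟩
    rw [map_smul, LinearMap.smul_apply]
    exact Submodule.smul_mem _ _ ⟨z, hz, rfl⟩

/-- Slowly increasing functions. -/
def slowlyIncreasing : Submodule ℂ Smooth where
  carrier := {Φ | ∃ (C : ℝ) (N : ℕ), ∀ g, ‖Φ.1 g‖ ≤ C * slNorm g ^ N}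
  add_mem' := by
    rintro Φ Ψ ⟨C, N, h⟩ ⟨C', N', h'⟩
    refine ⟨|C| + |C'|, max N N', fun g => ?_⟩
    have h1 := one_le_slNorm g
    have a1 : slNorm g ^ N ≤ slNorm g ^ max N N' := pow_le_pow_right₀ h1 (le_max_left _ _)
    have a2 : slNorm g ^ N' ≤ slNorm g ^ max N N' := pow_le_pow_right₀ h1 (le_max_right _ _)
    have b1 : C * slNorm g ^ N ≤ |C| * slNorm g ^ max N N' :=
      mul_le_mul (le_abs_self C) a1 (by positivity) (abs_nonneg C)
    have b2 : C' * slNorm g ^ N' ≤ |C'| * slNorm g ^ max N N' :=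
      mul_le_mul (le_abs_self C') a2 (by positivity) (abs_nonneg C')
    calc ‖Φ.1 g + Ψ.1 g‖ ≤ ‖Φ.1 g‖ + ‖Ψ.1 g‖ := norm_add_le _ _
      _ ≤ (|C| + |C'|) * slNorm g ^ max N N' := by linarith [h g, h' g]
  zero_mem' := ⟨0, 0, fun g => by
    change ‖(0 : ℂ)‖ ≤ _
    simp⟩
  smul_mem' := by
    rintro c Φ ⟨C, N, h⟩
    refine ⟨‖c‖ * C, N, fun g => ?_⟩
    change ‖c * Φ.1 g‖ ≤ _
    rw [norm_mul, mul_assoc]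
    exact mul_le_mul_of_nonneg_left (h g) (norm_nonneg c)

/-- The space `𝒜(Γ)` of automorphic forms on `SL₂(ℝ)` with respect to `Γ`. -/
noncomputable def automorphicForms (Γ : Subgroup SL(2, ℚ)) : Submodule ℂ Smooth :=
  leftInvariant Γ ⊓ kFinite ⊓ zFinite ⊓ slowlyIncreasing

theorem continuous_nMat (Φ : Smooth) (a b : SL(2, ℝ)) :
    Continuous fun x : ℝ => Φ.1 (a * nMat x * b) := by
  have h1 : Continuous fun x : ℝ => pt (a * nMat x * b) := by
    refine continuous_pi fun i => continuous_pi fun j => ?_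
    change Continuous fun x : ℝ => (a.1 * !![1, x; 0, 1] * b.1) i j
    simp only [Matrix.mul_apply, Fin.sum_univ_two]
    simp
    fun_prop
  have h2 : (fun x : ℝ => Φ.1 (a * nMat x * b)) =
      ext Φ.1 ∘ fun x : ℝ => pt (a * nMat x * b) := by
    funext x
    simp only [Function.comp, ext, normalize_pt]
  rw [h2]
  exact Φ.2.continuousOn.comp_continuous h1 fun x => pt_mem _

/-- Functions all of whose constant terms vanish. The unipotent radicals of the proper parabolic
`ℚ`-subgroups of `SL₂` are the groups `N_σ = {σ (1 x; 0 1) σ⁻¹}` with `σ ∈ SL₂(ℚ)`. If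
`h > 0` is such that `σ (1 h; 0 1) σ⁻¹` lies in `Γ`, then the integral of a left `Γ`-invariant
function over `(Γ ∩ N_σ) \ N_σ` is, up to a positive factor, the integral over `0 ≤ x ≤ h`. -/
noncomputable def cuspidal (Γ : Subgroup SL(2, ℚ)) : Submodule ℂ Smooth where
  carrier := {Φ | ∀ (σ : SL(2, ℚ)) (h : ℚ), 0 < h → σ * nMat h * σ⁻¹ ∈ Γ → ∀ g : SL(2, ℝ),
    ∫ x in (0 : ℝ)..h, Φ.1 (toReal σ * nMat x * (toReal σ)⁻¹ * g) = 0}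
  add_mem' {Φ Ψ} hΦ hΨ σ h hh hσ g := by
    change ∫ x in (0 : ℝ)..h, (Φ.1 (toReal σ * nMat x * (toReal σ)⁻¹ * g) +
      Ψ.1 (toReal σ * nMat x * (toReal σ)⁻¹ * g)) = 0
    have c1 := continuous_nMat Φ (toReal σ) ((toReal σ)⁻¹ * g)
    have c2 := continuous_nMat Ψ (toReal σ) ((toReal σ)⁻¹ * g)
    simp only [← mul_assoc] at c1 c2
    rw [intervalIntegral.integral_add (c1.intervalIntegrable _ _) (c2.intervalIntegrable _ _),
      hΦ σ h hh hσ, hΨ σ h hh hσ, add_zero]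
  zero_mem' σ h hh hσ g := by
    change ∫ x in (0 : ℝ)..h, (0 : ℂ) = 0
    simp
  smul_mem' c Φ hΦ σ h hh hσ g := by
    change ∫ x in (0 : ℝ)..h, c • Φ.1 (toReal σ * nMat x * (toReal σ)⁻¹ * g) = 0
    rw [intervalIntegral.integral_smul, hΦ σ h hh hσ, smul_zero]

/-- `𝔫`-finite functions: `L^v Φ = 0` for large `v`. -/
noncomputable def nFinite : Submodule ℂ Smooth where
  carrier := {Φ | ∃ v : ℕ, (cLieHom Lel ^ v) Φ = 0}
  add_mem' := by
    rintro Φ Ψ ⟨v, h⟩ ⟨w, h'⟩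
    refine ⟨v + w, ?_⟩
    rw [map_add, pow_add, Module.End.mul_apply, Module.End.mul_apply, h', ← Module.End.mul_apply,
      ← pow_add, add_comm v w, pow_add, Module.End.mul_apply, h, map_zero, map_zero, add_zero]
  zero_mem' := ⟨0, map_zero _⟩
  smul_mem' := by
    rintro c Φ ⟨v, h⟩
    exact ⟨v, by rw [map_smul, h, smul_zero]⟩

/-- The space `𝒜(Γ)°_{𝔫-fin}` of `𝔫`-finite cusp forms. -/
noncomputable def nFiniteCuspForms (Γ : Subgroup SL(2, ℚ)) : Submodule ℂ Smooth :=
  automorphicForms Γ ⊓ cuspidal Γ ⊓ nFinite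

/-! ### Lowest weight vectors and holomorphic cusp forms -/

/-- The space `S_k(Γ)` of holomorphic cusp forms of weight `k`. -/
abbrev S (Γ : Subgroup SL(2, ℚ)) (k : ℤ) : Type :=
  CuspForm (Γ.map (SpecialLinearGroup.mapGL ℝ)) k

/-- The isotypical component of type `𝒟_{p,+}` of `V`: the sum of all sub-`(𝔤, K)`-modules of `V`
that are isomorphic to `𝒟_{p,+}`. -/
noncomputable def isotypic (V : GKSubmodule) (p : ℕ) : Submodule ℂ Smooth :=
  sSup {W | ∃ W' : GKSubmodule, W'.toSubmodule = W ∧ W ≤ V.toSubmodule ∧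
    Nonempty (GKEquiv W'.rep (DiscreteSeries.rep p))}

/-- The space of lowest weight vectors of weight `k` in `W` (together with `0`): the vectors `Φ`
of weight `k` such that `L.Φ = 0`. -/
noncomputable def lowestWeight (W : Submodule ℂ Smooth) (k : ℤ) : Submodule ℂ Smooth where
  carrier := {Φ | Φ ∈ W ∧ ⁅Lel, Φ⁆ = 0 ∧
    ∀ θ : ℝ, rightTrans (rot θ) Φ = Complex.exp (Complex.I * k * θ) • Φ}
  add_mem' := by
    rintro Φ Ψ ⟨h1, h2, h3⟩ ⟨h1', h2', h3'⟩
    exact ⟨add_mem h1 h1', by rw [lie_add, h2, h2', add_zero],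
      fun θ => by rw [map_add, h3, h3', smul_add]⟩
  zero_mem' := ⟨zero_mem _, lie_zero _, fun θ => by rw [map_zero, smul_zero]⟩
  smul_mem' := by
    rintro c Φ ⟨h1, h2, h3⟩
    exact ⟨W.smul_mem c h1, by rw [lie_smul, h2, smul_zero],
      fun θ => by rw [map_smul, h3, smul_comm]⟩

/-- The function `Φ̃(x + iy) = y^{-k/2} Φ((1 x; 0 1) (y^{1/2} 0; 0 y^{-1/2}))` on the upper half
plane attached to a function `Φ` of weight `k`. -/
noncomputable def tilde (k : ℤ) (Φ : SL(2, ℝ) → ℂ) (τ : UpperHalfPlane) : ℂ :=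
  ((τ.im ^ (-(k : ℝ) / 2) : ℝ) : ℂ) * Φ (nMat τ.re * aMat τ.im τ.im_pos)

end AutSL2

/-! The proof has an analytic half, which makes the `𝔫`-finite cusp forms a `(𝔤, K)`-module and
identifies its lowest weight vectors, and an algebraic half, which rebuilds the module from these
vectors.

Since `K` is a circle, the infinitesimal generator of `K` acts on a `K`-finite function without
Jordan blocks and with eigenvalues in `iℤ`, so such a function is a sum of weight vectors
(`mem_iSup_wt_inf_krylov`). A vector `Φ` of weight `n` is determined by its function `pull n Φ` on
the upper half plane, and there `L` becomes `y² (∂_y - i ∂_x)`, a multiple of `∂/∂z̄`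
(`exists_hasPartials_pull`). Hence `L Φ = 0` means that this function is holomorphic, and `L^v Φ =
0` that it is a polynomial of degree `< v` in `1/y` with holomorphic coefficients
(`exists_pull_eq_sum`). The delicate point of `𝔤`-stability is slow increase. Moderate growth of
such a polynomial passes to its coefficients by the maximum principle (`moderate_leading`), then to
their derivatives by Cauchy's estimate, and so to `L Φ` and `R Φ`.

For a lowest weight vector, left invariance is modularity of the attached holomorphic function.
Moderate growth makes the singularity at `q = 0` removable at each cusp, and the vanishing constant
term says that the value there is zero (`isZeroAtImInfty_of_growth`). Conversely a cusp form `f`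
lifts to `g ↦ (f|g)(i)`: the bound `|f| ≤ C y^{-k/2}` gives slow increase, the zeroth Fourier
coefficient gives cuspidality, and the center acts by scalars (`mem_zFinite_of_lowestWeight`). This
yields `lowestWeightEquiv`. In weight `≤ 0` there are no cusp forms, hence no lowest weight vectors
(`lowestWeight_eq_bot`).

Algebraically, a lowest weight vector `φ ≠ 0` of weight `p + 1` satisfies `L Rⁿ φ = -n (p + n)
R^{n-1} φ` with non-zero factors for `n ≥ 1`, so it generates a copy of `𝒟_{p,+}`. The map from the
direct sum over a basis of lowest weight vectors is injective because injectivity can be tested on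
the kernel of `L` (`sumMap_injective`). It is surjective because a multiple of `R^v L^v Φ` can be
subtracted from `Φ` to lower its order of `L`-nilpotency (`le_range_sumMap`).

Finite-dimensionality of `S_ℓ(Γ)` is the Sturm bound: the norm of a form down to level one decays at
infinity as fast as the form itself, so enough vanishing `q`-coefficients force the norm, and then
the form, to vanish (`eq_zero_of_qExpansion_coeff`). -/

namespace AutSL2

open Matrix

/-! ### The action of `K` and weight spaces -/

/-- The scalar multiplication that underlies the module structure of `Smooth`, as a shortcut. -/
noncomputable instance smoothSMul : SMul ℂ Smooth := Module.toDistribMulAction.toSMul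

/-- The generator `(0 1; -1 0)` of the Lie algebra of `K`. -/
def kGen : sl2R := ⟨!![0, 1; -1, 0], mem_sl2R.2 (by simp)⟩

theorem hasDerivAt_rot (Φ : Smooth) (g : SL(2, ℝ)) (θ : ℝ) :
    HasDerivAt (fun t : ℝ => Φ.1 (g * rot t)) ((lieD kGen Φ).1 (g * rot θ)) θ := by
  have h0 : HasDerivAt (fun t : ℝ => pt (g * rot t)) (mulR kGen.1 (pt (g * rot θ))) θ := by
    refine hasDerivAt_pi.2 fun i => hasDerivAt_pi.2 fun j => ?_
    have e : ∀ t j, pt (g * rot t) i j = g.1 i 0 * (rot t).1.1 0 j + g.1 i 1 * (rot t).1.1 1 j := by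
      intro t j
      change (g.1 * (rot t).1.1) i j = _
      simp [Matrix.mul_apply]
    rw [mulR_apply]
    simp only [e]
    have hc := Real.hasDerivAt_cos θ
    have hs := Real.hasDerivAt_sin θ
    fin_cases j
    · refine ((hc.const_mul (g.1 i 0)).add (hs.neg.const_mul (g.1 i 1))).congr_deriv ?_
      simp [rot, kGen]
      ring
    · refine ((hs.const_mul (g.1 i 0)).add (hc.const_mul (g.1 i 1))).congr_deriv ?_
      simp [rot, kGen]
  have hd := (differentiableAt_ext Φ (pt_mem (g * rot θ))).hasFDerivAt
  have h1 := hd.comp_hasDerivAt θ h0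
  have h2 : (fun t : ℝ => Φ.1 (g * rot t)) = ext Φ ∘ fun t : ℝ => pt (g * rot t) := by
    funext t
    simp only [Function.comp, ext, normalize_pt]
  rw [h2, lieD_apply]
  exact h1

theorem rot_zero : rot 0 = 1 := by
  apply Subtype.ext; apply Subtype.ext
  ext i j
  fin_cases i <;> fin_cases j <;> simp [rot]

theorem rot_two_pi : rot (2 * Real.pi) = 1 := by
  apply Subtype.ext; apply Subtype.ext
  ext i j
  fin_cases i <;> fin_cases j <;> simp [rot]

theorem exists_rot_eq (k : SO2) : ∃ θ, k = rot θ := by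
  obtain ⟨h1, h2⟩ := SO2_entries k
  have hd := k.1.2
  rw [det_fin_two, h1, h2] at hd
  set z : ℂ := ⟨k.1.1 0 0, k.1.1 0 1⟩ with hz
  have hn : ‖z‖ = 1 := by
    rw [Complex.norm_def, Complex.normSq_apply, Real.sqrt_eq_one]
    simp only [hz]
    linarith
  have hz0 : z ≠ 0 := fun h => by simp [h] at hn
  refine ⟨z.arg, ?_⟩
  have hc : Real.cos z.arg = k.1.1 0 0 := by rw [Complex.cos_arg hz0, hn, div_one]
  have hs : Real.sin z.arg = k.1.1 0 1 := by rw [Complex.sin_arg, hn, div_one]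
  apply Subtype.ext; apply Subtype.ext
  ext i j
  fin_cases i <;> fin_cases j <;> simp [rot, hc, hs, h1, h2]

/-- The functions of weight `n` under `K`. -/
noncomputable def wt (n : ℤ) : Submodule ℂ Smooth where
  carrier := {Φ | ∀ θ : ℝ, rightTrans (rot θ) Φ = Complex.exp (Complex.I * n * θ) • Φ}
  add_mem' h h' θ := by rw [map_add, h, h', smul_add]
  zero_mem' θ := by rw [map_zero, smul_zero]
  smul_mem' c Φ h θ := by rw [map_smul, h, smul_comm]

theorem wt_apply {n : ℤ} {Φ : Smooth} (h : Φ ∈ wt n) (g : SL(2, ℝ)) (θ : ℝ) :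
    Φ.1 (g * rot θ) = Complex.exp (Complex.I * n * θ) * Φ.1 g :=
  congrFun (congrArg Subtype.val (h θ)) g

theorem lieD_kGen_of_wt {n : ℤ} {Φ : Smooth} (h : Φ ∈ wt n) :
    lieD kGen Φ = (Complex.I * n) • Φ := by
  refine Subtype.ext (funext fun g => ?_)
  have h1 := hasDerivAt_rot Φ g 0
  rw [rot_zero, Subgroup.coe_one, mul_one] at h1
  simp only [wt_apply h] at h1
  have h2 : HasDerivAt (fun θ : ℝ => Complex.exp (Complex.I * n * θ) * Φ.1 g)
      (Complex.I * n * Φ.1 g) 0 := by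
    have h3 : HasDerivAt (fun θ : ℝ => Complex.I * n * (θ : ℂ)) (Complex.I * n) 0 := by
      simpa using (Complex.ofRealCLM.hasDerivAt (x := (0 : ℝ))).const_mul (Complex.I * (n : ℂ))
    simpa using h3.cexp.mul_const (Φ.1 g)
  exact h1.unique h2

theorem lie_Hel_eq (Φ : Smooth) : ⁅Hel, Φ⁆ = -Complex.I • lieD kGen Φ := by
  have h1 : reSl Hel = 0 := by
    apply Subtype.ext; ext i j; fin_cases i <;> fin_cases j <;> simp [reSl, Hel]
  have h2 : imSl Hel = (-1 : ℝ) • kGen := by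
    apply Subtype.ext; ext i j; fin_cases i <;> fin_cases j <;> simp [imSl, Hel, kGen]
  change (lieD (reSl Hel) + Complex.I • lieD (imSl Hel)) Φ = _
  have h0 : lieD 0 = 0 := by simpa using lieD_smul 0 0
  rw [h1, h2, lieD_smul, h0]
  simp [neg_smul]

theorem lie_Hel_of_wt {n : ℤ} {Φ : Smooth} (h : Φ ∈ wt n) : ⁅Hel, Φ⁆ = (n : ℂ) • Φ := by
  rw [lie_Hel_eq, lieD_kGen_of_wt h, smul_smul]
  congr 1
  linear_combination -(n : ℂ) * Complex.I_mul_I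

/-- The hypothesis says `X' = h X h⁻¹`, and the exponential commutes with conjugation, so `exp(tX')
h = h exp(tX)`. -/
theorem lieDeriv_conj {X X' : sl2R} {h : SL(2, ℝ)} (hX : X'.1 * h.1 = h.1 * X.1)
    (Φ : SL(2, ℝ) → ℂ) (g : SL(2, ℝ)) :
    lieDeriv X' (fun g => Φ (g * h)) g = lieDeriv X Φ (g * h) := by
  have key : ∀ t : ℝ, expSL (t • X') * h = h * expSL (t • X) := by
    intro t
    apply Subtype.ext
    change NormedSpace.exp (t • X'.1) * h.1 = h.1 * NormedSpace.exp (t • X.1)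
    have hu : IsUnit h.1 := by
      rw [Matrix.isUnit_iff_isUnit_det, h.2]; exact isUnit_one
    have hd : IsUnit h.1.det := by rw [h.2]; exact isUnit_one
    have e : t • X'.1 = h.1 * (t • X.1) * h.1⁻¹ := by
      rw [Matrix.mul_smul, Matrix.smul_mul, ← hX, Matrix.mul_nonsing_inv_cancel_right _ _ hd]
    rw [e, Matrix.exp_conj _ _ hu, Matrix.nonsing_inv_mul_cancel_right _ _ hd]
  simp only [lieDeriv, mul_assoc, key]

theorem Ad_mul (h : SL(2, ℝ)) (Z : sl2C) :
    (Ad h Z).1 * h.1.map Complex.ofReal = h.1.map Complex.ofReal * Z.1 := by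
  have h1 : (h⁻¹).1 * h.1 = 1 := congrArg Subtype.val (inv_mul_cancel h)
  have h2 := congrArg (fun M : Matrix (Fin 2) (Fin 2) ℝ => M.map Complex.ofRealHom) h1
  simp only [Matrix.map_mul, Matrix.map_one _ (map_zero Complex.ofRealHom)
    (map_one Complex.ofRealHom)] at h2
  change h.1.map Complex.ofReal * Z.1 * (h⁻¹).1.map Complex.ofReal * h.1.map Complex.ofReal = _
  have h2' : (h⁻¹).1.map Complex.ofReal * h.1.map Complex.ofReal = 1 := h2
  rw [mul_assoc, h2', mul_one]

theorem rightTrans_lie (h : SL(2, ℝ)) (Z : sl2C) (Φ : Smooth) :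
    rightTrans h ⁅Z, Φ⁆ = ⁅Ad h Z, rightTrans h Φ⁆ := by
  refine Subtype.ext (funext fun g => ?_)
  change (⁅Z, Φ⁆ : Smooth).1 (g * h) = _
  rw [lie_smooth_apply, lie_smooth_apply]
  have e := fun i j => congrFun (congrFun (Ad_mul h Z) i) j
  simp only [Matrix.mul_apply, Fin.sum_univ_two, map_apply] at e
  have h1 : (reSl (Ad h Z)).1 * h.1 = h.1 * (reSl Z).1 := by
    ext i j
    simpa [Matrix.mul_apply, reSl] using congrArg Complex.re (e i j)
  have h2 : (imSl (Ad h Z)).1 * h.1 = h.1 * (imSl Z).1 := by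
    ext i j
    simpa [Matrix.mul_apply, imSl] using congrArg Complex.im (e i j)
  rw [← lieDeriv_conj h1, ← lieDeriv_conj h2]
  rfl

/-- The eigenvector equation is stated with the inverse rotation cleared, so that it can be checked
entry by entry as a polynomial identity in `cos θ` and `sin θ`. -/
theorem Ad_rot_eq {θ : ℝ} {Z : sl2C} {c : ℂ}
    (h : (rot θ).1.1.map Complex.ofReal * Z.1 = c • (Z.1 * (rot θ).1.1.map Complex.ofReal)) :
    Ad (rot θ) Z = c • Z := by
  apply Subtype.ext
  have hd : IsUnit ((rot θ).1.1.map Complex.ofReal).det := by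
    have : ((rot θ).1.1.map Complex.ofReal).det = Complex.ofRealHom (rot θ).1.1.det :=
      (RingHom.map_det Complex.ofRealHom _).symm
    rw [this, (rot θ).1.2, map_one]
    exact isUnit_one
  have h1 := Ad_mul (rot θ) Z
  rw [h, ← Matrix.smul_mul] at h1
  have h2 := congrArg (· * ((rot θ).1.1.map Complex.ofReal)⁻¹) h1
  simp only [Matrix.mul_nonsing_inv_cancel_right _ _ hd] at h2
  exact h2

theorem exp_two_I (θ : ℝ) : Complex.exp (Complex.I * 2 * θ) =
    (Real.cos θ + Real.sin θ * Complex.I) * (Real.cos θ + Real.sin θ * Complex.I) := by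
  rw [Complex.ofReal_cos, Complex.ofReal_sin, ← Complex.exp_mul_I, ← Complex.exp_add]
  congr 1; ring

theorem exp_neg_two_I (θ : ℝ) : Complex.exp (Complex.I * (-2) * θ) =
    (Real.cos θ - Real.sin θ * Complex.I) * (Real.cos θ - Real.sin θ * Complex.I) := by
  have h := Complex.exp_mul_I (-θ : ℂ)
  rw [Complex.cos_neg, Complex.sin_neg] at h
  rw [Complex.ofReal_cos, Complex.ofReal_sin, sub_eq_add_neg, ← neg_mul, ← h, ← Complex.exp_add]
  congr 1; ring

theorem cos_sq_add_sin_sq_complex (θ : ℝ) :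
    (Real.cos θ : ℂ) ^ 2 + (Real.sin θ : ℂ) ^ 2 = 1 := by
  exact_mod_cast Real.cos_sq_add_sin_sq θ

theorem Ad_rot_Rel (θ : ℝ) : Ad (rot θ) Rel = Complex.exp (Complex.I * 2 * θ) • Rel := by
  apply Ad_rot_eq
  rw [exp_two_I]
  have h := cos_sq_add_sin_sq_complex θ
  have hI := Complex.I_sq
  ext i j
  simp only [Matrix.mul_apply, Fin.sum_univ_two, Matrix.smul_apply, map_apply]
  fin_cases i <;> fin_cases j <;>
    simp [rot, Rel, -Complex.ofReal_cos, -Complex.ofReal_sin] <;>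
    generalize (Real.cos θ : ℂ) = c at * <;> generalize (Real.sin θ : ℂ) = s at * <;> grind

theorem Ad_rot_Lel (θ : ℝ) : Ad (rot θ) Lel = Complex.exp (Complex.I * (-2) * θ) • Lel := by
  apply Ad_rot_eq
  rw [exp_neg_two_I]
  have h := cos_sq_add_sin_sq_complex θ
  have hI := Complex.I_sq
  ext i j
  simp only [Matrix.mul_apply, Fin.sum_univ_two, Matrix.smul_apply, map_apply]
  fin_cases i <;> fin_cases j <;>
    simp [rot, Lel, -Complex.ofReal_cos, -Complex.ofReal_sin] <;>
    generalize (Real.cos θ : ℂ) = c at * <;> generalize (Real.sin θ : ℂ) = s at * <;> grind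

theorem lie_Rel_mem_wt {n : ℤ} {Φ : Smooth} (h : Φ ∈ wt n) : ⁅Rel, Φ⁆ ∈ wt (n + 2) := by
  intro θ
  rw [rightTrans_lie, Ad_rot_Rel, h θ, smul_lie,
    lie_smul (Complex.exp (Complex.I * n * θ)), smul_smul, ← Complex.exp_add]
  congr 2
  push_cast; ring

theorem lie_Lel_mem_wt {n : ℤ} {Φ : Smooth} (h : Φ ∈ wt n) : ⁅Lel, Φ⁆ ∈ wt (n - 2) := by
  intro θ
  rw [rightTrans_lie, Ad_rot_Lel, h θ, smul_lie,
    lie_smul (Complex.exp (Complex.I * n * θ)), smul_smul, ← Complex.exp_add]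
  congr 2
  push_cast; ring

theorem lie_Hel_Lel : ⁅Hel, Lel⁆ = (-2 : ℂ) • Lel := by
  apply Subtype.ext
  have hI := Complex.I_sq
  ext i j
  fin_cases i <;> fin_cases j <;>
    simp [LieRing.of_associative_ring_bracket, Hel, Lel] <;> grind

theorem lie_Rel_Lel : ⁅Rel, Lel⁆ = Hel := by
  apply Subtype.ext
  have hI := Complex.I_sq
  ext i j
  fin_cases i <;> fin_cases j <;>
    simp [LieRing.of_associative_ring_bracket, Rel, Lel, Hel] <;> grind

/-- The coefficients are literally those of `DiscreteSeries.lieHom`, so that intertwining maps out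
of `𝒟_{p,+}` need only be checked on `H`, `R` and `L`. -/
theorem sl2C_eq (Z : sl2C) : Z = (Complex.I * (Z.1 0 1 - Z.1 1 0) / 2) • Hel +
    (Z.1 0 0 - Complex.I * (Z.1 0 1 + Z.1 1 0) / 2) • Rel +
    (Z.1 0 0 + Complex.I * (Z.1 0 1 + Z.1 1 0) / 2) • Lel := by
  apply Subtype.ext
  have hI := Complex.I_sq
  have hZ := mem_sl2C.1 Z.2
  ext i j
  fin_cases i <;> fin_cases j <;> simp [Rel, Lel, Hel] <;> grind

end AutSL2

namespace AutSL2

open Matrix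

/-! ### Decomposition of `K`-finite functions into weight vectors -/

theorem hasDerivAt_exp_mul (μ : ℂ) (θ : ℝ) :
    HasDerivAt (fun t : ℝ => Complex.exp (μ * t)) (Complex.exp (μ * θ) * μ) θ := by
  have h3 : HasDerivAt (fun t : ℝ => μ * (t : ℂ)) μ θ := by
    simpa using (Complex.ofRealCLM.hasDerivAt (x := θ)).const_mul μ
  exact h3.cexp

/-- A function with `dΨ/dθ = μ Ψ + χ`, `dχ/dθ = μ χ` along `K` is `e^{μθ} (Ψ + θ χ)`. -/
theorem rot_apply_of_lieD {μ : ℂ} {Ψ χ : Smooth} (hΨ : lieD kGen Ψ = μ • Ψ + χ)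
    (hχ : lieD kGen χ = μ • χ) (g : SL(2, ℝ)) (θ : ℝ) :
    χ.1 (g * rot θ) = Complex.exp (μ * θ) * χ.1 g ∧
      Ψ.1 (g * rot θ) = Complex.exp (μ * θ) * (Ψ.1 g + θ * χ.1 g) := by
  have dχ : ∀ t, HasDerivAt (fun t : ℝ => χ.1 (g * rot t)) (μ * χ.1 (g * rot t)) t := fun t => by
    have := hasDerivAt_rot χ g t
    rwa [hχ] at this
  have dΨ : ∀ t, HasDerivAt (fun t : ℝ => Ψ.1 (g * rot t))
      (μ * Ψ.1 (g * rot t) + χ.1 (g * rot t)) t := fun t => by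
    have := hasDerivAt_rot Ψ g t
    rwa [hΨ] at this
  have dm : ∀ t : ℝ, HasDerivAt (fun t : ℝ => Complex.exp (-μ * t))
      (Complex.exp (-μ * t) * -μ) t := hasDerivAt_exp_mul (-μ)
  have hg : g * rot 0 = g := by rw [rot_zero, Subgroup.coe_one, mul_one]
  have hexp : Complex.exp (μ * θ) * Complex.exp (-μ * θ) = 1 := by
    rw [← Complex.exp_add]; simp
  have c1 : ∀ t : ℝ, Complex.exp (-μ * t) * χ.1 (g * rot t) = χ.1 g := by
    intro t
    have d : ∀ t : ℝ, HasDerivAt (fun t : ℝ => Complex.exp (-μ * t) * χ.1 (g * rot t)) 0 t :=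
      fun t => ((dm t).mul (dχ t)).congr_deriv (by ring)
    have := is_const_of_deriv_eq_zero (fun t => (d t).differentiableAt) (fun t => (d t).deriv) t 0
    simpa [hg] using this
  have c2 : Complex.exp (-μ * θ) * Ψ.1 (g * rot θ) - θ * χ.1 g = Ψ.1 g := by
    have d : ∀ t : ℝ, HasDerivAt (fun t : ℝ =>
        Complex.exp (-μ * t) * Ψ.1 (g * rot t) - t * χ.1 g) 0 t := fun t => by
      refine (((dm t).mul (dΨ t)).sub
        ((Complex.ofRealCLM.hasDerivAt (x := t)).mul_const (χ.1 g))).congr_deriv ?_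
      rw [← c1 t]
      simp only [Complex.ofRealCLM_apply, Complex.ofReal_one]
      ring
    have := is_const_of_deriv_eq_zero (fun t => (d t).differentiableAt) (fun t => (d t).deriv) θ 0
    simpa [hg] using this
  constructor
  · linear_combination Complex.exp (μ * θ) * c1 θ - χ.1 (g * rot θ) * hexp
  · linear_combination Complex.exp (μ * θ) * c2 - Ψ.1 (g * rot θ) * hexp

/-- Periodicity excludes Jordan blocks. Going once around the circle gives `χ(g) = e^{2πμ} χ(g)`. If
`χ(g) ≠ 0`, the exponential is `1`, and then `Ψ(g) = Ψ(g) + 2π χ(g)` is a contradiction. -/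
theorem eigenvector_of_sq {μ : ℂ} {Ψ : Smooth}
    (h : ((lieD kGen - algebraMap ℂ (Module.End ℂ Smooth) μ) ^ 2) Ψ = 0) :
    (lieD kGen - algebraMap ℂ (Module.End ℂ Smooth) μ) Ψ = 0 := by
  set χ := (lieD kGen - algebraMap ℂ (Module.End ℂ Smooth) μ) Ψ with hχ
  have e1 : lieD kGen χ = μ • χ := by
    rw [pow_two, Module.End.mul_apply, ← hχ] at h
    rwa [LinearMap.sub_apply, Module.algebraMap_end_apply, sub_eq_zero] at h
  have e2 : lieD kGen Ψ = μ • Ψ + χ := by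
    rw [hχ, LinearMap.sub_apply, Module.algebraMap_end_apply]
    abel
  refine Subtype.ext (funext fun g => ?_)
  obtain ⟨h1, h2⟩ := rot_apply_of_lieD e2 e1 g (2 * Real.pi)
  rw [rot_two_pi, Subgroup.coe_one, mul_one] at h1 h2
  change χ.1 g = 0
  by_contra hne
  have h3 : Complex.exp (μ * (2 * Real.pi : ℝ)) = 1 := by
    have : (Complex.exp (μ * (2 * Real.pi : ℝ)) - 1) * χ.1 g = 0 := by linear_combination -h1
    rcases mul_eq_zero.1 this with h | h
    · linear_combination h
    · exact absurd h hne
  rw [h3, one_mul] at h2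
  have h4 : ((2 * Real.pi : ℝ) : ℂ) * χ.1 g = 0 := by linear_combination -h2
  rcases mul_eq_zero.1 h4 with h | h
  · exact (by positivity : (2 * Real.pi : ℝ) ≠ 0) (by exact_mod_cast h)
  · exact hne h

theorem eigenvector_of_pow {μ : ℂ} {Ψ : Smooth} (k : ℕ)
    (h : ((lieD kGen - algebraMap ℂ (Module.End ℂ Smooth) μ) ^ k) Ψ = 0) :
    (lieD kGen - algebraMap ℂ (Module.End ℂ Smooth) μ) Ψ = 0 := by
  induction k with
  | zero => rw [pow_zero, Module.End.one_apply] at h; rw [h, map_zero]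
  | succ k ih =>
    rcases k with _ | k
    · simpa using h
    · refine ih ?_
      rw [pow_succ', Module.End.mul_apply]
      apply eigenvector_of_sq
      rw [← Module.End.mul_apply, ← pow_add, show 2 + k = k + 1 + 1 by ring]
      exact h

/-- Going once around the circle forces `e^{2πμ} = 1`, that is `μ ∈ iℤ`. -/
theorem exists_mem_wt_of_eigenvector {μ : ℂ} {Ψ : Smooth} (h : lieD kGen Ψ = μ • Ψ) :
    ∃ n : ℤ, Ψ ∈ wt n := by
  by_cases h0 : Ψ = 0
  · exact ⟨0, h0 ▸ zero_mem _⟩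
  have key : ∀ g (θ : ℝ), Ψ.1 (g * rot θ) = Complex.exp (μ * θ) * Ψ.1 g := fun g θ => by
    have := (rot_apply_of_lieD (Ψ := Ψ) (χ := 0) (μ := μ) (by rw [h, add_zero])
      (by rw [map_zero, smul_zero]) g θ).2
    simpa using this
  obtain ⟨g, hg⟩ : ∃ g, Ψ.1 g ≠ 0 := by
    by_contra hne
    push Not at hne
    exact h0 (Subtype.ext (funext hne))
  have h1 := key g (2 * Real.pi)
  rw [rot_two_pi, Subgroup.coe_one, mul_one] at h1
  have h3 : Complex.exp (μ * (2 * Real.pi : ℝ)) = 1 :=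
    mul_right_cancel₀ hg (by rw [one_mul]; exact h1.symm)
  obtain ⟨n, hn⟩ := Complex.exp_eq_one_iff.1 h3
  refine ⟨n, fun θ => Subtype.ext (funext fun g => ?_)⟩
  have hμ : μ = Complex.I * n := by
    have hp : (2 * (Real.pi : ℂ)) ≠ 0 := by
      simp [Real.pi_ne_zero]
    apply mul_right_cancel₀ hp
    push_cast at hn
    linear_combination hn
  rw [← hμ]
  exact key g θ

/-- The derivative is the pointwise limit of difference quotients that lie in the span of the
`K`-translates. This span is finite-dimensional, hence closed for pointwise convergence. -/
theorem lieD_kGen_mem_kOrbit {Φ Ψ : Smooth} (hΦ : Φ ∈ kFinite) (hΨ : Ψ ∈ kOrbit Φ) :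
    lieD kGen Ψ ∈ kOrbit Φ := by
  have : FiniteDimensional ℂ (kOrbit Φ) := hΦ
  have hK : ∀ θ, rightTrans (rot θ) Ψ ∈ kOrbit Φ := by
    intro θ
    have : kOrbit Φ ≤ (kOrbit Φ).comap (rightTrans (rot θ)) := by
      refine Submodule.span_le.2 ?_
      rintro _ ⟨k, rfl⟩
      refine Submodule.subset_span ⟨rot θ * k, ?_⟩
      change rightTrans ((rot θ * k : SO2) : SL(2, ℝ)) Φ = _
      rw [Subgroup.coe_mul, map_mul]
      rfl
    exact this hΨ
  let U : Submodule ℂ (SL(2, ℝ) → ℂ) := (kOrbit Φ).map Smooth.subtype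
  have hU : IsClosed (U : Set (SL(2, ℝ) → ℂ)) := U.closed_of_finiteDimensional
  have hlim : Filter.Tendsto (fun t : ℝ => (t : ℂ)⁻¹ • ((rightTrans (rot t) Ψ).1 - Ψ.1))
      (nhdsWithin 0 {0}ᶜ) (nhds (lieD kGen Ψ).1) := by
    refine tendsto_pi_nhds.2 fun g => ?_
    have h := (hasDerivAt_rot Ψ g 0).tendsto_slope_zero
    simp only [zero_add, rot_zero, Subgroup.coe_one, mul_one] at h
    refine h.congr fun t => ?_
    rw [← Complex.ofReal_inv]
    exact (Complex.real_smul)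
  have hmem : (lieD kGen Ψ).1 ∈ U := by
    refine hU.mem_of_tendsto hlim (Filter.Eventually.of_forall fun t => ?_)
    exact U.smul_mem _ (U.sub_mem ⟨_, hK t, rfl⟩ ⟨_, hΨ, rfl⟩)
  obtain ⟨Ξ, hΞ, he⟩ := hmem
  have : Ξ = lieD kGen Ψ := Subtype.ext he
  exact this ▸ hΞ

/-- The span of the iterated derivatives of `Φ` along `K`. -/
noncomputable def krylov (Φ : Smooth) : Submodule ℂ Smooth :=
  Submodule.span ℂ (Set.range fun j : ℕ => (lieD kGen ^ j) Φ)

theorem self_mem_krylov (Φ : Smooth) : Φ ∈ krylov Φ := Submodule.subset_span ⟨0, rfl⟩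

theorem self_mem_kOrbit (Φ : Smooth) : Φ ∈ kOrbit Φ := by
  refine Submodule.subset_span ⟨1, ?_⟩
  change rightTrans ((1 : SO2) : SL(2, ℝ)) Φ = _
  rw [Subgroup.coe_one, map_one]
  rfl

/-- Weight components are sought in `krylov Φ` rather than in `kOrbit Φ`. They then inherit
properties stable under `K` as well as properties, such as `𝒵`- or `𝔫`-finiteness, for which
stability is known only under `H`. -/
theorem krylov_le_of_stable {Φ : Smooth} {W : Submodule ℂ Smooth} (hΦ : Φ ∈ W)
    (hW : ∀ Ψ ∈ W, lieD kGen Ψ ∈ W) : krylov Φ ≤ W := by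
  refine Submodule.span_le.2 ?_
  rintro _ ⟨j, rfl⟩
  induction j with
  | zero => exact hΦ
  | succ j ih =>
    change (lieD kGen ^ (j + 1)) Φ ∈ W
    rw [pow_succ', Module.End.mul_apply]
    exact hW _ ih

theorem krylov_le_kOrbit {Φ : Smooth} (hΦ : Φ ∈ kFinite) : krylov Φ ≤ kOrbit Φ :=
  krylov_le_of_stable (self_mem_kOrbit Φ) fun _ h => lieD_kGen_mem_kOrbit hΦ h

theorem lieD_kGen_mem_krylov {Φ Ψ : Smooth} (hΨ : Ψ ∈ krylov Φ) : lieD kGen Ψ ∈ krylov Φ := by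
  have : krylov Φ ≤ (krylov Φ).comap (lieD kGen) := by
    refine Submodule.span_le.2 ?_
    rintro _ ⟨j, rfl⟩
    refine Submodule.subset_span ⟨j + 1, ?_⟩
    change (lieD kGen ^ (j + 1)) Φ = _
    rw [pow_succ', Module.End.mul_apply]
  exact this hΨ

/-- The restriction of `f` to `W` acts on a finite-dimensional complex space, where generalized
eigenspaces span. Intersecting with `W` records that the components stay inside it. -/
theorem mem_iSup_maxGenEigenspace_inf {V : Type*} [AddCommGroup V] [Module ℂ V]
    (f : Module.End ℂ V) (W : Submodule ℂ V) [FiniteDimensional ℂ W]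
    (hW : ∀ x ∈ W, f x ∈ W) {x : V} (hx : x ∈ W) :
    x ∈ ⨆ μ : ℂ, f.maxGenEigenspace μ ⊓ W := by
  have hmem : (⟨x, hx⟩ : W) ∈ ⨆ μ : ℂ, Module.End.maxGenEigenspace (f.restrict hW) μ := by
    rw [Module.End.iSup_maxGenEigenspace_eq_top]
    exact Submodule.mem_top
  have h2 := Submodule.mem_map_of_mem (f := W.subtype) hmem
  rw [Submodule.map_iSup] at h2
  refine SetLike.le_def.1 (iSup_mono fun μ => ?_) h2
  rintro _ ⟨y, hy, rfl⟩
  refine ⟨?_, y.2⟩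
  obtain ⟨k, hk⟩ := (Module.End.mem_maxGenEigenspace _ μ y).1 hy
  refine (Module.End.mem_maxGenEigenspace f μ _).2 ⟨k, ?_⟩
  have hcomm : ∀ (k : ℕ) (x : W), (((f.restrict hW - μ • 1 : Module.End ℂ W) ^ k) x : W).1 =
      ((f - μ • 1) ^ k) x.1 := by
    intro k
    induction k with
    | zero => intro x; rfl
    | succ k ih =>
      intro x
      rw [pow_succ, pow_succ, Module.End.mul_apply, Module.End.mul_apply, ih]
      rfl
  have h3 := hcomm k y
  rw [hk] at h3
  exact h3.symm

/-- A `K`-finite function is a sum of weight vectors that lie in the span of its derivatives. -/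
theorem mem_iSup_wt_inf_krylov {Φ : Smooth} (hΦ : Φ ∈ kFinite) :
    Φ ∈ ⨆ n : ℤ, wt n ⊓ krylov Φ := by
  have : FiniteDimensional ℂ (kOrbit Φ) := hΦ
  have hf : FiniteDimensional ℂ (krylov Φ) :=
    Submodule.finiteDimensional_of_le (krylov_le_kOrbit hΦ)
  have h1 := mem_iSup_maxGenEigenspace_inf (lieD kGen) (krylov Φ)
    (fun _ h => lieD_kGen_mem_krylov h) (self_mem_krylov Φ)
  refine (iSup_le fun μ => ?_ : (⨆ μ : ℂ, (lieD kGen).maxGenEigenspace μ ⊓ krylov Φ) ≤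
    ⨆ n : ℤ, wt n ⊓ krylov Φ) h1
  rintro Ψ ⟨hΨ, hΨ'⟩
  obtain ⟨k, hk⟩ := (Module.End.mem_maxGenEigenspace _ μ Ψ).1 hΨ
  have h4 := eigenvector_of_pow k hk
  rw [LinearMap.sub_apply, Module.algebraMap_end_apply, sub_eq_zero] at h4
  obtain ⟨n, hn⟩ := exists_mem_wt_of_eigenvector h4
  exact Submodule.mem_iSup_of_mem n ⟨hn, hΨ'⟩

end AutSL2

namespace AutSL2

open Matrix

/-! ### Coordinates on the upper half plane -/

/-- `F` is differentiable at `z = x + iy` with `∂F/∂x = a` and `∂F/∂y = b`. -/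
def HasPartials (F : ℂ → ℂ) (a b : ℂ) (z : ℂ) : Prop :=
  HasFDerivAt F (Complex.reCLM.smulRight a + Complex.imCLM.smulRight b) z

namespace HasPartials

variable {F G : ℂ → ℂ} {a b a' b' z : ℂ}

theorem of_hasFDerivAt {F' : ℂ →L[ℝ] ℂ} (h : HasFDerivAt F F' z) :
    HasPartials F (F' 1) (F' Complex.I) z := by
  refine h.congr_fderiv (ContinuousLinearMap.ext fun w => ?_)
  have : w = w.re • (1 : ℂ) + w.im • Complex.I := by
    simp [Complex.re_add_im]
  conv_lhs => rw [this, map_add, map_smul, map_smul]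
  rfl

theorem congr_partials (h : HasPartials F a b z) (ha : a = a') (hb : b = b') :
    HasPartials F a' b' z := ha ▸ hb ▸ h

theorem sub (h : HasPartials F a b z) (h' : HasPartials G a' b' z) :
    HasPartials (fun w => F w - G w) (a - a') (b - b') z :=
  (of_hasFDerivAt (HasFDerivAt.sub h h')).congr_partials (by simp) (by simp)

theorem mul (h : HasPartials F a b z) (h' : HasPartials G a' b' z) :
    HasPartials (fun w => F w * G w) (a * G z + F z * a') (b * G z + F z * b') z :=
  (of_hasFDerivAt (HasFDerivAt.mul h h')).congr_partials (by simp; ring) (by simp; ring)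

theorem sum {ι : Type*} {s : Finset ι} {F : ι → ℂ → ℂ} {a b : ι → ℂ}
    (h : ∀ i ∈ s, HasPartials (F i) (a i) (b i) z) :
    HasPartials (fun w => ∑ i ∈ s, F i w) (∑ i ∈ s, a i) (∑ i ∈ s, b i) z :=
  (of_hasFDerivAt (HasFDerivAt.fun_sum h)).congr_partials (by simp) (by simp)

theorem of_hasDerivAt {F' : ℂ} (h : HasDerivAt F F' z) :
    HasPartials F F' (Complex.I * F') z :=
  (of_hasFDerivAt (h.hasFDerivAt.restrictScalars ℝ)).congr_partials (by simp) (by simp)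

theorem comp_im {φ : ℝ → ℂ} {φ' : ℂ} (h : HasDerivAt φ φ' z.im) :
    HasPartials (fun w => φ w.im) 0 φ' z :=
  (of_hasFDerivAt (h.hasFDerivAt.comp z Complex.imCLM.hasFDerivAt)).congr_partials
    (by simp) (by simp)

theorem unique (h : HasPartials F a b z) (h' : HasPartials F a' b' z) : a = a' ∧ b = b' := by
  have := HasFDerivAt.unique h h'
  exact ⟨by simpa using congrArg (fun L : ℂ →L[ℝ] ℂ => L 1) this,
    by simpa using congrArg (fun L : ℂ →L[ℝ] ℂ => L Complex.I) this⟩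

theorem congr_of_eventuallyEq (h : HasPartials F a b z) (hFG : G =ᶠ[nhds z] F) :
    HasPartials G a b z :=
  HasFDerivAt.congr_of_eventuallyEq h hFG

/-- The condition on the partial derivatives is the Cauchy–Riemann equation. -/
theorem differentiableAt (h : HasPartials F a b z) (hb : b = Complex.I * a) :
    DifferentiableAt ℂ F z := by
  refine differentiableAt_complex_iff_differentiableAt_real.2 ⟨HasFDerivAt.differentiableAt h, ?_⟩
  rw [HasFDerivAt.fderiv h, hb]
  simp

end HasPartials

/-- The matrix `(y x; 0 1)` for `z = x + iy`. -/
def hpMat (z : ℂ) : M2 := ![![z.im, z.re], ![0, 1]]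

theorem det_hpMat (z : ℂ) : (of (hpMat z)).det = z.im := by
  simp [hpMat, det_fin_two]

theorem hpMat_mem {z : ℂ} (hz : 0 < z.im) : hpMat z ∈ posDet := by
  change 0 < (of (hpMat z)).det
  rwa [det_hpMat]

/-- The retraction divides by `y^{1/2}`. Working with `(y x; 0 1)` keeps square roots out of the
differentiation, because the coordinates are then affine in `x` and `y`. -/
theorem normalize_hpMat {z : ℂ} (hz : 0 < z.im) :
    normalize (hpMat z) = nMat z.re * aMat z.im hz := by
  apply Subtype.ext
  rw [normalize_val (hpMat_mem hz), det_hpMat]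
  have h0 : Real.sqrt z.im ≠ 0 := (Real.sqrt_pos.2 hz).ne'
  have h1 : Real.sqrt z.im * Real.sqrt z.im = z.im := Real.mul_self_sqrt hz.le
  change _ = (nMat z.re).1 * (aMat z.im hz).1
  ext i j
  fin_cases i <;> fin_cases j <;> simp [hpMat, nMat, aMat, Matrix.mul_apply]
  · field_simp
    nlinarith
  · ring

/-- The function `y^{-n/2} Φ((1 x; 0 1) (y^{1/2} 0; 0 y^{-1/2}))` of `z = x + iy`. -/
noncomputable def pull (n : ℤ) (Φ : SL(2, ℝ) → ℂ) (z : ℂ) : ℂ :=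
  ((z.im ^ (-(n : ℝ) / 2) : ℝ) : ℂ) * ext Φ (hpMat z)

theorem tilde_eq_pull (n : ℤ) (Φ : SL(2, ℝ) → ℂ) (τ : UpperHalfPlane) :
    tilde n Φ τ = pull n Φ τ := by
  rw [tilde, pull, ext, normalize_hpMat (z := τ) τ.im_pos]
  rfl

theorem hasPartials_ext_hpMat (Φ : Smooth) {z : ℂ} (hz : 0 < z.im) :
    HasPartials (fun w => ext Φ (hpMat w))
      (fderiv ℝ (ext Φ) (hpMat z) ![![0, 1], ![0, 0]])
      (fderiv ℝ (ext Φ) (hpMat z) ![![1, 0], ![0, 0]]) z := by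
  have h1 : HasFDerivAt hpMat (Complex.reCLM.smulRight (![![0, 1], ![0, 0]] : M2) +
      Complex.imCLM.smulRight (![![1, 0], ![0, 0]] : M2)) z := by
    refine hasFDerivAt_pi'' fun i => hasFDerivAt_pi'' fun j => ?_
    fin_cases i <;> fin_cases j
    · exact Complex.imCLM.hasFDerivAt.congr_fderiv (by ext w; simp)
    · exact Complex.reCLM.hasFDerivAt.congr_fderiv (by ext w; simp)
    · exact (hasFDerivAt_const (0 : ℝ) z).congr_fderiv (by ext w; simp)
    · exact (hasFDerivAt_const (1 : ℝ) z).congr_fderiv (by ext w; simp)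
  have h2 := (differentiableAt_ext Φ (hpMat_mem hz)).hasFDerivAt.comp z h1
  exact (HasPartials.of_hasFDerivAt h2).congr_partials (by simp) (by simp)

/-- Euler's relation: `ext Φ` is homogeneous of degree `0`. -/
theorem fderiv_ext_self (Φ : Smooth) {A : M2} (h : A ∈ posDet) :
    fderiv ℝ (ext Φ) A A = 0 := by
  have hd := (differentiableAt_ext Φ h).hasFDerivAt
  have h1 : HasDerivAt (fun t : ℝ => t • A) A 1 := by
    simpa using (hasDerivAt_id (1 : ℝ)).smul_const A
  rw [← one_smul ℝ A] at hd
  have h2 := hd.comp_hasDerivAt (1 : ℝ) h1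
  rw [one_smul] at h2
  have h3 : (ext Φ ∘ fun t : ℝ => t • A) =ᶠ[nhds 1] fun _ => ext Φ A := by
    filter_upwards [lt_mem_nhds (zero_lt_one (α := ℝ))] with t ht
    simp only [Function.comp, ext, normalize_smul h ht]
  exact h2.unique ((hasDerivAt_const (1 : ℝ) (ext Φ A)).congr_of_eventuallyEq h3)

theorem ext_lie (Z : sl2C) (Φ : Smooth) {A : M2} (h : A ∈ posDet) :
    ext (⁅Z, Φ⁆ : Smooth) A = fderiv ℝ (ext Φ) A (mulR (reSl Z) A) +
      Complex.I * fderiv ℝ (ext Φ) A (mulR (imSl Z) A) := by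
  rw [← ext_lieDeriv _ _ h, ← ext_lieDeriv _ _ h]
  rfl

theorem fderiv_ext_kGen {n : ℤ} {Φ : Smooth} (hΦ : Φ ∈ wt n) {A : M2} (h : A ∈ posDet) :
    fderiv ℝ (ext Φ) A (mulR kGen.1 A) = Complex.I * n * ext Φ A := by
  rw [← ext_lieDeriv _ _ h]
  change (lieD kGen Φ).1 _ = _
  rw [lieD_kGen_of_wt hΦ]
  rfl

/-- The tangent vector `A L` at `A = (y x; 0 1)` is a combination of the directions `∂_x` and `∂_y`,
of `A` itself, which acts by `0`, and of the direction of `K`, which acts by `i n`. -/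
theorem ext_lie_Lel {n : ℤ} {Φ : Smooth} (hΦ : Φ ∈ wt n) {z : ℂ} (hz : 0 < z.im) :
    ext (⁅Lel, Φ⁆ : Smooth) (hpMat z) =
      z.im * fderiv ℝ (ext Φ) (hpMat z) ![![1, 0], ![0, 0]] -
      Complex.I * z.im * fderiv ℝ (ext Φ) (hpMat z) ![![0, 1], ![0, 0]] -
      n / 2 * ext Φ (hpMat z) := by
  have hA := hpMat_mem hz
  rw [ext_lie _ _ hA]
  have e1 : mulR (reSl Lel).1 (hpMat z) =
      z.im • ![![1, 0], ![0, 0]] - (1 / 2 : ℝ) • hpMat z := by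
    funext i j
    fin_cases i <;> fin_cases j <;> simp [mulR_apply, reSl, Lel, hpMat] <;> ring
  have e2 : mulR (imSl Lel).1 (hpMat z) =
      (1 / 2 : ℝ) • mulR kGen.1 (hpMat z) - z.im • ![![0, 1], ![0, 0]] := by
    funext i j
    fin_cases i <;> fin_cases j <;> simp [mulR_apply, imSl, Lel, hpMat, kGen] <;> ring
  rw [e1, e2, map_sub, map_sub, map_smul, map_smul, map_smul, map_smul, fderiv_ext_self Φ hA,
    fderiv_ext_kGen hΦ hA]
  simp only [Complex.real_smul]
  push_cast
  linear_combination (n / 2 * ext Φ (hpMat z)) * Complex.I_mul_I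

theorem ext_lie_Rel {n : ℤ} {Φ : Smooth} (hΦ : Φ ∈ wt n) {z : ℂ} (hz : 0 < z.im) :
    ext (⁅Rel, Φ⁆ : Smooth) (hpMat z) =
      z.im * fderiv ℝ (ext Φ) (hpMat z) ![![1, 0], ![0, 0]] +
      Complex.I * z.im * fderiv ℝ (ext Φ) (hpMat z) ![![0, 1], ![0, 0]] +
      n / 2 * ext Φ (hpMat z) := by
  have hA := hpMat_mem hz
  rw [ext_lie _ _ hA]
  have e1 : mulR (reSl Rel).1 (hpMat z) =
      z.im • ![![1, 0], ![0, 0]] - (1 / 2 : ℝ) • hpMat z := by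
    funext i j
    fin_cases i <;> fin_cases j <;> simp [mulR_apply, reSl, Rel, hpMat] <;> ring
  have e2 : mulR (imSl Rel).1 (hpMat z) =
      z.im • ![![0, 1], ![0, 0]] - (1 / 2 : ℝ) • mulR kGen.1 (hpMat z) := by
    funext i j
    fin_cases i <;> fin_cases j <;> simp [mulR_apply, imSl, Rel, hpMat, kGen] <;> ring
  rw [e1, e2, map_sub, map_sub, map_smul, map_smul, map_smul, map_smul, fderiv_ext_self Φ hA,
    fderiv_ext_kGen hΦ hA]
  simp only [Complex.real_smul]
  push_cast
  linear_combination (-n / 2 * ext Φ (hpMat z)) * Complex.I_mul_I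

theorem ofReal_rpow_sub_one {y : ℝ} (hy : 0 < y) (r : ℝ) :
    (((y ^ (r - 1) : ℝ)) : ℂ) = ((y ^ r : ℝ) : ℂ) / y := by
  rw [Real.rpow_sub_one hy.ne']; push_cast; rfl

/-- In terms of `F = pull n Φ`, the element `L` acts by `y² (∂_y - i ∂_x)` and `R` acts by
`∂_y + i ∂_x + n / y`. -/
theorem exists_hasPartials_pull {n : ℤ} {Φ : Smooth} (hΦ : Φ ∈ wt n) {z : ℂ} (hz : 0 < z.im) :
    ∃ a b : ℂ, HasPartials (pull n Φ) a b z ∧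
      pull (n - 2) (⁅Lel, Φ⁆ : Smooth) z = (z.im : ℂ) ^ 2 * (b - Complex.I * a) ∧
      pull (n + 2) (⁅Rel, Φ⁆ : Smooth) z = b + Complex.I * a + n / z.im * pull n Φ z := by
  have hG := hasPartials_ext_hpMat Φ hz
  have hy : HasDerivAt (fun y : ℝ => ((y ^ (-(n : ℝ) / 2) : ℝ) : ℂ))
      (((-(n : ℝ) / 2) * z.im ^ (-(n : ℝ) / 2 - 1) : ℝ) : ℂ) z.im :=
    (Real.hasDerivAt_rpow_const (Or.inl hz.ne')).ofReal_comp
  refine ⟨_, _, (HasPartials.comp_im hy).mul hG, ?_, ?_⟩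
  · have e : -((n - 2 : ℤ) : ℝ) / 2 = -(n : ℝ) / 2 - 1 + 1 + 1 := by push_cast; ring
    rw [pull, ext_lie_Lel hΦ hz, e, Real.rpow_add_one hz.ne', Real.rpow_add_one hz.ne']
    push_cast
    rw [ofReal_rpow_sub_one hz]
    have hz' : (z.im : ℂ) ≠ 0 := by exact_mod_cast hz.ne'
    field_simp
    ring
  · have e : -((n + 2 : ℤ) : ℝ) / 2 = -(n : ℝ) / 2 - 1 := by push_cast; ring
    rw [pull, pull, ext_lie_Rel hΦ hz, e]
    push_cast
    rw [ofReal_rpow_sub_one hz]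
    have hz' : (z.im : ℂ) ≠ 0 := by exact_mod_cast hz.ne'
    field_simp
    ring

/-- The open upper half plane as a subset of `ℂ`. -/
def upper : Set ℂ := {z | 0 < z.im}

theorem isOpen_upper : IsOpen upper := isOpen_lt continuous_const Complex.continuous_im

/-- The holomorphic parts cancel in `∂_y - i ∂_x`, so `y² (∂_y - i ∂_x)` sends `f / y^j` to `-j f /
y^{j-1}` for `j ≥ 1`, and to `0` for `j = 0`. -/
theorem hasPartials_div_im_pow {f : ℂ → ℂ} (hf : DifferentiableOn ℂ f upper) (j : ℕ) {z : ℂ}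
    (hz : 0 < z.im) :
    HasPartials (fun w => f w / (w.im : ℂ) ^ j) (deriv f z / (z.im : ℂ) ^ j)
      (Complex.I * deriv f z / (z.im : ℂ) ^ j - j * f z / (z.im : ℂ) ^ (j + 1)) z := by
  have hz' : (z.im : ℂ) ≠ 0 := by exact_mod_cast hz.ne'
  have h1 := HasPartials.of_hasDerivAt
    (hf.differentiableAt (isOpen_upper.mem_nhds hz)).hasDerivAt
  have h2 : HasDerivAt (fun y : ℝ => ((y : ℂ) ^ j)⁻¹) (-(j / (z.im : ℂ) ^ (j + 1))) z.im := by
    have h3 : HasDerivAt (fun y : ℝ => (y : ℂ) ^ j) (j * (z.im : ℂ) ^ (j - 1)) z.im := by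
      simpa using (Complex.ofRealCLM.hasDerivAt (x := z.im)).fun_pow j
    refine (h3.inv (pow_ne_zero _ hz')).congr_deriv ?_
    rcases j with _ | j
    · simp
    · simp only [Nat.add_sub_cancel]
      field_simp
      ring
  refine (h1.mul (HasPartials.comp_im h2)).congr_partials ?_ ?_
  · ring
  · field_simp
    ring

/-- A function of weight `n` with `L^v Φ = 0` corresponds to a polynomial of degree `< v` in `1/y`
with holomorphic coefficients. -/
theorem exists_pull_eq_sum (v : ℕ) : ∀ {n : ℤ} {Φ : Smooth}, Φ ∈ wt n →
    (cLieHom Lel ^ v) Φ = 0 → ∃ f : ℕ → ℂ → ℂ, (∀ j, DifferentiableOn ℂ (f j) upper) ∧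
      ∀ z ∈ upper, pull n Φ z = ∑ j ∈ Finset.range v, f j z / (z.im : ℂ) ^ j := by
  induction v with
  | zero =>
    intro n Φ _ h0
    rw [pow_zero, Module.End.one_apply] at h0
    refine ⟨fun _ _ => 0, fun _ => differentiableOn_const 0, fun z _ => ?_⟩
    rw [h0, pull]
    simp [ext]
  | succ v ih =>
    intro n Φ hΦ h0
    rw [pow_succ, Module.End.mul_apply] at h0
    obtain ⟨g, hg, hs⟩ := ih (lie_Lel_mem_wt hΦ) h0
    -- The operator `y² (∂_y - i ∂_x)` sends `f / y^{j+1}` to `-(j+1) f / y^j`, so these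
    -- coefficients integrate `L Φ`.
    let f : ℕ → ℂ → ℂ := fun j z => -g j z / (j + 1)
    have hf : ∀ j, DifferentiableOn ℂ (f j) upper := fun j => ((hg j).neg).div_const _
    -- The difference is killed by `∂_y - i ∂_x`, hence is holomorphic; it is the coefficient of
    -- `y^0`.
    let f₀ : ℂ → ℂ := fun z => pull n Φ z -
      ∑ j ∈ Finset.range v, f j z / (z.im : ℂ) ^ (j + 1)
    have hf₀ : DifferentiableOn ℂ f₀ upper := by
      intro z hz
      obtain ⟨a, b, hab, hL, -⟩ := exists_hasPartials_pull hΦ hz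
      have hsum := HasPartials.sum (s := Finset.range v)
        fun j _ => hasPartials_div_im_pow (hf j) (j + 1) hz
      refine ((hab.sub hsum).differentiableAt ?_).differentiableWithinAt
      have hz' : (z.im : ℂ) ≠ 0 := by exact_mod_cast (show z.im ≠ 0 from hz.ne')
      have hb : b - Complex.I * a = ∑ j ∈ Finset.range v, g j z / (z.im : ℂ) ^ (j + 2) := by
        apply mul_left_cancel₀ (pow_ne_zero 2 hz')
        rw [← hL, hs z hz, Finset.mul_sum]
        refine Finset.sum_congr rfl fun j _ => ?_
        field_simp
        ring
      rw [Finset.sum_sub_distrib, mul_sub, Finset.mul_sum]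
      have e1 : ∀ j ∈ Finset.range v, ((j + 1 : ℕ) : ℂ) * f j z / (z.im : ℂ) ^ (j + 1 + 1) =
          -(g j z / (z.im : ℂ) ^ (j + 2)) := by
        intro j _
        have : (j + 1 : ℂ) ≠ 0 := by exact_mod_cast Nat.succ_ne_zero j
        have e : ((j + 1 : ℕ) : ℂ) * f j z = -g j z := by
          change ((j + 1 : ℕ) : ℂ) * (-g j z / (j + 1)) = -g j z
          push_cast
          exact mul_div_cancel₀ _ this
        rw [e, neg_div]
      rw [Finset.sum_congr rfl e1, Finset.sum_neg_distrib, ← hb]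
      simp only [mul_div_assoc]
      ring
    refine ⟨fun j => j.casesOn f₀ f, fun j => ?_, fun z _ => ?_⟩
    · cases j with
      | zero => exact hf₀
      | succ j => exact hf j
    · rw [Finset.sum_range_succ']
      simp [f₀]

end AutSL2

namespace AutSL2

open Matrix

/-! ### Moderate growth -/

/-- The height `(1 + |z|²) / y` on the upper half plane. -/
noncomputable def height (z : ℂ) : ℝ := (1 + ‖z‖ ^ 2) / z.im

/-- Functions on the upper half plane of moderate growth. -/
def Moderate (F : ℂ → ℂ) : Prop :=
  ∃ C : ℝ, 0 ≤ C ∧ ∃ N : ℕ, ∀ z ∈ upper, ‖F z‖ ≤ C * height z ^ N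

theorem im_le_height {z : ℂ} (hz : z ∈ upper) : z.im ≤ height z := by
  have hz' : 0 < z.im := hz
  rw [height, le_div_iff₀ hz', Complex.sq_norm, Complex.normSq_apply]
  nlinarith [sq_nonneg z.re]

theorem inv_im_le_height {z : ℂ} (hz : z ∈ upper) : z.im⁻¹ ≤ height z := by
  have hz' : 0 < z.im := hz
  rw [height, ← one_div]
  gcongr
  nlinarith [sq_nonneg ‖z‖]

theorem one_le_height {z : ℂ} (hz : z ∈ upper) : 1 ≤ height z := by
  have hz' : 0 < z.im := hz
  rcases le_total 1 z.im with h | h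
  · exact h.trans (im_le_height hz)
  · exact ((one_le_inv₀ hz').2 h).trans (inv_im_le_height hz)

namespace Moderate

variable {F G : ℂ → ℂ}

theorem congr (hF : Moderate F) (h : ∀ z ∈ upper, G z = F z) : Moderate G := by
  obtain ⟨C, hC, N, hN⟩ := hF
  exact ⟨C, hC, N, fun z hz => h z hz ▸ hN z hz⟩

theorem const (c : ℂ) : Moderate fun _ => c := ⟨‖c‖, norm_nonneg _, 0, fun z _ => by simp⟩

theorem add (hF : Moderate F) (hG : Moderate G) : Moderate fun z => F z + G z := by
  obtain ⟨C, hC, N, hN⟩ := hF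
  obtain ⟨C', hC', N', hN'⟩ := hG
  refine ⟨C + C', add_nonneg hC hC', max N N', fun z hz => ?_⟩
  have h1 := one_le_height hz
  have a1 : height z ^ N ≤ height z ^ max N N' := pow_le_pow_right₀ h1 (le_max_left _ _)
  have a2 : height z ^ N' ≤ height z ^ max N N' := pow_le_pow_right₀ h1 (le_max_right _ _)
  calc ‖F z + G z‖ ≤ ‖F z‖ + ‖G z‖ := norm_add_le _ _
    _ ≤ C * height z ^ max N N' + C' * height z ^ max N N' :=
      add_le_add ((hN z hz).trans (mul_le_mul_of_nonneg_left a1 hC))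
        ((hN' z hz).trans (mul_le_mul_of_nonneg_left a2 hC'))
    _ = _ := by ring

theorem mul (hF : Moderate F) (hG : Moderate G) : Moderate fun z => F z * G z := by
  obtain ⟨C, hC, N, hN⟩ := hF
  obtain ⟨C', hC', N', hN'⟩ := hG
  refine ⟨C * C', mul_nonneg hC hC', N + N', fun z hz => ?_⟩
  have h1 := one_le_height hz
  rw [norm_mul, pow_add]
  calc ‖F z‖ * ‖G z‖ ≤ (C * height z ^ N) * (C' * height z ^ N') :=
      mul_le_mul (hN z hz) (hN' z hz) (norm_nonneg _) (by positivity)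
    _ = _ := by ring

theorem sub (hF : Moderate F) (hG : Moderate G) : Moderate fun z => F z - G z :=
  (hF.add ((const (-1)).mul hG)).congr fun z _ => by ring

theorem sum {ι : Type*} {s : Finset ι} {F : ι → ℂ → ℂ} (h : ∀ i ∈ s, Moderate (F i)) :
    Moderate fun z => ∑ i ∈ s, F i z := by
  classical
  induction s using Finset.induction_on with
  | empty => simpa using const 0
  | insert i s hi ih =>
    refine ((h i (Finset.mem_insert_self i s)).add
      (ih fun j hj => h j (Finset.mem_insert_of_mem hj))).congr fun z _ => ?_
    rw [Finset.sum_insert hi]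

theorem rpow_im (r : ℝ) : Moderate fun z => ((z.im ^ r : ℝ) : ℂ) := by
  obtain ⟨N, hN⟩ := exists_nat_ge |r|
  refine ⟨1, zero_le_one, N, fun z hz => ?_⟩
  have hz' : 0 < z.im := hz
  have h1 := one_le_height hz
  rw [one_mul, Complex.norm_real, Real.norm_of_nonneg (by positivity), ← Real.rpow_natCast]
  rcases le_total 1 z.im with h | h
  · calc z.im ^ r ≤ z.im ^ (N : ℝ) :=
        Real.rpow_le_rpow_of_exponent_le h ((le_abs_self r).trans hN)
      _ ≤ _ := Real.rpow_le_rpow hz'.le (im_le_height hz) (Nat.cast_nonneg N)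
  · calc z.im ^ r ≤ z.im ^ (-(N : ℝ)) :=
        Real.rpow_le_rpow_of_exponent_ge hz' h (by linarith [neg_abs_le r])
      _ = (z.im⁻¹) ^ (N : ℝ) := by rw [Real.rpow_neg hz'.le, Real.inv_rpow hz'.le]
      _ ≤ _ := Real.rpow_le_rpow (by positivity) (inv_im_le_height hz) (Nat.cast_nonneg N)

theorem im_pow (j : ℕ) : Moderate fun z => (z.im : ℂ) ^ j :=
  (rpow_im j).congr fun z _ => by rw [Real.rpow_natCast]; push_cast; rfl

theorem im_pow_inv (j : ℕ) : Moderate fun z => ((z.im : ℂ) ^ j)⁻¹ :=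
  (rpow_im (-j)).congr fun z hz => by
    have hz' : 0 < z.im := hz
    rw [Real.rpow_neg hz'.le, Real.rpow_natCast]; push_cast; rfl

end Moderate

theorem half_im_le_of_mem_closedBall {z ζ : ℂ}
    (h : ζ ∈ Metric.closedBall z (z.im / 2)) : z.im / 2 ≤ ζ.im := by
  rw [Metric.mem_closedBall, dist_eq_norm] at h
  have h1 := (Complex.abs_im_le_norm (ζ - z)).trans h
  rw [Complex.sub_im] at h1
  linarith [neg_abs_le (ζ.im - z.im)]

theorem closedBall_subset_upper {z : ℂ} (hz : z ∈ upper) :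
    Metric.closedBall z (z.im / 2) ⊆ upper := fun ζ h => by
  have hz' : 0 < z.im := hz
  change 0 < ζ.im
  linarith [half_im_le_of_mem_closedBall h]

/-- On a disc of radius `y/2` the height changes by a bounded factor only. This makes the Cauchy
estimate and the maximum principle on such discs preserve moderate growth. -/
theorem height_le_of_mem_closedBall {z ζ : ℂ} (hz : z ∈ upper)
    (h : ζ ∈ Metric.closedBall z (z.im / 2)) : height ζ ≤ 5 * height z := by
  have hz' : 0 < z.im := hz
  have h1 := half_im_le_of_mem_closedBall h
  rw [Metric.mem_closedBall, dist_eq_norm] at h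
  have h2 : ‖ζ‖ ≤ 3 / 2 * ‖z‖ := by
    have h3 := norm_add_le (ζ - z) z
    rw [sub_add_cancel] at h3
    have h4 := (le_abs_self z.im).trans (Complex.abs_im_le_norm z)
    linarith
  have h5 : ‖ζ‖ ^ 2 ≤ 9 / 4 * ‖z‖ ^ 2 := by nlinarith [norm_nonneg ζ, norm_nonneg z]
  rw [height, height, div_le_iff₀ (by linarith)]
  calc 1 + ‖ζ‖ ^ 2 ≤ 5 / 2 * (1 + ‖z‖ ^ 2) := by nlinarith [sq_nonneg ‖z‖]
    _ = 5 * ((1 + ‖z‖ ^ 2) / z.im) * (z.im / 2) := by field_simp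
    _ ≤ _ := by gcongr

theorem diffContOnCl_ball {f : ℂ → ℂ} (hf : DifferentiableOn ℂ f upper) {z : ℂ}
    (hz : z ∈ upper) : DiffContOnCl ℂ f (Metric.ball z (z.im / 2)) :=
  DifferentiableOn.diffContOnCl (hf.mono (Metric.closure_ball_subset_closedBall.trans
    (closedBall_subset_upper hz)))

/-- Cauchy's estimate on the disc of radius `y/2`; the factor `2/y` is absorbed by one more power of
the height. -/
theorem Moderate.deriv {f : ℂ → ℂ} (hf : DifferentiableOn ℂ f upper) (h : Moderate f) :
    Moderate (deriv f) := by
  obtain ⟨C, hC, N, hN⟩ := h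
  refine ⟨2 * C * 5 ^ N, by positivity, N + 1, fun z hz => ?_⟩
  have hz' : 0 < z.im := hz
  have h1 := one_le_height hz
  have h2 := Complex.norm_deriv_le_of_forall_mem_sphere_norm_le (R := z.im / 2) (by positivity)
    (diffContOnCl_ball hf hz) (C := C * (5 * height z) ^ N) fun ζ hζ => by
      have hζ' := Metric.sphere_subset_closedBall hζ
      have h3 := one_le_height (closedBall_subset_upper hz hζ')
      have h4 := height_le_of_mem_closedBall hz hζ'
      refine (hN ζ (closedBall_subset_upper hz hζ')).trans ?_
      gcongr
  refine h2.trans ?_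
  calc C * (5 * height z) ^ N / (z.im / 2) = 2 * C * 5 ^ N * height z ^ N * z.im⁻¹ := by
        rw [mul_pow]; field_simp
    _ ≤ 2 * C * 5 ^ N * height z ^ N * height z := by
        gcongr; exact inv_im_le_height hz
    _ = _ := by ring

/-- The leading coefficient of a polynomial in `y` with holomorphic coefficients has moderate
growth if the polynomial has. -/
theorem moderate_leading {m : ℕ} {g : ℕ → ℂ → ℂ} (hg : ∀ i, DifferentiableOn ℂ (g i) upper)
    (h : Moderate fun z => ∑ i ∈ Finset.range (m + 1), (z.im : ℂ) ^ i * g i z) :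
    Moderate (g m) := by
  obtain ⟨C, hC, N, hN⟩ := h
  refine ⟨4 ^ m * C * 5 ^ N, by positivity, N + m, fun z hz => ?_⟩
  have hz' : 0 < z.im := hz
  have h1 := one_le_height hz
  set r : ℝ := z.im / 2 with hr
  have hr0 : 0 < r := by positivity
  -- On the circle `|ζ - z| = r` one has `conj ζ - conj z = r² / (ζ - z)`, so `Im ζ · (ζ - z)`
  -- agrees there with the polynomial `Q ζ`. Therefore `(ζ - z)^m` times the given polynomial in `y`
  -- agrees on the circle with the holomorphic function `P`. At the center only the top term of `P`
  -- survives, and the maximum principle bounds it.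
  let Q : ℂ → ℂ := fun ζ => ((ζ - (starRingEnd ℂ) z) * (ζ - z) - (r : ℂ) ^ 2) / (2 * Complex.I)
  let P : ℂ → ℂ := fun ζ => ∑ i ∈ Finset.range (m + 1), Q ζ ^ i * g i ζ * (ζ - z) ^ (m - i)
  have hQ : Differentiable ℂ Q := by fun_prop
  have hP : DifferentiableOn ℂ P upper := by
    refine DifferentiableOn.fun_sum fun i _ => ?_
    exact ((hQ.differentiableOn.pow i).mul (hg i)).mul (by fun_prop)
  have hsph : ∀ ζ ∈ Metric.sphere z r, Q ζ = ζ.im * (ζ - z) := by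
    intro ζ hζ
    rw [mem_sphere_iff_norm] at hζ
    have h2 : (r : ℂ) ^ 2 = (ζ - z) * ((starRingEnd ℂ) ζ - (starRingEnd ℂ) z) := by
      rw [← map_sub, Complex.mul_conj, Complex.normSq_eq_norm_sq, hζ]; push_cast; rfl
    have h3 : (ζ.im : ℂ) = (ζ - (starRingEnd ℂ) ζ) / (2 * Complex.I) := by
      rw [Complex.sub_conj]
      push_cast
      field_simp
    simp only [Q]
    rw [h2, h3]
    field_simp
    ring
  have hb : ∀ ζ ∈ frontier (Metric.ball z r), ‖P ζ‖ ≤ C * (5 * height z) ^ N * r ^ m := by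
    intro ζ hζ
    rw [frontier_ball z hr0.ne'] at hζ
    have hζ' := Metric.sphere_subset_closedBall hζ
    have h3 := one_le_height (closedBall_subset_upper hz hζ')
    have h4 := height_le_of_mem_closedBall hz hζ'
    have e : P ζ = (∑ i ∈ Finset.range (m + 1), (ζ.im : ℂ) ^ i * g i ζ) * (ζ - z) ^ m := by
      simp only [P]
      rw [Finset.sum_mul]
      refine Finset.sum_congr rfl fun i hi => ?_
      have hi' : i ≤ m := Nat.lt_succ_iff.1 (Finset.mem_range.1 hi)
      rw [hsph ζ hζ, mul_pow]
      conv_rhs => rw [← Nat.add_sub_of_le hi', pow_add]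
      ring
    rw [e, norm_mul, norm_pow, mem_sphere_iff_norm.1 hζ]
    gcongr
    refine (hN ζ (closedBall_subset_upper hz hζ')).trans ?_
    gcongr
  have h5 := Complex.norm_le_of_forall_mem_frontier_norm_le Metric.isBounded_ball
    (diffContOnCl_ball hP hz) hb (subset_closure (Metric.mem_ball_self hr0))
  have h6 : P z = Q z ^ m * g m z := by
    simp only [P]
    rw [Finset.sum_eq_single m]
    · simp
    · intro i hi hne
      have hi' : i ≤ m := Nat.lt_succ_iff.1 (Finset.mem_range.1 hi)
      rw [sub_self, zero_pow (by omega), mul_zero]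
    · intro hm
      exact absurd (Finset.mem_range.2 (Nat.lt_succ_self m)) hm
  have h7 : ‖Q z‖ = r ^ 2 / 2 := by
    simp only [Q]
    rw [sub_self, mul_zero, zero_sub, norm_div, norm_neg, norm_pow, Complex.norm_real,
      Real.norm_of_nonneg hr0.le, norm_mul, Complex.norm_I]
    simp
  rw [h6, norm_mul, norm_pow, h7] at h5
  have h8 : ‖g m z‖ ≤ C * (5 * height z) ^ N * (2 / r) ^ m := by
    have hrm : 0 < (r ^ 2 / 2) ^ m := by positivity
    refine le_of_mul_le_mul_left (h5.trans (le_of_eq ?_)) hrm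
    have : r ^ m = (r ^ 2 / 2) ^ m * (2 / r) ^ m := by
      rw [← mul_pow]; congr 1; field_simp
    rw [this]; ring
  refine h8.trans ?_
  have h9 : 2 / r = 4 * z.im⁻¹ := by rw [hr]; field_simp; norm_num
  rw [h9]
  calc C * (5 * height z) ^ N * (4 * z.im⁻¹) ^ m ≤ C * (5 * height z) ^ N * (4 * height z) ^ m := by
        gcongr; exact inv_im_le_height hz
    _ = _ := by rw [mul_pow, mul_pow, pow_add]; ring

/-- Subtract the leading term, which is moderate, and repeat in lower degree. -/
theorem moderate_coeff {m : ℕ} {g : ℕ → ℂ → ℂ} (hg : ∀ i, DifferentiableOn ℂ (g i) upper)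
    (h : Moderate fun z => ∑ i ∈ Finset.range m, (z.im : ℂ) ^ i * g i z) :
    ∀ i < m, Moderate (g i) := by
  induction m with
  | zero => intro i hi; omega
  | succ m ih =>
    have h1 := moderate_leading hg h
    have h2 : Moderate fun z => ∑ i ∈ Finset.range m, (z.im : ℂ) ^ i * g i z :=
      (h.sub ((Moderate.im_pow m).mul h1)).congr fun z _ => by
        rw [Finset.sum_range_succ]; ring
    intro i hi
    rcases Nat.lt_succ_iff_lt_or_eq.1 hi with hi | rfl
    · exact ih h2 i hi
    · exact h1

/-- Multiplication by `y^{m-1}` turns a polynomial in `1/y` into one in `y` with the coefficients in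
reverse order. -/
theorem moderate_coeff_div {m : ℕ} {f : ℕ → ℂ → ℂ} (hf : ∀ i, DifferentiableOn ℂ (f i) upper)
    (h : Moderate fun z => ∑ j ∈ Finset.range m, f j z / (z.im : ℂ) ^ j) :
    ∀ j < m, Moderate (f j) := by
  have h1 : Moderate fun z => ∑ i ∈ Finset.range m, (z.im : ℂ) ^ i * f (m - 1 - i) z := by
    refine ((Moderate.im_pow (m - 1)).mul h).congr fun z hz => ?_
    have hz' : (z.im : ℂ) ≠ 0 := by exact_mod_cast (show z.im ≠ 0 from hz.ne')
    rw [← Finset.sum_range_reflect, Finset.mul_sum]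
    refine Finset.sum_congr rfl fun j hj => ?_
    have hj' : j < m := Finset.mem_range.1 hj
    have e : m - 1 - (m - 1 - j) = j := by omega
    have e2 : (z.im : ℂ) ^ (m - 1) = (z.im : ℂ) ^ (m - 1 - j) * (z.im : ℂ) ^ j := by
      rw [← pow_add]; congr 1; omega
    rw [e, e2]
    field_simp
  intro j hj
  have h2 := moderate_coeff (g := fun i => f (m - 1 - i)) (fun i => hf _) h1 (m - 1 - j) (by omega)
  have e : m - 1 - (m - 1 - j) = j := by omega
  simpa only [e] using h2

end AutSL2

namespace AutSL2

open Matrix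

/-! ### Slowly increasing functions -/

theorem slNorm_sq (g : SL(2, ℝ)) :
    slNorm g ^ 2 = g.1 0 0 ^ 2 + g.1 0 1 ^ 2 + g.1 1 0 ^ 2 + g.1 1 1 ^ 2 := by
  have h : (g.1ᵀ * g.1).trace = g.1 0 0 ^ 2 + g.1 0 1 ^ 2 + g.1 1 0 ^ 2 + g.1 1 1 ^ 2 := by
    simp only [trace_fin_two, Matrix.mul_apply, Fin.sum_univ_two, transpose_apply]
    ring
  rw [slNorm, h, Real.sq_sqrt (by positivity)]

theorem slNorm_mul_SO2 (g : SL(2, ℝ)) (k : SO2) : slNorm (g * k) = slNorm g := by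
  rw [slNorm, slNorm]
  congr 1
  have h : k.1.1 * k.1.1ᵀ = 1 := k.2
  change ((g.1 * k.1.1)ᵀ * (g.1 * k.1.1)).trace = _
  rw [trace_mul_comm, transpose_mul, mul_assoc, ← mul_assoc k.1.1, h, one_mul, trace_mul_comm]

/-- The point `(1 x; 0 1) (y^{1/2} 0; 0 y^{-1/2})` of `SL₂(ℝ)` for `z = x + iy`. -/
noncomputable def naMat (z : ℂ) : SL(2, ℝ) := normalize (hpMat z)

theorem naMat_eq {z : ℂ} (hz : 0 < z.im) : naMat z = nMat z.re * aMat z.im hz :=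
  normalize_hpMat hz

theorem pull_eq (n : ℤ) (Φ : SL(2, ℝ) → ℂ) (z : ℂ) :
    pull n Φ z = ((z.im ^ (-(n : ℝ) / 2) : ℝ) : ℂ) * Φ (naMat z) := rfl

theorem apply_naMat_eq (n : ℤ) (Φ : SL(2, ℝ) → ℂ) {z : ℂ} (hz : 0 < z.im) :
    Φ (naMat z) = ((z.im ^ ((n : ℝ) / 2) : ℝ) : ℂ) * pull n Φ z := by
  rw [pull_eq, ← mul_assoc, ← Complex.ofReal_mul, ← Real.rpow_add hz]
  ring_nf
  simp

theorem naMat_val {z : ℂ} (hz : 0 < z.im) :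
    (naMat z).1 = !![Real.sqrt z.im, z.re / Real.sqrt z.im; 0, (Real.sqrt z.im)⁻¹] := by
  have h0 : Real.sqrt z.im ≠ 0 := (Real.sqrt_pos.2 hz).ne'
  have h1 : Real.sqrt z.im * Real.sqrt z.im = z.im := Real.mul_self_sqrt hz.le
  rw [naMat_eq hz]
  change (nMat z.re).1 * (aMat z.im hz).1 = _
  ext i j
  fin_cases i <;> fin_cases j <;> simp [nMat, aMat, Matrix.mul_apply]
  ring

theorem slNorm_naMat {z : ℂ} (hz : 0 < z.im) : slNorm (naMat z) ^ 2 = height z := by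
  have h1 : Real.sqrt z.im ^ 2 = z.im := Real.sq_sqrt hz.le
  rw [slNorm_sq, naMat_val hz, height, Complex.sq_norm, Complex.normSq_apply]
  simp [div_pow, h1]
  field_simp
  ring

/-- The Iwasawa decomposition. -/
theorem exists_eq_naMat_mul_rot (g : SL(2, ℝ)) : ∃ z ∈ upper, ∃ θ, g = naMat z * rot θ := by
  have hd := g.2
  rw [det_fin_two] at hd
  set a := g.1 0 0 with ha
  set b := g.1 0 1 with hb
  set c := g.1 1 0 with hc
  set d := g.1 1 1 with hd'
  have hD : 0 < c ^ 2 + d ^ 2 := by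
    by_contra hn
    have h1 : c = 0 := by nlinarith [sq_nonneg c, sq_nonneg d]
    have h2 : d = 0 := by nlinarith [sq_nonneg c, sq_nonneg d]
    rw [h1, h2] at hd; simp at hd
  set s := Real.sqrt (c ^ 2 + d ^ 2) with hs
  have hs0 : 0 < s := Real.sqrt_pos.2 hD
  have hs2 : s ^ 2 = c ^ 2 + d ^ 2 := Real.sq_sqrt hD.le
  -- This is `g · i = (ai + b) / (ci + d)`. The rotation below has the normalized bottom row `(c, d)
  -- / s` of `g` as its own bottom row.
  let z : ℂ := ⟨(a * c + b * d) / s ^ 2, 1 / s ^ 2⟩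
  have hz : 0 < z.im := by simp only [z]; positivity
  have hsz : Real.sqrt z.im = s⁻¹ := by
    simp only [z]
    rw [show 1 / s ^ 2 = (s⁻¹) ^ 2 by field_simp, Real.sqrt_sq (by positivity)]
  let k : SO2 := ⟨⟨!![d / s, -c / s; c / s, d / s], by
    rw [det_fin_two_of]; field_simp; linarith⟩, by
    change !![d / s, -c / s; c / s, d / s] * !![d / s, -c / s; c / s, d / s]ᵀ = 1
    ext i j
    fin_cases i <;> fin_cases j <;> simp [Matrix.mul_apply] <;> field_simp <;> linarith⟩
  obtain ⟨θ, hθ⟩ := exists_rot_eq k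
  refine ⟨z, hz, θ, ?_⟩
  rw [← hθ]
  apply Subtype.ext
  change g.1 = (naMat z).1 * k.1.1
  rw [naMat_val hz, hsz]
  have h3 : c ^ 2 + d ^ 2 ≠ 0 := hD.ne'
  ext i j
  fin_cases i <;> fin_cases j <;> simp [Matrix.mul_apply, k, z]
  · rw [← ha]
    field_simp
    rw [hs2]
    linear_combination d * hd
  · rw [← hb]
    field_simp
    rw [hs2]
    linear_combination (-c) * hd
  · rw [← hc]; field_simp
  · rw [← hd']; field_simp

theorem norm_apply_mul_rot {n : ℤ} {Φ : Smooth} (hΦ : Φ ∈ wt n) (g : SL(2, ℝ)) (θ : ℝ) :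
    ‖Φ.1 (g * rot θ)‖ = ‖Φ.1 g‖ := by
  rw [wt_apply hΦ, norm_mul]
  have : Complex.I * n * θ = ((n * θ : ℝ) : ℂ) * Complex.I := by push_cast; ring
  rw [this, Complex.norm_exp_ofReal_mul_I, one_mul]

/-- Right translation by `K` changes neither `|Φ|` nor the norm, the squared norm of `naMat z` is
the height of `z`, and powers of `y` are moderate in both directions. -/
theorem slowlyIncreasing_iff_moderate {n : ℤ} {Φ : Smooth} (hΦ : Φ ∈ wt n) :
    Φ ∈ slowlyIncreasing ↔ Moderate (pull n Φ) := by
  constructor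
  · rintro ⟨C, N, h⟩
    have h1 : Moderate fun z => Φ.1 (naMat z) := by
      refine ⟨|C|, abs_nonneg C, N, fun z hz => (h _).trans ?_⟩
      have h2 := one_le_slNorm (naMat z)
      have h3 : slNorm (naMat z) ≤ height z := by
        rw [← slNorm_naMat hz]; nlinarith
      gcongr
      exact le_abs_self C
    exact ((Moderate.rpow_im (-(n : ℝ) / 2)).mul h1).congr fun z _ => rfl
  · intro h
    have h1 : Moderate fun z => Φ.1 (naMat z) :=
      ((Moderate.rpow_im ((n : ℝ) / 2)).mul h).congr fun z hz => apply_naMat_eq n Φ.1 hz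
    obtain ⟨C, -, N, hN⟩ := h1
    refine ⟨C, 2 * N, fun g => ?_⟩
    obtain ⟨z, hz, θ, rfl⟩ := exists_eq_naMat_mul_rot g
    rw [norm_apply_mul_rot hΦ, slNorm_mul_SO2, pow_mul, slNorm_naMat hz]
    exact hN z hz

/-- The image of a slowly increasing `𝔫`-finite weight vector under `L` and `R` is slowly
increasing. -/
theorem lie_mem_slowlyIncreasing_of_wt {n : ℤ} {Φ : Smooth} (hΦ : Φ ∈ wt n)
    (hs : Φ ∈ slowlyIncreasing) (hn : Φ ∈ nFinite) :
    ⁅Lel, Φ⁆ ∈ slowlyIncreasing ∧ ⁅Rel, Φ⁆ ∈ slowlyIncreasing := by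
  obtain ⟨v, hv⟩ := hn
  obtain ⟨f, hf, he⟩ := exists_pull_eq_sum v hΦ hv
  have hF := (slowlyIncreasing_iff_moderate hΦ).1 hs
  -- This is where `𝔫`-finiteness controls derivatives: they are expressed through holomorphic
  -- coefficients of moderate growth, to which Cauchy's estimate applies.
  have hm := moderate_coeff_div hf (hF.congr fun z hz => (he z hz).symm)
  let A : ℂ → ℂ := fun z => ∑ j ∈ Finset.range v, deriv (f j) z / (z.im : ℂ) ^ j
  let B : ℂ → ℂ := fun z => ∑ j ∈ Finset.range v,
    (Complex.I * deriv (f j) z / (z.im : ℂ) ^ j - j * f j z / (z.im : ℂ) ^ (j + 1))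
  have hdm : ∀ j ∈ Finset.range v, Moderate (deriv (f j)) := fun j hj =>
    (hm j (Finset.mem_range.1 hj)).deriv (hf j)
  have hA : Moderate A := Moderate.sum fun j hj =>
    ((hdm j hj).mul (Moderate.im_pow_inv j)).congr fun z _ => div_eq_mul_inv _ _
  have hB : Moderate B := Moderate.sum fun j hj =>
    ((((Moderate.const Complex.I).mul (hdm j hj)).mul (Moderate.im_pow_inv j)).sub
      (((Moderate.const j).mul (hm j (Finset.mem_range.1 hj))).mul
        (Moderate.im_pow_inv (j + 1)))).congr fun z _ => by simp only [div_eq_mul_inv]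
  have hAB : ∀ z ∈ upper, HasPartials (pull n Φ) (A z) (B z) z := fun z hz => by
    refine (HasPartials.sum (s := Finset.range v)
      fun j _ => hasPartials_div_im_pow (hf j) j hz).congr_of_eventuallyEq ?_
    filter_upwards [isOpen_upper.mem_nhds hz] with w hw using he w hw
  rw [slowlyIncreasing_iff_moderate (lie_Lel_mem_wt hΦ),
    slowlyIncreasing_iff_moderate (lie_Rel_mem_wt hΦ)]
  constructor
  · refine ((Moderate.im_pow 2).mul (hB.sub ((Moderate.const Complex.I).mul hA))).congr ?_
    intro z hz
    obtain ⟨a, b, hab, hL, -⟩ := exists_hasPartials_pull hΦ hz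
    obtain ⟨rfl, rfl⟩ := hab.unique (hAB z hz)
    exact hL
  · refine ((hB.add ((Moderate.const Complex.I).mul hA)).add
      (((Moderate.const n).mul (Moderate.im_pow_inv 1)).mul hF)).congr ?_
    intro z hz
    obtain ⟨a, b, hab, -, hR⟩ := exists_hasPartials_pull hΦ hz
    obtain ⟨rfl, rfl⟩ := hab.unique (hAB z hz)
    rw [hR, div_eq_mul_inv, pow_one]

end AutSL2

namespace AutSL2

open Matrix

/-! ### Stability of the space of cusp forms -/

theorem continuous_apply_of_pt {X : Type*} [TopologicalSpace X] (Φ : Smooth) {γ : X → SL(2, ℝ)}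
    (h : Continuous fun x => pt (γ x)) : Continuous fun x => Φ.1 (γ x) := by
  have h2 : (fun x => Φ.1 (γ x)) = ext Φ.1 ∘ fun x => pt (γ x) := by
    funext x
    simp only [Function.comp, ext, normalize_pt]
  rw [h2]
  exact Φ.2.continuousOn.comp_continuous h fun x => pt_mem _

theorem pt_mul_apply (a b : SL(2, ℝ)) (i j : Fin 2) :
    pt (a * b) i j = a.1 i 0 * b.1 0 j + a.1 i 1 * b.1 1 j := by
  change (a.1 * b.1) i j = _
  simp [Matrix.mul_apply]

theorem hasDerivAt_apply_mul_expSL (X : sl2R) (Φ : Smooth) (a : SL(2, ℝ)) (t : ℝ) :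
    HasDerivAt (fun t : ℝ => Φ.1 (a * expSL (t • X))) ((lieD X Φ).1 (a * expSL (t • X))) t := by
  have h0 : HasDerivAt (fun t : ℝ => pt (a * expSL (t • X)))
      (mulR X.1 (pt (a * expSL (t • X)))) t := by
    refine hasDerivAt_pi.2 fun i => hasDerivAt_pi.2 fun j => ?_
    have he := fun k => hasDerivAt_exp_entry X.1 t k j
    have h1 := ((he 0).const_mul (a.1 i 0)).add ((he 1).const_mul (a.1 i 1))
    have h2 : (fun t : ℝ => pt (a * expSL (t • X)) i j) = (fun t : ℝ =>
        a.1 i 0 * NormedSpace.exp (t • X.1) 0 j) + (fun t : ℝ =>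
        a.1 i 1 * NormedSpace.exp (t • X.1) 1 j) := funext fun t => pt_mul_apply _ _ i j
    rw [h2]
    refine h1.congr_deriv ?_
    have e : ∀ k, (expSL (t • X)).1 k = NormedSpace.exp (t • X.1) k := fun _ => rfl
    rw [mulR_apply, pt_mul_apply, pt_mul_apply]
    simp only [Matrix.mul_apply, Fin.sum_univ_two, e]
    ring
  have h1 := (differentiableAt_ext Φ (pt_mem (a * expSL (t • X)))).hasFDerivAt.comp_hasDerivAt t h0
  rw [lieD_apply]
  refine h1.congr_of_eventuallyEq (Filter.Eventually.of_forall fun t => ?_)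
  simp only [Function.comp, ext, normalize_pt]

theorem continuous_expSL (X : sl2R) (i j : Fin 2) :
    Continuous fun t : ℝ => (expSL (t • X)).1 i j :=
  continuous_iff_continuousAt.2 fun t => (hasDerivAt_exp_entry X.1 t i j).continuousAt

/-- Replace `g` by `g exp(tX)` in the constant term, which vanishes for all `t`, and differentiate
under the integral sign. -/
theorem lieD_mem_cuspidal {Γ : Subgroup SL(2, ℚ)} (X : sl2R) {Φ : Smooth} (hΦ : Φ ∈ cuspidal Γ) :
    lieD X Φ ∈ cuspidal Γ := by
  intro σ h hh hσ g
  let γ : ℝ → ℝ → SL(2, ℝ) := fun t x =>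
    toReal σ * nMat x * (toReal σ)⁻¹ * g * expSL (t • X)
  have hγ : Continuous fun p : ℝ × ℝ => pt (γ p.1 p.2) := by
    refine continuous_pi fun i => continuous_pi fun j => ?_
    have e : ∀ p : ℝ × ℝ, pt (γ p.1 p.2) i j =
        pt (toReal σ * (nMat p.2 * ((toReal σ)⁻¹ * g))) i 0 * (expSL (p.1 • X)).1 0 j +
        pt (toReal σ * (nMat p.2 * ((toReal σ)⁻¹ * g))) i 1 * (expSL (p.1 • X)).1 1 j := by
      intro p
      refine Eq.trans ?_ (pt_mul_apply _ _ i j)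
      simp only [γ, mul_assoc]
    have hn : ∀ k, Continuous fun p : ℝ × ℝ =>
        pt (toReal σ * (nMat p.2 * ((toReal σ)⁻¹ * g))) i k := by
      intro k
      have e2 : ∀ k l, (fun p : ℝ × ℝ => (nMat p.2 * ((toReal σ)⁻¹ * g)).1 k l) = fun p =>
          (nMat p.2 : SL(2, ℝ)).1 k 0 * ((toReal σ)⁻¹ * g).1 0 l +
          (nMat p.2 : SL(2, ℝ)).1 k 1 * ((toReal σ)⁻¹ * g).1 1 l :=
        fun k l => funext fun p => pt_mul_apply _ _ k l
      have c : ∀ k l, Continuous fun p : ℝ × ℝ => (nMat p.2 : SL(2, ℝ)).1 k l := by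
        intro k l
        fin_cases k <;> fin_cases l <;> simp [nMat] <;> fun_prop
      have c2 : ∀ k l, Continuous fun p : ℝ × ℝ => (nMat p.2 * ((toReal σ)⁻¹ * g)).1 k l := by
        intro k l
        rw [e2]
        exact ((c k 0).mul continuous_const).add ((c k 1).mul continuous_const)
      simp only [pt_mul_apply (toReal σ)]
      exact (continuous_const.mul (c2 0 k)).add (continuous_const.mul (c2 1 k))
    simp only [e]
    exact ((hn 0).mul ((continuous_expSL X 0 j).comp continuous_fst)).add
      ((hn 1).mul ((continuous_expSL X 1 j).comp continuous_fst))
  have c1 := continuous_apply_of_pt Φ hγ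
  have c2 := continuous_apply_of_pt (lieD X Φ) hγ
  -- The integrand's `t`-derivative is continuous, hence bounded for `|t| ≤ 1` and `x` in the period
  -- interval; this constant is the dominating function.
  obtain ⟨C, hC⟩ := ((isCompact_Icc (a := (-1 : ℝ)) (b := 1)).prod
    (isCompact_uIcc (a := (0 : ℝ)) (b := h))).exists_bound_of_continuousOn c2.continuousOn
  have key := (intervalIntegral.hasDerivAt_integral_of_dominated_loc_of_deriv_le
    (μ := MeasureTheory.volume) (a := 0) (b := h) (bound := fun _ => C)
    (F := fun t x => Φ.1 (γ t x)) (F' := fun t x => (lieD X Φ).1 (γ t x)) (x₀ := (0 : ℝ))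
    (Icc_mem_nhds (by norm_num : (-1 : ℝ) < 0) one_pos)
    (Filter.Eventually.of_forall fun t =>
      (c1.comp (Continuous.prodMk_right t)).aestronglyMeasurable)
    ((c1.comp (Continuous.prodMk_right 0)).intervalIntegrable _ _)
    (c2.comp (Continuous.prodMk_right 0)).aestronglyMeasurable
    (Filter.Eventually.of_forall fun x hx t ht =>
      hC (t, x) ⟨ht, Set.uIoc_subset_uIcc hx⟩)
    (continuous_const.intervalIntegrable _ _)
    (Filter.Eventually.of_forall fun x _ t _ => hasDerivAt_apply_mul_expSL X Φ _ t)).2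
  have h0 : ∀ t : ℝ, ∫ x in (0 : ℝ)..h, Φ.1 (γ t x) = 0 := by
    intro t
    simpa only [γ, mul_assoc] using hΦ σ h hh hσ (g * expSL (t • X))
  simp only [h0] at key
  have h1 := key.unique (hasDerivAt_const (0 : ℝ) (0 : ℂ))
  have he : expSL ((0 : ℝ) • X) = 1 := Subtype.ext (by simp [expSL])
  simpa only [γ, he, mul_one] using h1

theorem lie_mem_cuspidal {Γ : Subgroup SL(2, ℚ)} (Z : sl2C) {Φ : Smooth} (hΦ : Φ ∈ cuspidal Γ) :
    ⁅Z, Φ⁆ ∈ cuspidal Γ :=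
  add_mem (lieD_mem_cuspidal (reSl Z) hΦ)
    (Submodule.smul_mem _ Complex.I (lieD_mem_cuspidal (imSl Z) hΦ))

theorem lie_mem_leftInvariant {Γ : Subgroup SL(2, ℚ)} (Z : sl2C) {Φ : Smooth}
    (hΦ : Φ ∈ leftInvariant Γ) : ⁅Z, Φ⁆ ∈ leftInvariant Γ := by
  intro γ hγ g
  simp only [lie_smooth_apply, lieDeriv, mul_assoc, hΦ γ hγ]

theorem envAction_ι (Z : sl2C) (Φ : Smooth) :
    envAction (UniversalEnvelopingAlgebra.ι ℂ Z) Φ = ⁅Z, Φ⁆ := by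
  rw [envAction, UniversalEnvelopingAlgebra.lift_ι_apply]
  rfl

/-- Central elements commute with `Z`, so the `𝒵`-orbit of `Z.Φ` lies in the image of that of `Φ`
under `Z`. -/
theorem lie_mem_zFinite (Z : sl2C) {Φ : Smooth} (hΦ : Φ ∈ zFinite) : ⁅Z, Φ⁆ ∈ zFinite := by
  have : FiniteDimensional ℂ (zOrbit Φ) := hΦ
  refine Submodule.finiteDimensional_of_le (S₂ := (zOrbit Φ).map (cLieHom Z)) ?_
  rintro _ ⟨z, hz, rfl⟩
  refine ⟨envAction z Φ, ⟨z, hz, rfl⟩, ?_⟩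
  have hz' : z ∈ Subalgebra.center ℂ (UniversalEnvelopingAlgebra ℂ sl2C) := hz
  have hc := Subalgebra.mem_center_iff.1 hz' (UniversalEnvelopingAlgebra.ι ℂ Z)
  have h1 := congrArg (fun u => envAction u Φ) hc
  simp only [map_mul, Module.End.mul_apply, envAction_ι] at h1
  exact h1

theorem lie_Lel_Rel_apply {n : ℤ} {Φ : Smooth} (hΦ : Φ ∈ wt n) :
    ⁅Lel, ⁅Rel, Φ⁆⁆ = ⁅Rel, ⁅Lel, Φ⁆⁆ - (n : ℂ) • Φ := by
  have h := lie_lie Rel Lel Φ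
  rw [lie_Rel_Lel, lie_Hel_of_wt hΦ] at h
  rw [h]
  abel

/-- On weight vectors `[L, R] = -H` is a scalar. Moving one `L` past `R` reduces to `L Φ`, so `R`
costs only one additional power of `L`. -/
theorem pow_Lel_apply_Rel (v : ℕ) : ∀ {n : ℤ} {Φ : Smooth}, Φ ∈ wt n →
    (cLieHom Lel ^ v) Φ = 0 → (cLieHom Lel ^ (v + 1)) ⁅Rel, Φ⁆ = 0 := by
  induction v with
  | zero =>
    intro n Φ _ h
    have h' : Φ = 0 := h
    rw [h', lie_zero, map_zero]
  | succ v ih =>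
    intro n Φ hΦ h
    rw [pow_succ, Module.End.mul_apply] at h
    rw [pow_succ, Module.End.mul_apply]
    have h1 : cLieHom Lel ⁅Rel, Φ⁆ = ⁅Rel, ⁅Lel, Φ⁆⁆ - (n : ℂ) • Φ := lie_Lel_Rel_apply hΦ
    rw [h1, map_sub, map_smul, ih (lie_Lel_mem_wt hΦ) h, pow_succ, Module.End.mul_apply, h,
      smul_zero, sub_zero]

theorem lie_Lel_mem_nFinite {Φ : Smooth} (h : Φ ∈ nFinite) : ⁅Lel, Φ⁆ ∈ nFinite := by
  obtain ⟨v, hv⟩ := h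
  refine ⟨v, ?_⟩
  change (cLieHom Lel ^ v) (cLieHom Lel Φ) = 0
  rw [← Module.End.mul_apply, ← pow_succ, pow_succ', Module.End.mul_apply, hv, map_zero]

theorem pow_Lel_apply_Hel (v : ℕ) : ∀ Φ : Smooth, (cLieHom Lel ^ v) ⁅Hel, Φ⁆ =
    ⁅Hel, (cLieHom Lel ^ v) Φ⁆ + (2 * v : ℂ) • (cLieHom Lel ^ v) Φ := by
  induction v with
  | zero => intro Φ; simp
  | succ v ih =>
    intro Φ
    have h := lie_lie Hel Lel Φ
    rw [lie_Hel_Lel, smul_lie] at h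
    have h1 : cLieHom Lel ⁅Hel, Φ⁆ = ⁅Hel, ⁅Lel, Φ⁆⁆ + (2 : ℂ) • ⁅Lel, Φ⁆ := by
      change ⁅Lel, ⁅Hel, Φ⁆⁆ = _
      rw [eq_sub_iff_add_eq] at h
      rw [← h]
      module
    rw [pow_succ, Module.End.mul_apply, Module.End.mul_apply, h1, map_add, map_smul, ih, add_assoc,
      ← add_smul]
    congr 2
    push_cast
    ring

theorem lie_Hel_mem_nFinite {Φ : Smooth} (h : Φ ∈ nFinite) : ⁅Hel, Φ⁆ ∈ nFinite := by
  obtain ⟨v, hv⟩ := h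
  exact ⟨v, by rw [pow_Lel_apply_Hel, hv, lie_zero, smul_zero, add_zero]⟩

theorem wt_le_kFinite (n : ℤ) : wt n ≤ kFinite := by
  intro Φ hΦ
  refine Submodule.finiteDimensional_of_le (S₂ := Submodule.span ℂ {Φ}) ?_
  refine Submodule.span_le.2 ?_
  rintro _ ⟨k, rfl⟩
  obtain ⟨θ, rfl⟩ := exists_rot_eq k
  exact Submodule.mem_span_singleton.2 ⟨_, (hΦ θ).symm⟩

theorem rightTrans_mem_cuspidal {Γ : Subgroup SL(2, ℚ)} (k : SO2) {Φ : Smooth}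
    (hΦ : Φ ∈ cuspidal Γ) : rightTrans k Φ ∈ cuspidal Γ := by
  intro σ h hh hσ g
  have h1 := hΦ σ h hh hσ (g * k)
  simp only [← mul_assoc] at h1
  exact h1

theorem rightTrans_mem_leftInvariant {Γ : Subgroup SL(2, ℚ)} (k : SO2) {Φ : Smooth}
    (hΦ : Φ ∈ leftInvariant Γ) : rightTrans k Φ ∈ leftInvariant Γ := by
  intro γ hγ g
  have h1 := hΦ γ hγ (g * k)
  rw [← mul_assoc] at h1
  exact h1

theorem rightTrans_mem_slowlyIncreasing (k : SO2) {Φ : Smooth} (hΦ : Φ ∈ slowlyIncreasing) :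
    rightTrans k Φ ∈ slowlyIncreasing := by
  obtain ⟨C, N, h⟩ := hΦ
  refine ⟨C, N, fun g => ?_⟩
  rw [← slNorm_mul_SO2 g k]
  exact h (g * k)

theorem kOrbit_le_of_stable {Φ : Smooth} {W : Submodule ℂ Smooth} (hΦ : Φ ∈ W)
    (hW : ∀ (k : SO2), ∀ Ψ ∈ W, rightTrans k Ψ ∈ W) : kOrbit Φ ≤ W := by
  refine Submodule.span_le.2 ?_
  rintro _ ⟨k, rfl⟩
  exact hW k Φ hΦ

theorem lieD_kGen_eq (Φ : Smooth) : lieD kGen Φ = Complex.I • ⁅Hel, Φ⁆ := by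
  rw [lie_Hel_eq, smul_smul]
  simp

theorem mem_nFiniteCuspForms {Γ : Subgroup SL(2, ℚ)} {Φ : Smooth} :
    Φ ∈ nFiniteCuspForms Γ ↔ Φ ∈ leftInvariant Γ ∧ Φ ∈ kFinite ∧ Φ ∈ zFinite ∧
      Φ ∈ slowlyIncreasing ∧ Φ ∈ cuspidal Γ ∧ Φ ∈ nFinite := by
  simp only [nFiniteCuspForms, automorphicForms, Submodule.mem_inf]
  tauto

/-- Invariance, growth and cuspidality pass to weight components through `K`-stability, `𝒵`- and
`𝔫`-finiteness through stability under `H`. -/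
theorem mem_iSup_wt_inf_nFiniteCuspForms {Γ : Subgroup SL(2, ℚ)} {Φ : Smooth}
    (hΦ : Φ ∈ nFiniteCuspForms Γ) : Φ ∈ ⨆ n : ℤ, wt n ⊓ nFiniteCuspForms Γ := by
  obtain ⟨h1, h2, h3, h4, h5, h6⟩ := mem_nFiniteCuspForms.1 hΦ
  refine SetLike.le_def.1 (iSup_mono fun n => ?_) (mem_iSup_wt_inf_krylov h2)
  rintro Ψ ⟨hn, hΨ⟩
  have hK := krylov_le_kOrbit h2 hΨ
  refine ⟨hn, mem_nFiniteCuspForms.2 ⟨?_, wt_le_kFinite n hn, ?_, ?_, ?_, ?_⟩⟩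
  · exact kOrbit_le_of_stable h1 (fun k _ h => rightTrans_mem_leftInvariant k h) hK
  · refine krylov_le_of_stable h3 (fun Ξ h => ?_) hΨ
    rw [lieD_kGen_eq]
    exact Submodule.smul_mem _ _ (lie_mem_zFinite Hel h)
  · exact kOrbit_le_of_stable h4 (fun k _ h => rightTrans_mem_slowlyIncreasing k h) hK
  · exact kOrbit_le_of_stable h5 (fun k _ h => rightTrans_mem_cuspidal k h) hK
  · refine krylov_le_of_stable h6 (fun Ξ h => ?_) hΨ
    rw [lieD_kGen_eq]
    exact Submodule.smul_mem _ _ (lie_Hel_mem_nFinite h)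

theorem lie_eq_of_wt (Z : sl2C) {n : ℤ} {Φ : Smooth} (hΦ : Φ ∈ wt n) :
    ∃ a b c : ℂ, ⁅Z, Φ⁆ = a • Φ + b • ⁅Rel, Φ⁆ + c • ⁅Lel, Φ⁆ := by
  have h := congrArg (fun Z : sl2C => ⁅Z, Φ⁆) (sl2C_eq Z)
  simp only [add_lie, smul_lie, lie_Hel_of_wt hΦ, smul_smul] at h
  exact ⟨_, _, _, h⟩

/-- It suffices to treat a weight vector, on which `Z` acts as a combination of the identity, `R`
and `L`. The growth estimate is available for these two operators on weight vectors. -/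
theorem lie_mem_nFiniteCuspForms {Γ : Subgroup SL(2, ℚ)} (Z : sl2C) {Φ : Smooth}
    (hΦ : Φ ∈ nFiniteCuspForms Γ) : ⁅Z, Φ⁆ ∈ nFiniteCuspForms Γ := by
  refine Submodule.iSup_induction _ (motive := fun Φ => ⁅Z, Φ⁆ ∈ nFiniteCuspForms Γ)
    (mem_iSup_wt_inf_nFiniteCuspForms hΦ) ?_ ?_ ?_
  · rintro n Ψ ⟨hn, hΨ⟩
    obtain ⟨h1, h2, h3, h4, h5, h6⟩ := mem_nFiniteCuspForms.1 hΨ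
    obtain ⟨s1, s2⟩ := lie_mem_slowlyIncreasing_of_wt hn h4 h6
    have hR : ⁅Rel, Ψ⁆ ∈ nFiniteCuspForms Γ := mem_nFiniteCuspForms.2
      ⟨lie_mem_leftInvariant _ h1, wt_le_kFinite _ (lie_Rel_mem_wt hn), lie_mem_zFinite _ h3, s2,
        lie_mem_cuspidal _ h5, h6.imp' (· + 1) fun v hv => pow_Lel_apply_Rel v hn hv⟩
    have hL : ⁅Lel, Ψ⁆ ∈ nFiniteCuspForms Γ := mem_nFiniteCuspForms.2
      ⟨lie_mem_leftInvariant _ h1, wt_le_kFinite _ (lie_Lel_mem_wt hn), lie_mem_zFinite _ h3, s1,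
        lie_mem_cuspidal _ h5, lie_Lel_mem_nFinite h6⟩
    obtain ⟨a, b, c, h⟩ := lie_eq_of_wt Z hn
    rw [h]
    exact add_mem (add_mem (Submodule.smul_mem _ _ hΨ) (Submodule.smul_mem _ _ hR))
      (Submodule.smul_mem _ _ hL)
  · rw [lie_zero]
    exact zero_mem _
  · intro x y hx hy
    rw [lie_add]
    exact add_mem hx hy

/-- `K` acts on each weight component by a scalar, so no separate argument is needed for the
`K`-stability of `𝒵`- and `𝔫`-finiteness. -/
theorem rightTrans_mem_of_weights {W : Submodule ℂ Smooth}
    (hW : ∀ Φ ∈ W, Φ ∈ ⨆ n : ℤ, wt n ⊓ W) (k : SO2) {Φ : Smooth} (hΦ : Φ ∈ W) :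
    rightTrans k Φ ∈ W := by
  refine Submodule.iSup_induction _ (motive := fun Φ => rightTrans k Φ ∈ W) (hW Φ hΦ) ?_ ?_ ?_
  · rintro n Ψ ⟨hn, hΨ⟩
    obtain ⟨θ, rfl⟩ := exists_rot_eq k
    rw [hn θ]
    exact W.smul_mem _ hΨ
  · rw [map_zero]
    exact zero_mem _
  · intro x y hx hy
    rw [map_add]
    exact add_mem hx hy

/-- The `(𝔤, K)`-module of `𝔫`-finite cusp forms. -/
noncomputable def cuspModule (Γ : Subgroup SL(2, ℚ)) : GKSubmodule where
  toSubmodule := nFiniteCuspForms Γ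
  lie_mem := fun h => lie_mem_nFiniteCuspForms _ h
  K_mem := fun k _ h => rightTrans_mem_of_weights
    (fun _ h => mem_iSup_wt_inf_nFiniteCuspForms h) k h

/-- Differentiability of the `K`-action reduces by linearity to weight vectors, where a linear form
gives a multiple of `e^{inθ}`. -/
theorem isGKModule_of_weights (V : GKSubmodule)
    (hV : ∀ Φ ∈ V.toSubmodule, Φ ∈ ⨆ n : ℤ, wt n ⊓ V.toSubmodule)
    (hK : V.toSubmodule ≤ kFinite) : IsGKModule V.rep where
  kFinite v := by
    have : FiniteDimensional ℂ (kOrbit v.1) := hK v.2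
    have h : (Submodule.span ℂ (Set.range fun k : SO2 => V.rep k v)).map
        V.toSubmodule.subtype ≤ kOrbit v.1 := by
      rw [Submodule.map_span_le]
      rintro _ ⟨k, rfl⟩
      exact Submodule.subset_span ⟨k, rfl⟩
    have h2 := Submodule.finiteDimensional_of_le h
    exact Module.Finite.iff_fg.2 (Submodule.fg_of_fg_map_injective _
      V.toSubmodule.injective_subtype (Module.Finite.iff_fg.1 h2))
  compat k Z v := Subtype.ext (rightTrans_lie k Z v.1)
  deriv := by
    rintro ⟨Φ, hΦ⟩ φ
    have hle : (⨆ n : ℤ, wt n ⊓ V.toSubmodule) ≤ V.toSubmodule := iSup_le fun n => inf_le_right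
    refine Submodule.iSup_induction' (fun n : ℤ => wt n ⊓ V.toSubmodule)
      (motive := fun Ψ hΨ => HasDerivAt (fun θ : ℝ => φ (V.rep (rot θ) ⟨Ψ, hle hΨ⟩))
        (φ ⁅Complex.I • Hel, (⟨Ψ, hle hΨ⟩ : V.toLieSubmodule)⁆) 0) ?_ ?_ ?_ (hV Φ hΦ)
    · rintro n Ψ ⟨hn, hΨ⟩
      have h1 : ∀ θ : ℝ, V.rep (rot θ) ⟨Ψ, hΨ⟩ =
          Complex.exp (Complex.I * n * θ) • (⟨Ψ, hΨ⟩ : V.toLieSubmodule) :=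
        fun θ => Subtype.ext (hn θ)
      have h2 : ⁅Complex.I • Hel, (⟨Ψ, hΨ⟩ : V.toLieSubmodule)⁆ =
          (Complex.I * n) • (⟨Ψ, hΨ⟩ : V.toLieSubmodule) := by
        refine Subtype.ext ?_
        change ⁅Complex.I • Hel, Ψ⁆ = (Complex.I * n) • Ψ
        rw [smul_lie, lie_Hel_of_wt hn, smul_smul]
      simp only [h1, map_smul]
      have h3 : HasDerivAt (fun θ : ℝ => Complex.I * n * (θ : ℂ)) (Complex.I * n) 0 := by
        simpa using (Complex.ofRealCLM.hasDerivAt (x := (0 : ℝ))).const_mul (Complex.I * (n : ℂ))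
      rw [h2, map_smul]
      simpa using h3.cexp.smul_const (φ ⟨Ψ, hΨ⟩)
    · have h0 : (⟨0, zero_mem _⟩ : V.toLieSubmodule) = 0 := rfl
      simp only [h0, map_zero, lie_zero]
      exact hasDerivAt_const _ _
    · intro x y hx hy h1 h2
      have h0 : (⟨x + y, add_mem (hle hx) (hle hy)⟩ : V.toLieSubmodule) =
        ⟨x, hle hx⟩ + ⟨y, hle hy⟩ := rfl
      simp only [h0, map_add, lie_add]
      exact h1.add h2

end AutSL2

namespace AutSL2

open Matrix

/-! ### Modules generated by lowest weight vectors -/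

/-- If `m ≠ 0` lies in the kernel of `f`, so does the last non-zero vector `A^j m`; it is killed by
`A`. Thus injectivity need only be tested on the kernel of `A`. -/
theorem injective_of_locally_nilpotent {M N : Type*} [AddCommGroup M] [Module ℂ M]
    [AddCommGroup N] [Module ℂ N] (f : M →ₗ[ℂ] N) (A : Module.End ℂ M) (B : Module.End ℂ N)
    (h : ∀ m, f (A m) = B (f m)) (hA : ∀ m, ∃ k : ℕ, (A ^ k) m = 0)
    (h0 : ∀ m, A m = 0 → f m = 0 → m = 0) : Function.Injective f := by
  have key : ∀ (k : ℕ) (m : M), (A ^ k) m = 0 → f m = 0 → m = 0 := by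
    intro k
    induction k with
    | zero => exact fun m hm _ => hm
    | succ k ih =>
      intro m hm hf
      rw [pow_succ, Module.End.mul_apply] at hm
      exact h0 m (ih _ hm (by rw [h, hf, map_zero])) hf
  refine (injective_iff_map_eq_zero f).2 fun m hm => ?_
  obtain ⟨k, hk⟩ := hA m
  exact key k m hk hm

theorem linearIndependent_sigma {K V ι : Type*} [Ring K] [AddCommGroup V] [Module K V]
    {κ : ι → Type*} [∀ i, Fintype (κ i)] {W : ι → Submodule K V} (hW : iSupIndep W)
    {v : ∀ i, κ i → V} (hv : ∀ i, LinearIndependent K (v i)) (hm : ∀ i j, v i j ∈ W i) :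
    LinearIndependent K fun x : Σ i, κ i => v x.1 x.2 := by
  classical
  refine linearIndependent_iff'.2 fun s g hg i hi => ?_
  -- Extending the coefficients by zero completes the sum to full fibres, so it can be grouped by
  -- `i`.
  let c : (Σ i, κ i) → K := fun x => if x ∈ s then g x else 0
  have hsub : s ⊆ (s.image Sigma.fst).sigma fun i => (Finset.univ : Finset (κ i)) := fun x hx =>
    Finset.mem_sigma.2 ⟨Finset.mem_image_of_mem _ hx, Finset.mem_univ _⟩
  have h1 : ∑ p ∈ s.image Sigma.fst, ∑ j, c ⟨p, j⟩ • v p j = 0 := by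
    rw [← hg, ← Finset.sum_sigma (s.image Sigma.fst) (fun i => (Finset.univ : Finset (κ i)))
      (fun x => c x • v x.1 x.2), ← Finset.sum_subset hsub]
    · exact Finset.sum_congr rfl fun x hx => by simp [c, hx]
    · intro x _ hx
      simp [c, hx]
  have h2 := (iSupIndep_iff_finsetSum_eq_zero_imp_eq_zero W).1 hW _ _
    (fun p _ => Submodule.sum_mem _ fun j _ => Submodule.smul_mem _ (c ⟨p, j⟩) (hm p j)) h1
    i.1 (Finset.mem_image_of_mem _ hi)
  have h3 := linearIndependent_iff'.1 (hv i.1) Finset.univ (fun j => c ⟨i.1, j⟩) h2 i.2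
    (Finset.mem_univ _)
  simpa [c, hi] using h3

theorem linearIndependent_coe_basis {K V κ : Type*} [Ring K] [AddCommGroup V] [Module K V]
    {W : Submodule K V} (b : Module.Basis κ K W) : LinearIndependent K fun j => (b j).1 :=
  b.linearIndependent.map' W.subtype (Submodule.ker_subtype _)

theorem mem_span_coe_basis {K V κ : Type*} [Ring K] [AddCommGroup V] [Module K V]
    {W : Submodule K V} (b : Module.Basis κ K W) {x : V} (hx : x ∈ W) :
    x ∈ Submodule.span K (Set.range fun j => (b j).1) := by
  have h2 := Submodule.mem_map_of_mem (f := W.subtype) (b.mem_span ⟨x, hx⟩)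
  rw [Submodule.map_span, ← Set.range_comp] at h2
  exact h2

/-- Different weight spaces lie in different eigenspaces of `H`. -/
theorem iSupIndep_wt : iSupIndep wt := by
  have h := ((cLieHom Hel).eigenspaces_iSupIndep).comp
    (fun a b hab => Int.cast_injective hab : Function.Injective fun n : ℤ => (n : ℂ))
  exact h.mono fun n Φ hΦ => Module.End.mem_eigenspace_iff.2 (lie_Hel_of_wt hΦ)

/-- The vectors `Rⁿ φ`. -/
noncomputable def raise (φ : Smooth) (n : ℕ) : Smooth := (cLieHom Rel ^ n) φ

theorem raise_zero (φ : Smooth) : raise φ 0 = φ := rfl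

theorem raise_succ (φ : Smooth) (n : ℕ) : raise φ (n + 1) = ⁅Rel, raise φ n⁆ := by
  rw [raise, pow_succ', Module.End.mul_apply]
  rfl

theorem raise_mem_wt {m : ℤ} {φ : Smooth} (h : φ ∈ wt m) (n : ℕ) :
    raise φ n ∈ wt (m + 2 * n) := by
  induction n with
  | zero => simpa [raise_zero] using h
  | succ n ih =>
    rw [raise_succ]
    have h1 := lie_Rel_mem_wt ih
    have e : m + 2 * ((n + 1 : ℕ) : ℤ) = m + 2 * n + 2 := by push_cast; ring
    rwa [e]

theorem raise_mem {W : Submodule ℂ Smooth} (hW : ∀ Ψ ∈ W, ⁅Rel, Ψ⁆ ∈ W) {φ : Smooth} (h : φ ∈ W)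
    (n : ℕ) : raise φ n ∈ W := by
  induction n with
  | zero => exact h
  | succ n ih =>
    rw [raise_succ]
    exact hW _ ih

/-- Induction via `[L, R] = -H` and `n(p+n) + (p+1+2n) = (n+1)(p+n+1)`. For `n = 0` the factor
vanishes, so the truncated index `n - 1` is harmless. -/
theorem lie_Lel_raise {p : ℤ} {φ : Smooth} (h : φ ∈ wt (p + 1)) (hL : ⁅Lel, φ⁆ = 0) (n : ℕ) :
    ⁅Lel, raise φ n⁆ = (-(n * (p + n)) : ℂ) • raise φ (n - 1) := by
  induction n with
  | zero => simp [raise_zero, hL]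
  | succ n ih =>
    rw [raise_succ, lie_Lel_Rel_apply (raise_mem_wt h n), ih]
    rcases n with _ | n
    · simp only [Nat.add_sub_cancel, raise_zero]
      rw [lie_smul (-(((0 : ℕ) : ℂ) * (p + (0 : ℕ))))]
      push_cast
      module
    · simp only [Nat.add_sub_cancel]
      rw [lie_smul (-(((n + 1 : ℕ) : ℂ) * (p + (n + 1 : ℕ)))), ← raise_succ, ← sub_smul]
      congr 1
      push_cast
      ring

/-- The constant is the product of the factors `-j(p+j)` for `1 ≤ j ≤ n`. None is zero because `p ≥
0`; this is where positivity of the weight matters. -/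
theorem exists_pow_Lel_raise {p : ℕ} {φ : Smooth} (h : φ ∈ wt (p + 1)) (hL : ⁅Lel, φ⁆ = 0)
    (n : ℕ) : ∃ c : ℂ, c ≠ 0 ∧ (cLieHom Lel ^ n) (raise φ n) = c • φ := by
  induction n with
  | zero => exact ⟨1, one_ne_zero, by rw [one_smul]; rfl⟩
  | succ n ih =>
    obtain ⟨c, hc, h1⟩ := ih
    have h2 := lie_Lel_raise h hL (n + 1)
    refine ⟨-(((n + 1 : ℕ) : ℂ) * ((p : ℤ) + (n + 1 : ℕ))) * c, mul_ne_zero ?_ hc, ?_⟩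
    · rw [neg_ne_zero]
      refine mul_ne_zero (Nat.cast_ne_zero.2 n.succ_ne_zero) ?_
      have : ((p + (n + 1) : ℕ) : ℂ) ≠ 0 := Nat.cast_ne_zero.2 (by omega)
      push_cast at this ⊢
      exact this
    · rw [pow_succ, Module.End.mul_apply]
      change (cLieHom Lel ^ n) ⁅Lel, raise φ (n + 1)⁆ = _
      rw [h2, map_smul, Nat.add_sub_cancel, h1, smul_smul]

/-- The map `𝒟_{p,+} → C^∞(SL₂(ℝ))` with `vₙ ↦ Rⁿ φ`. -/
noncomputable def seriesMap (p : ℕ) (φ : Smooth) : DiscreteSeries p →ₗ[ℂ] Smooth :=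
  Finsupp.lsum ℂ fun n => LinearMap.toSpanSingleton ℂ Smooth (raise φ n)

theorem seriesMap_vec (p : ℕ) (φ : Smooth) (n : ℕ) (c : ℂ) :
    seriesMap p φ (DiscreteSeries.vec p n c) = c • raise φ n := by
  have : seriesMap p φ (DiscreteSeries.vec p n c) =
    LinearMap.toSpanSingleton ℂ Smooth (raise φ n) c := Finsupp.sum_single_index (by simp)
  rw [this, LinearMap.toSpanSingleton_apply]

theorem discreteSeries_hom_ext {V : Type*} [AddCommGroup V] [Module ℂ V] {p : ℕ}
    {f g : DiscreteSeries p →ₗ[ℂ] V}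
    (h : ∀ n, f (DiscreteSeries.vec p n 1) = g (DiscreteSeries.vec p n 1)) : f = g :=
  Finsupp.lhom_ext' fun n => LinearMap.ext_ring (h n)

theorem seriesMap_op {p : ℕ} {φ : Smooth} {A : Module.End ℂ Smooth} {c : ℕ → ℂ} {s : ℕ → ℕ}
    (h : ∀ n, A (raise φ n) = c n • raise φ (s n)) (v : DiscreteSeries p) :
    seriesMap p φ (DiscreteSeries.op p c s v) = A (seriesMap p φ v) := by
  have : (seriesMap p φ).comp (DiscreteSeries.op p c s) = A.comp (seriesMap p φ) := by
    refine discreteSeries_hom_ext fun n => ?_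
    rw [LinearMap.comp_apply, LinearMap.comp_apply, DiscreteSeries.op_vec, seriesMap_vec,
      seriesMap_vec, one_smul, mul_one, h]
  exact LinearMap.congr_fun this v

/-- The vectors `Rⁿ φ` satisfy the same formulas for `H`, `R`, `L` as the basis vectors `vₙ`. -/
theorem seriesMap_lie {p : ℕ} {φ : Smooth} (h : φ ∈ wt (p + 1)) (hL : ⁅Lel, φ⁆ = 0) (Z : sl2C)
    (v : DiscreteSeries p) : seriesMap p φ ⁅Z, v⁆ = ⁅Z, seriesMap p φ v⁆ := by
  have hH : ∀ v, seriesMap p φ (DiscreteSeries.opH p v) = ⁅Hel, seriesMap p φ v⁆ :=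
    seriesMap_op (A := cLieHom Hel) fun n => by
      refine (lie_Hel_of_wt (raise_mem_wt h n)).trans ?_
      push_cast
      rfl
  have hR : ∀ v, seriesMap p φ (DiscreteSeries.opR p v) = ⁅Rel, seriesMap p φ v⁆ :=
    seriesMap_op (A := cLieHom Rel) fun n => by
      rw [one_smul]
      exact (raise_succ φ n).symm
  have hL : ∀ v, seriesMap p φ (DiscreteSeries.opL p v) = ⁅Lel, seriesMap p φ v⁆ :=
    seriesMap_op (A := cLieHom Lel) fun n => by
      refine (lie_Lel_raise h hL n).trans ?_
      push_cast
      rfl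
  have e := congrArg (fun Z : sl2C => ⁅Z, seriesMap p φ v⁆) (sl2C_eq Z)
  simp only [add_lie, smul_lie] at e
  rw [e, ← hH, ← hR, ← hL, ← map_smul (seriesMap p φ), ← map_smul (seriesMap p φ),
    ← map_smul (seriesMap p φ), ← map_add (seriesMap p φ), ← map_add (seriesMap p φ)]
  rfl

theorem seriesMap_rep {p : ℕ} {φ : Smooth} (h : φ ∈ wt (p + 1)) (k : SO2)
    (v : DiscreteSeries p) :
    seriesMap p φ (DiscreteSeries.rep p k v) = rightTrans k (seriesMap p φ v) := by
  refine seriesMap_op (A := rightTrans k) (fun n => ?_) v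
  obtain ⟨θ, rfl⟩ := exists_rot_eq k
  rw [raise_mem_wt h n θ, chi_rot, ← Complex.exp_nat_mul]
  congr 2
  push_cast
  ring

theorem lie_Lel_discreteSeries (p : ℕ) (v : DiscreteSeries p) :
    ⁅Lel, v⁆ = DiscreteSeries.opL p v :=
  LinearMap.congr_fun (DiscreteSeries.lieHom_Lel p) v

/-- The coefficient of `vₙ` in a vector of `𝒟_{p,+}`. -/
noncomputable def coeff (p n : ℕ) : DiscreteSeries p →ₗ[ℂ] ℂ := Finsupp.lapply n

theorem coeff_vec (p n m : ℕ) (c : ℂ) :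
    coeff p n (DiscreteSeries.vec p m c) = if m = n then c else 0 := by
  change Finsupp.single m c n = _
  rw [Finsupp.single_apply]

theorem discreteSeries_ext {p : ℕ} {v w : DiscreteSeries p} (h : ∀ n, coeff p n v = coeff p n w) :
    v = w :=
  Finsupp.ext h

theorem discreteSeries_mem {p : ℕ} {W : Submodule ℂ (DiscreteSeries p)}
    (h : ∀ n c, DiscreteSeries.vec p n c ∈ W) (v : DiscreteSeries p) : v ∈ W :=
  Finsupp.induction_linear (motive := fun v : ℕ →₀ ℂ => (show DiscreteSeries p from v) ∈ W) v
    (zero_mem W) (fun _ _ hf hg => add_mem hf hg) h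

theorem coeff_opL (p : ℕ) (v : DiscreteSeries p) (n : ℕ) :
    coeff p n (DiscreteSeries.opL p v) = -((n + 1 : ℂ) * (p + n + 1)) * coeff p (n + 1) v := by
  have : (coeff p n).comp (DiscreteSeries.opL p) =
      -((n + 1 : ℂ) * (p + n + 1)) • coeff p (n + 1) := by
    refine discreteSeries_hom_ext fun m => ?_
    rw [LinearMap.comp_apply, LinearMap.smul_apply, DiscreteSeries.opL, DiscreteSeries.op_vec,
      coeff_vec, coeff_vec]
    rcases m with _ | m
    · simp
    · by_cases hmn : m = n
      · subst hmn
        simp [add_assoc]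
      · simp [hmn]
  exact LinearMap.congr_fun this v

/-- `L` sends `v_{n+1}` to a non-zero multiple of `vₙ`, so an element of its kernel has no
coefficients beyond the zeroth. -/
theorem eq_vec_zero_of_opL {p : ℕ} {v : DiscreteSeries p} (h : DiscreteSeries.opL p v = 0) :
    v = DiscreteSeries.vec p 0 (coeff p 0 v) := by
  refine discreteSeries_ext fun n => ?_
  rw [coeff_vec]
  rcases n with _ | n
  · simp
  · rw [if_neg (by omega)]
    have h1 := coeff_opL p v n
    rw [h, map_zero] at h1
    have h2 : -((n + 1 : ℂ) * (p + n + 1)) ≠ 0 := by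
      have : (((n + 1) * (p + n + 1) : ℕ) : ℂ) ≠ 0 := Nat.cast_ne_zero.2 (by positivity)
      push_cast at this
      exact neg_ne_zero.2 this
    exact (mul_eq_zero.1 h1.symm).resolve_left h2

/-- The vectors killed by a power of an operator. -/
def nilSpace {M : Type*} [AddCommGroup M] [Module ℂ M] (A : Module.End ℂ M) : Submodule ℂ M where
  carrier := {m | ∃ k : ℕ, (A ^ k) m = 0}
  add_mem' := by
    rintro a b ⟨k, hk⟩ ⟨l, hl⟩
    refine ⟨k + l, ?_⟩
    rw [map_add, pow_add, Module.End.mul_apply, Module.End.mul_apply, hl, ← Module.End.mul_apply,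
      ← pow_add, add_comm k l, pow_add, Module.End.mul_apply, hk, map_zero, map_zero, add_zero]
  zero_mem' := ⟨0, map_zero _⟩
  smul_mem' := by
    rintro c a ⟨k, hk⟩
    exact ⟨k, by rw [map_smul, hk, smul_zero]⟩

theorem mem_nilSpace_opL (p : ℕ) (v : DiscreteSeries p) : v ∈ nilSpace (DiscreteSeries.opL p) := by
  have h1 : ∀ (n : ℕ) (c : ℂ), DiscreteSeries.vec p n c ∈ nilSpace (DiscreteSeries.opL p) := by
    intro n
    induction n with
    | zero =>
      intro c
      refine ⟨1, ?_⟩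
      rw [pow_one, DiscreteSeries.opL, DiscreteSeries.op_vec]
      simp
    | succ n ih =>
      intro c
      obtain ⟨k, hk⟩ := ih (-(((n + 1 : ℕ) : ℂ) * (p + (n + 1 : ℕ))) * c)
      refine ⟨k + 1, ?_⟩
      rw [pow_succ, Module.End.mul_apply]
      conv_lhs => rw [DiscreteSeries.opL, DiscreteSeries.op_vec, Nat.add_sub_cancel]
      exact hk
  exact discreteSeries_mem h1 v

theorem exists_gkSubmodule {M : Type} [AddCommGroup M] [Module ℂ M] [LieRingModule sl2C M]
    (σ : Representation ℂ SO2 M) (f : M →ₗ[ℂ] Smooth)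
    (hl : ∀ (Z : sl2C) (v : M), f ⁅Z, v⁆ = ⁅Z, f v⁆)
    (hk : ∀ (k : SO2) (v : M), f (σ k v) = rightTrans k (f v)) :
    ∃ V : GKSubmodule, V.toSubmodule = LinearMap.range f :=
  ⟨{ toSubmodule := LinearMap.range f
     lie_mem := by
       rintro Z _ ⟨v, rfl⟩
       exact ⟨⁅Z, v⁆, hl Z v⟩
     K_mem := by
       rintro k _ ⟨v, rfl⟩
       exact ⟨σ k v, hk k v⟩ }, rfl⟩

theorem nonempty_gkEquiv {M : Type} [AddCommGroup M] [Module ℂ M] [LieRingModule sl2C M]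
    (σ : Representation ℂ SO2 M) (f : M →ₗ[ℂ] Smooth)
    (hl : ∀ (Z : sl2C) (v : M), f ⁅Z, v⁆ = ⁅Z, f v⁆)
    (hk : ∀ (k : SO2) (v : M), f (σ k v) = rightTrans k (f v)) (hf : Function.Injective f)
    (V : GKSubmodule) (hV : V.toSubmodule = LinearMap.range f) :
    Nonempty (GKEquiv V.rep σ) := by
  have hm : ∀ v, f v ∈ V.toSubmodule := fun v => hV ▸ LinearMap.mem_range_self f v
  let F : M →ₗ[ℂ] V.toLieSubmodule :=
    { toFun := fun v => ⟨f v, hm v⟩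
      map_add' := fun x y => Subtype.ext (map_add f x y)
      map_smul' := fun c x => Subtype.ext (map_smul f c x) }
  have hF : Function.Bijective F := by
    refine ⟨fun x y hxy => hf (congrArg Subtype.val hxy), ?_⟩
    rintro ⟨w, hw⟩
    have hw' : w ∈ V.toSubmodule := hw
    rw [hV] at hw'
    obtain ⟨v, rfl⟩ := hw'
    exact ⟨v, rfl⟩
  let e : M ≃ₗ[ℂ] V.toLieSubmodule := LinearEquiv.ofBijective F hF
  refine ⟨{ toLinearEquiv := e.symm, map_lie := fun Z w => ?_, map_K := fun k w => ?_ }⟩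
  · rw [LinearEquiv.symm_apply_eq]
    obtain ⟨v, rfl⟩ := e.surjective w
    rw [LinearEquiv.symm_apply_apply]
    exact Subtype.ext (hl Z v).symm
  · rw [LinearEquiv.symm_apply_eq]
    obtain ⟨v, rfl⟩ := e.surjective w
    rw [LinearEquiv.symm_apply_apply]
    exact Subtype.ext (hk k v).symm

theorem mem_lowestWeight {W : Submodule ℂ Smooth} {n : ℤ} {φ : Smooth} :
    φ ∈ lowestWeight W n ↔ φ ∈ W ∧ ⁅Lel, φ⁆ = 0 ∧ φ ∈ wt n := Iff.rfl

/-- `L` is locally nilpotent on `𝒟_{p,+}` with kernel spanned by `v₀`, and `v₀ ↦ φ ≠ 0`. -/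
theorem seriesMap_injective {p : ℕ} {φ : Smooth} (h : φ ∈ wt (p + 1)) (hL : ⁅Lel, φ⁆ = 0)
    (h0 : φ ≠ 0) : Function.Injective (seriesMap p φ) := by
  refine injective_of_locally_nilpotent _ (DiscreteSeries.opL p) (cLieHom Lel) (fun v => ?_)
    (mem_nilSpace_opL p) fun v hv hf => ?_
  · rw [← lie_Lel_discreteSeries]
    exact seriesMap_lie h hL Lel v
  · have h1 := eq_vec_zero_of_opL hv
    rw [h1, seriesMap_vec, raise_zero] at hf
    rw [h1, (smul_eq_zero.1 hf).resolve_right h0, map_zero]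

theorem seriesMap_mem {W : Submodule ℂ Smooth} (hW : ∀ Ψ ∈ W, ⁅Rel, Ψ⁆ ∈ W) {φ : Smooth}
    (h : φ ∈ W) (p : ℕ) (v : DiscreteSeries p) : seriesMap p φ v ∈ W := by
  refine discreteSeries_mem (W := W.comap (seriesMap p φ)) (fun n c => ?_) v
  rw [Submodule.mem_comap, seriesMap_vec]
  exact W.smul_mem c (raise_mem hW h n)

/-- A non-zero lowest weight vector of weight `p + 1` generates a copy of `𝒟_{p,+}` inside `V`,
hence lies in the isotypical component already. -/
theorem lowestWeight_isotypic (V : GKSubmodule) (p : ℕ) :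
    lowestWeight (isotypic V p) (p + 1) = lowestWeight V.toSubmodule (p + 1) := by
  have hle : isotypic V p ≤ V.toSubmodule := sSup_le fun W ⟨_, _, h, _⟩ => h
  refine le_antisymm (fun φ h => ⟨hle h.1, h.2⟩) fun φ h => ⟨?_, h.2⟩
  obtain ⟨h1, h2, h3⟩ := mem_lowestWeight.1 h
  by_cases h0 : φ = 0
  · rw [h0]
    exact zero_mem _
  have hl := seriesMap_lie h3 h2
  have hk := seriesMap_rep h3
  obtain ⟨W, hW⟩ := exists_gkSubmodule _ _ hl hk
  have hm : LinearMap.range (seriesMap p φ) ≤ isotypic V p := by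
    refine le_sSup ⟨W, hW, ?_, nonempty_gkEquiv _ _ hl hk (seriesMap_injective h3 h2 h0) W hW⟩
    rintro _ ⟨v, rfl⟩
    exact seriesMap_mem (fun _ h => V.lie_mem h) h1 p v
  refine hm ⟨DiscreteSeries.vec p 0 1, ?_⟩
  rw [seriesMap_vec, one_smul, raise_zero]

/-! ### Direct sums of lowest weight modules. -/

section Sum

variable {ι : Type} (p : ι → ℕ) (φ : ι → Smooth)

/-- The map `⨁ 𝒟_{p i,+} → C^∞(SL₂(ℝ))` attached to a family of vectors `φ i`. -/
noncomputable def sumMap [DecidableEq ι] : (⨁ i, DiscreteSeries (p i)) →ₗ[ℂ] Smooth :=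
  DirectSum.toModule ℂ ι Smooth fun i => seriesMap (p i) (φ i)

variable {p φ}

theorem sumMap_of [DecidableEq ι] (i : ι) (v : DiscreteSeries (p i)) :
    sumMap p φ (DirectSum.lof ℂ ι (fun i => DiscreteSeries (p i)) i v) =
      seriesMap (p i) (φ i) v :=
  DirectSum.toModule_lof (φ := fun i => seriesMap (p i) (φ i)) ℂ i v

theorem sumMap_lie [DecidableEq ι] (h : ∀ i, φ i ∈ wt (p i + 1)) (hL : ∀ i, ⁅Lel, φ i⁆ = 0)
    (Z : sl2C) (m : ⨁ i, DiscreteSeries (p i)) : sumMap p φ ⁅Z, m⁆ = ⁅Z, sumMap p φ m⁆ := by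
  induction m using DirectSum.induction_on with
  | zero => simp
  | of i v =>
    have e := (DirectSum.lieModuleOf ℂ ι sl2C (fun i => DiscreteSeries (p i)) i).map_lie Z v
    change sumMap p φ ⁅Z, DirectSum.lieModuleOf ℂ ι sl2C (fun i => DiscreteSeries (p i)) i v⁆ =
      ⁅Z, sumMap p φ (DirectSum.lof ℂ ι (fun i => DiscreteSeries (p i)) i v)⁆
    rw [← e, sumMap_of, ← seriesMap_lie (h i) (hL i)]
    exact sumMap_of i _
  | add x y hx hy => rw [lie_add, map_add, map_add, lie_add, hx, hy]

theorem sumMap_rep [DecidableEq ι] (h : ∀ i, φ i ∈ wt (p i + 1)) (k : SO2)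
    (m : ⨁ i, DiscreteSeries (p i)) :
    sumMap p φ (sumRep p k m) = rightTrans k (sumMap p φ m) := by
  induction m using DirectSum.induction_on with
  | zero => simp
  | of i v =>
    have e : sumRep p k (DirectSum.lof ℂ ι (fun i => DiscreteSeries (p i)) i v) =
        DirectSum.lof ℂ ι (fun i => DiscreteSeries (p i)) i (DiscreteSeries.rep (p i) k v) :=
      DirectSum.lmap_lof _ _ _
    change sumMap p φ (sumRep p k (DirectSum.lof ℂ ι (fun i => DiscreteSeries (p i)) i v)) =
      rightTrans k (sumMap p φ (DirectSum.lof ℂ ι (fun i => DiscreteSeries (p i)) i v))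
    rw [e, sumMap_of, sumMap_of, seriesMap_rep (h i)]
  | add x y hx hy => rw [map_add, map_add, map_add, map_add, hx, hy]

/-- The kernel of `L` on the direct sum consists of combinations of the vectors `v₀` of the
summands, and these go to the linearly independent vectors `φ i`. -/
theorem sumMap_injective [DecidableEq ι] (h : ∀ i, φ i ∈ wt (p i + 1))
    (hL : ∀ i, ⁅Lel, φ i⁆ = 0) (hi : LinearIndependent ℂ φ) :
    Function.Injective (sumMap p φ) := by
  classical
  let A := LieModule.toEnd ℂ sl2C (⨁ i, DiscreteSeries (p i)) Lel
  refine injective_of_locally_nilpotent _ A (cLieHom Lel)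
    (fun m => sumMap_lie h hL Lel m) (fun m => ?_) fun m hm hf => ?_
  · suffices m ∈ nilSpace A from this
    induction m using DirectSum.induction_on with
    | zero => exact zero_mem _
    | of i v =>
      obtain ⟨k, hk⟩ := mem_nilSpace_opL (p i) v
      refine ⟨k, ?_⟩
      let g := DirectSum.lieModuleOf ℂ ι sl2C (fun i => DiscreteSeries (p i)) i
      have e : ∀ (k : ℕ) (v : DiscreteSeries (p i)),
          (A ^ k) (g v) = g ((DiscreteSeries.opL (p i) ^ k) v) := by
        intro k
        induction k with
        | zero => exact fun v => rfl
        | succ k ih =>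
          intro v
          have e1 : A (g v) = g (DiscreteSeries.opL (p i) v) := by
            rw [← lie_Lel_discreteSeries]
            exact (g.map_lie Lel v).symm
          rw [pow_succ, Module.End.mul_apply, e1, ih, pow_succ, Module.End.mul_apply]
      exact (e k v).trans (by rw [hk, map_zero])
    | add x y hx hy => exact add_mem hx hy
  · have h1 : ∀ i, m i = DiscreteSeries.vec (p i) 0 (coeff (p i) 0 (m i)) := by
      intro i
      refine eq_vec_zero_of_opL ?_
      rw [← lie_Lel_discreteSeries, ← DirectSum.lie_module_bracket_apply]
      exact congrArg (fun m : ⨁ i, DiscreteSeries (p i) => m i) hm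
    have h2 : ∑ i ∈ m.support, (coeff (p i) 0 (m i)) • φ i = 0 := by
      rw [← hf]
      conv_rhs => rw [← DirectSum.sum_support_of m]
      rw [map_sum]
      refine Finset.sum_congr rfl fun i _ => ?_
      refine Eq.trans ?_ (sumMap_of i (m i)).symm
      conv_rhs => rw [h1 i]
      rw [seriesMap_vec, raise_zero]
    refine DFinsupp.ext fun i => ?_
    by_contra hne
    refine hne ?_
    have h3 := linearIndependent_iff'.1 hi _ _ h2 i (DFinsupp.mem_support_iff.2 hne)
    rw [h1 i, h3, map_zero]
    rfl

theorem sumMap_vec_zero [DecidableEq ι] (i : ι) : sumMap p φ (DirectSum.lof ℂ ι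
    (fun i => DiscreteSeries (p i)) i (DiscreteSeries.vec (p i) 0 1)) = φ i := by
  rw [sumMap_of, seriesMap_vec, one_smul, raise_zero]

theorem range_sumMap_le [DecidableEq ι] {W : Submodule ℂ Smooth} (hW : ∀ Ψ ∈ W, ⁅Rel, Ψ⁆ ∈ W)
    (h : ∀ i, φ i ∈ W) : LinearMap.range (sumMap p φ) ≤ W := by
  rintro _ ⟨m, rfl⟩
  induction m using DirectSum.induction_on with
  | zero => rw [map_zero]; exact zero_mem _
  | of i v =>
    have e := sumMap_of (p := p) (φ := φ) i v
    change sumMap p φ (DirectSum.lof ℂ ι (fun i => DiscreteSeries (p i)) i v) ∈ _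
    rw [e]
    exact seriesMap_mem hW (h i) (p i) v
  | add x y hx hy => rw [map_add]; exact add_mem hx hy

/-- Induction on the power of `L` that kills a weight vector `Φ`. If `L^{v+1} Φ = 0`, then `ψ = L^v
Φ` is a lowest weight vector: it vanishes if its weight is not positive, and otherwise `ψ` and `R^v
ψ` lie in the range. -/
theorem le_range_sumMap [DecidableEq ι] (hw : ∀ i, φ i ∈ wt (p i + 1))
    (hL : ∀ i, ⁅Lel, φ i⁆ = 0) (V : GKSubmodule)
    (hV : ∀ Φ ∈ V.toSubmodule, Φ ∈ ⨆ n : ℤ, wt n ⊓ V.toSubmodule)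
    (hn : V.toSubmodule ≤ nFinite) (hpos : ∀ n ≤ 0, lowestWeight V.toSubmodule n = ⊥)
    (hspan : ∀ q : ℕ, lowestWeight V.toSubmodule (q + 1) ≤ Submodule.span ℂ (Set.range φ)) :
    V.toSubmodule ≤ LinearMap.range (sumMap p φ) := by
  have hRF : ∀ Ψ ∈ LinearMap.range (sumMap p φ), ⁅Rel, Ψ⁆ ∈ LinearMap.range (sumMap p φ) := by
    rintro _ ⟨m, rfl⟩
    exact ⟨⁅Rel, m⁆, sumMap_lie hw hL Rel m⟩
  have hlow : ∀ q : ℕ, lowestWeight V.toSubmodule (q + 1) ≤ LinearMap.range (sumMap p φ) := by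
    refine fun q => (hspan q).trans (Submodule.span_le.2 ?_)
    rintro _ ⟨i, rfl⟩
    exact ⟨_, sumMap_vec_zero i⟩
  have key : ∀ (v : ℕ) (n : ℤ) (Φ : Smooth), Φ ∈ V.toSubmodule → Φ ∈ wt n →
      (cLieHom Lel ^ v) Φ = 0 → Φ ∈ LinearMap.range (sumMap p φ) := by
    intro v
    induction v with
    | zero =>
      intro n Φ _ _ h0
      have h0' : Φ = 0 := h0
      rw [h0']
      exact zero_mem _
    | succ v ih =>
      intro n Φ hΦ hn h0
      have hψ : ∀ v : ℕ, (cLieHom Lel ^ v) Φ ∈ V.toSubmodule ∧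
          (cLieHom Lel ^ v) Φ ∈ wt (n - 2 * v) := by
        intro v
        induction v with
        | zero => simpa using ⟨hΦ, hn⟩
        | succ v ih =>
          rw [pow_succ', Module.End.mul_apply]
          refine ⟨V.lie_mem ih.1, ?_⟩
          have e : n - 2 * ((v + 1 : ℕ) : ℤ) = n - 2 * v - 2 := by push_cast; ring
          rw [e]
          exact lie_Lel_mem_wt ih.2
      obtain ⟨m1, m2⟩ := hψ v
      have m3 : ⁅Lel, (cLieHom Lel ^ v) Φ⁆ = 0 := by
        rw [pow_succ', Module.End.mul_apply] at h0
        exact h0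
      rcases le_or_gt (n - 2 * v) 0 with hneg | hgt
      · refine ih n Φ hΦ hn ?_
        have : (cLieHom Lel ^ v) Φ ∈ lowestWeight V.toSubmodule (n - 2 * v) := ⟨m1, m3, m2⟩
        rw [hpos _ hneg] at this
        exact (Submodule.mem_bot ℂ).1 this
      · obtain ⟨p, hp⟩ : ∃ p : ℕ, n - 2 * v = p + 1 := ⟨(n - 2 * v - 1).toNat, by omega⟩
        rw [hp] at m2
        obtain ⟨c, hc, hcv⟩ := exists_pow_Lel_raise m2 m3 v
        have r1 : raise ((cLieHom Lel ^ v) Φ) v ∈ V.toSubmodule :=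
          raise_mem (fun _ h => V.lie_mem h) m1 v
        have r2 : raise ((cLieHom Lel ^ v) Φ) v ∈ wt n := by
          have := raise_mem_wt m2 v
          rwa [← hp, sub_add_cancel] at this
        have r3 : raise ((cLieHom Lel ^ v) Φ) v ∈ LinearMap.range (sumMap p φ) :=
          raise_mem hRF (hlow p ⟨m1, m3, m2⟩) v
        -- Since `L^v R^v ψ = c ψ` with `c ≠ 0`, the corrected vector is killed by `L^v`.
        have r4 := ih n (Φ - c⁻¹ • raise ((cLieHom Lel ^ v) Φ) v)
          (sub_mem hΦ (Submodule.smul_mem _ _ r1)) (sub_mem hn (Submodule.smul_mem _ _ r2))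
          (by rw [map_sub, map_smul, hcv, smul_smul, inv_mul_cancel₀ hc, one_smul, sub_self])
        have r5 := add_mem r4 (Submodule.smul_mem _ c⁻¹ r3)
        rwa [sub_add_cancel] at r5
  intro Φ hΦ
  refine (iSup_le fun n => ?_ : (⨆ n : ℤ, wt n ⊓ V.toSubmodule) ≤ LinearMap.range (sumMap p φ)) (hV Φ hΦ)
  rintro Ψ ⟨h1, h2⟩
  obtain ⟨v, hv⟩ := hn h2
  exact key v n Ψ h2 h1 hv

end Sum

/-- A module with a weight decomposition that is locally `L`-nilpotent, and all of whose lowest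
weight vectors have positive weight, is a sum of modules `𝒟_{p,+}`. -/
theorem nonempty_gkEquiv_sumRep (V : GKSubmodule)
    (hV : ∀ Φ ∈ V.toSubmodule, Φ ∈ ⨆ n : ℤ, wt n ⊓ V.toSubmodule)
    (hn : V.toSubmodule ≤ nFinite) (hpos : ∀ n ≤ 0, lowestWeight V.toSubmodule n = ⊥)
    (d : ℕ → ℕ) (b : ∀ p : ℕ, Module.Basis (Fin (d p)) ℂ (lowestWeight V.toSubmodule (p + 1))) :
    Nonempty (GKEquiv V.rep (sumRep fun i : (Σ p : ℕ, Fin (d p)) => i.1)) := by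
  let φ : (Σ p : ℕ, Fin (d p)) → Smooth := fun i => (b i.1 i.2).1
  have hmem : ∀ i, φ i ∈ V.toSubmodule := fun i => (b i.1 i.2).2.1
  have hw : ∀ i, φ i ∈ wt (i.1 + 1) := fun i => (b i.1 i.2).2.2.2
  have hL : ∀ i, ⁅Lel, φ i⁆ = 0 := fun i => (b i.1 i.2).2.2.1
  have hi : LinearIndependent ℂ φ := by
    have hinj : Function.Injective fun p : ℕ => (p : ℤ) + 1 := fun a b h => by
      simpa using h
    exact linearIndependent_sigma (W := fun p : ℕ => wt (p + 1)) (iSupIndep_wt.comp hinj)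
      (v := fun p j => (b p j).1) (fun p => linearIndependent_coe_basis (b p)) fun p j => hw ⟨p, j⟩
  have hspan : ∀ q : ℕ, lowestWeight V.toSubmodule (q + 1) ≤
      Submodule.span ℂ (Set.range φ) := by
    intro q ψ hψ
    refine Submodule.span_mono ?_ (mem_span_coe_basis (b q) hψ)
    rintro _ ⟨j, rfl⟩
    exact ⟨⟨q, j⟩, rfl⟩
  exact nonempty_gkEquiv _ _ (sumMap_lie hw hL) (sumMap_rep hw) (sumMap_injective hw hL hi) V
    (le_antisymm (le_range_sumMap hw hL V hV hn hpos hspan)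
      (range_sumMap_le (fun _ h => V.lie_mem h) hmem))

end AutSL2

namespace AutSL2

open Matrix UpperHalfPlane

/-! ### The function on the group attached to a function on the upper half plane -/

/-- The function `g ↦ (f|ₖ g)(i)` on `SL₂(ℝ)`. -/
noncomputable def lift (k : ℤ) (f : ℍ → ℂ) (g : SL(2, ℝ)) : ℂ :=
  (f ∣[k] (g : GL (Fin 2) ℝ)) UpperHalfPlane.I

theorem slash_SL_apply (k : ℤ) (f : ℍ → ℂ) (g : SL(2, ℝ)) (τ : ℍ) :
    (f ∣[k] (g : GL (Fin 2) ℝ)) τ =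
      f ((g : GL (Fin 2) ℝ) • τ) * ((g.1 1 0 : ℂ) * τ + g.1 1 1) ^ (-k) := by
  have h1 : ((g : GL (Fin 2) ℝ).det : ℝˣ).val = 1 := by simp
  have h2 : ∀ z, σ (g : GL (Fin 2) ℝ) z = z := by
    intro z
    rw [σ, if_pos (by simp)]
    rfl
  rw [ModularForm.slash_def, h1]
  simp only [h2]
  simp [denom]

theorem coe_SL_smul (g : SL(2, ℝ)) (τ : ℍ) : (((g : GL (Fin 2) ℝ) • τ : ℍ) : ℂ) =
    (g.1 0 0 * τ + g.1 0 1) / (g.1 1 0 * τ + g.1 1 1) := by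
  rw [UpperHalfPlane.coe_smul_of_det_pos (by simp)]
  simp [num, denom]

theorem lift_mul (k : ℤ) (f : ℍ → ℂ) (a b : SL(2, ℝ)) :
    lift k f (a * b) = lift k (f ∣[k] (a : GL (Fin 2) ℝ)) b := by
  rw [lift, lift, ← SlashAction.slash_mul, map_mul]

theorem lift_naMat (k : ℤ) (f : ℍ → ℂ) (τ : ℍ) :
    lift k f (naMat τ) = ((τ.im ^ ((k : ℝ) / 2) : ℝ) : ℂ) * f τ := by
  have hy : 0 < Real.sqrt τ.im := Real.sqrt_pos.2 τ.im_pos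
  have hv := naMat_val τ.im_pos
  have e00 : (naMat τ).1 0 0 = Real.sqrt τ.im := by rw [hv]; simp
  have e01 : (naMat τ).1 0 1 = τ.re * (Real.sqrt τ.im)⁻¹ := by rw [hv]; simp [div_eq_mul_inv]
  have e10 : (naMat τ).1 1 0 = 0 := by rw [hv]; simp
  have e11 : (naMat τ).1 1 1 = (Real.sqrt τ.im)⁻¹ := by rw [hv]; simp
  have hy' : ((Real.sqrt τ.im : ℝ) : ℂ) ≠ 0 := Complex.ofReal_ne_zero.2 hy.ne'
  have h1 : ((naMat τ : GL (Fin 2) ℝ) • UpperHalfPlane.I : ℍ) = τ := by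
    apply UpperHalfPlane.ext
    rw [coe_SL_smul, e00, e01, e10, e11]
    have hs : ((Real.sqrt τ.im : ℝ) : ℂ) * (Real.sqrt τ.im : ℝ) = (τ.im : ℝ) := by
      rw [← Complex.ofReal_mul, Real.mul_self_sqrt τ.im_pos.le]
    have ht : (τ : ℂ) = (τ.re : ℝ) + (τ.im : ℝ) * Complex.I := (Complex.re_add_im _).symm
    rw [ht, ← hs]
    push_cast
    field_simp
    simp
    ring
  rw [lift, slash_SL_apply, h1, e10, e11, mul_comm]
  congr 1
  rw [Complex.ofReal_zero, zero_mul, zero_add, _root_.zpow_neg, ← _root_.inv_zpow, ← Complex.ofReal_inv, inv_inv,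
    ← Complex.ofReal_zpow]
  congr 1
  rw [Real.sqrt_eq_rpow, ← Real.rpow_intCast, ← Real.rpow_mul τ.im_pos.le]
  congr 1
  ring

/-- The rotation fixes `i`, and its automorphy factor there is `cos θ - i sin θ = e^{-iθ}`. -/
theorem lift_rot (k : ℤ) (f : ℍ → ℂ) (θ : ℝ) :
    lift k f (rot θ) = Complex.exp (Complex.I * k * θ) * f UpperHalfPlane.I := by
  have e00 : (rot θ).1.1 0 0 = Real.cos θ := by simp [rot]
  have e01 : (rot θ).1.1 0 1 = Real.sin θ := by simp [rot]
  have e10 : (rot θ).1.1 1 0 = -Real.sin θ := by simp [rot]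
  have e11 : (rot θ).1.1 1 1 = Real.cos θ := by simp [rot]
  have hd : ((-Real.sin θ : ℝ) : ℂ) * Complex.I + (Real.cos θ : ℝ) =
      Complex.exp (-(Complex.I * θ)) := by
    rw [mul_comm Complex.I, ← neg_mul, Complex.exp_mul_I, Complex.cos_neg, Complex.sin_neg]
    push_cast
    ring
  have h1 : ((((rot θ : SO2) : SL(2, ℝ)) : GL (Fin 2) ℝ) • UpperHalfPlane.I : ℍ) =
      UpperHalfPlane.I := by
    apply UpperHalfPlane.ext
    rw [coe_SL_smul, e00, e01, e10, e11, UpperHalfPlane.coe_I, hd,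
      div_eq_iff (Complex.exp_ne_zero _), ← hd]
    push_cast
    linear_combination (Complex.sin θ) * Complex.I_mul_I
  rw [lift, slash_SL_apply, h1, e10, e11, UpperHalfPlane.coe_I, hd, mul_comm, ← Complex.exp_int_mul]
  congr 2
  push_cast
  ring

theorem lift_mul_rot (k : ℤ) (f : ℍ → ℂ) (g : SL(2, ℝ)) (θ : ℝ) :
    lift k f (g * rot θ) = Complex.exp (Complex.I * k * θ) * lift k f g := by
  rw [lift_mul, lift_rot]
  rfl

theorem pull_lift (k : ℤ) (f : ℍ → ℂ) (τ : ℍ) : pull k (lift k f) τ = f τ := by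
  rw [pull_eq, lift_naMat, ← mul_assoc, ← Complex.ofReal_mul]
  have h : (τ : ℂ).im ^ (-(k : ℝ) / 2) * τ.im ^ ((k : ℝ) / 2) = 1 := by
    change τ.im ^ (-(k : ℝ) / 2) * τ.im ^ ((k : ℝ) / 2) = 1
    rw [← Real.rpow_add τ.im_pos, neg_div, neg_add_cancel, Real.rpow_zero]
  rw [h, Complex.ofReal_one, one_mul]

theorem tilde_lift (k : ℤ) (f : ℍ → ℂ) : tilde k (lift k f) = f :=
  funext fun τ => (tilde_eq_pull k _ τ).trans (pull_lift k f τ)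

/-- A function of weight `k` is determined by its restriction to the upper triangular matrices. -/
theorem eq_of_pull_eq {k : ℤ} {F G : SL(2, ℝ) → ℂ}
    (hF : ∀ g (θ : ℝ), F (g * rot θ) = Complex.exp (Complex.I * k * θ) * F g)
    (hG : ∀ g (θ : ℝ), G (g * rot θ) = Complex.exp (Complex.I * k * θ) * G g)
    (h : ∀ τ : ℍ, pull k F τ = pull k G τ) : F = G := by
  funext g
  obtain ⟨z, hz, θ, rfl⟩ := exists_eq_naMat_mul_rot g
  rw [hF, hG, apply_naMat_eq k F hz, apply_naMat_eq k G hz]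
  have := h ⟨z, hz⟩
  rw [show ((⟨z, hz⟩ : ℍ) : ℂ) = z from rfl] at this
  rw [this]

/-- Both functions have weight `k` and agree on the upper triangular representatives, so they agree
by the Iwasawa decomposition. -/
theorem lift_tilde {k : ℤ} {Φ : Smooth} (hΦ : Φ ∈ wt k) : lift k (tilde k Φ.1) = Φ.1 :=
  eq_of_pull_eq (lift_mul_rot k _) (wt_apply hΦ) fun τ =>
    (pull_lift k _ τ).trans (tilde_eq_pull k _ τ)

/-- Translating the function by `a` on the left is slashing by `a` on the half plane; this
transports behaviour at any cusp to behaviour at `∞`. -/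
theorem slash_tilde_apply {k : ℤ} {Φ : Smooth} (hΦ : Φ ∈ wt k) (a : SL(2, ℝ)) (τ : ℍ) :
    (tilde k Φ.1 ∣[k] (a : GL (Fin 2) ℝ)) τ =
      ((τ.im ^ (-(k : ℝ) / 2) : ℝ) : ℂ) * Φ.1 (a * naMat τ) := by
  have h : lift k (tilde k Φ.1 ∣[k] (a : GL (Fin 2) ℝ)) (naMat τ) = Φ.1 (a * naMat τ) := by
    rw [← lift_mul, lift_tilde hΦ]
  rw [← pull_lift k (tilde k Φ.1 ∣[k] (a : GL (Fin 2) ℝ)) τ, pull_eq, h]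
  rfl

end AutSL2

namespace AutSL2

open Matrix UpperHalfPlane Filter Topology Asymptotics
open scoped Manifold

/-! ### Behaviour at the cusps -/

/-- The Frobenius norm is submultiplicative, by Cauchy–Schwarz on each entry. -/
theorem slNorm_mul_le (a b : SL(2, ℝ)) : slNorm (a * b) ≤ slNorm a * slNorm b := by
  have ha : 0 ≤ slNorm a := Real.sqrt_nonneg _
  have hb : 0 ≤ slNorm b := Real.sqrt_nonneg _
  refine abs_le_of_sq_le_sq' ?_ (by positivity) |>.2
  have e : ∀ i j, (a * b).1 i j = a.1 i 0 * b.1 0 j + a.1 i 1 * b.1 1 j := pt_mul_apply a b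
  have key : ∀ x y z w : ℝ, (x * z + y * w) ^ 2 ≤ (x ^ 2 + y ^ 2) * (z ^ 2 + w ^ 2) :=
    fun x y z w => by nlinarith [sq_nonneg (x * w - y * z)]
  rw [mul_pow, slNorm_sq, slNorm_sq, slNorm_sq, e, e, e, e]
  nlinarith [key (a.1 0 0) (a.1 0 1) (b.1 0 0) (b.1 1 0), key (a.1 0 0) (a.1 0 1) (b.1 0 1) (b.1 1 1),
    key (a.1 1 0) (a.1 1 1) (b.1 0 0) (b.1 1 0), key (a.1 1 0) (a.1 1 1) (b.1 0 1) (b.1 1 1)]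

theorem naMat_add {z : ℂ} (hz : 0 < z.im) (x : ℝ) : naMat (x + z) = nMat x * naMat z := by
  have hz' : 0 < ((x : ℂ) + z).im := by simpa using hz
  rw [naMat_eq hz, naMat_eq hz', ← mul_assoc]
  have h1 : (nMat x * nMat z.re : SL(2, ℝ)) = nMat ((x : ℂ) + z).re := by
    apply Subtype.ext
    change (nMat x).1 * (nMat z.re).1 = _
    ext i j
    fin_cases i <;> fin_cases j <;> simp [nMat, Matrix.mul_apply, add_comm]
  have h2 : aMat z.im hz = aMat ((x : ℂ) + z).im hz' := by
    apply Subtype.ext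
    simp [aMat]
  rw [h1, h2]

/-- In the coordinate `q` one has `y = -(h/2π) log|q|`. Polynomial growth in `y` becomes a power of
`log|q|`, which is `o(1/q)`: the hypothesis of the removable singularity theorem. -/
theorem isLittleO_cuspFunction {h : ℝ} (hh : 0 < h) {F : ℂ → ℂ} (hper : Function.Periodic F h)
    {C : ℝ} {M : ℕ} (hF : ∀ z : ℂ, 1 ≤ z.im → 0 ≤ z.re → z.re ≤ h → ‖F z‖ ≤ C * z.im ^ M) :
    (fun q => Function.Periodic.cuspFunction h F q - Function.Periodic.cuspFunction h F 0)
      =o[𝓝[≠] 0] fun q => (q - 0)⁻¹ := by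
  have hlog : ∀ n : ℕ, (fun q : ℂ => Real.log ‖q‖⁻¹ ^ n) =o[𝓝[≠] 0] fun q => (q - 0)⁻¹ := by
    intro n
    have h1 : Tendsto (fun q : ℂ => ‖q‖⁻¹) (𝓝[≠] 0) atTop :=
      tendsto_inv_nhdsGT_zero.comp tendsto_norm_nhdsNE_zero
    refine ((Real.isLittleO_pow_log_id_atTop (n := n)).comp_tendsto h1).trans_isBigO ?_
    refine IsBigO.of_bound 1 (Eventually.of_forall fun q => ?_)
    simp
  refine IsLittleO.sub ?_ ?_
  · refine IsBigO.trans_isLittleO ?_ (hlog M)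
    refine IsBigO.of_bound (|C| * (h / (2 * Real.pi)) ^ M) ?_
    have hev := (tendsto_comap_iff.1 (Function.Periodic.invQParam_tendsto hh)).eventually_ge_atTop 1
    filter_upwards [hev, self_mem_nhdsWithin] with q hq hq0
    rw [Function.Periodic.cuspFunction_eq_of_nonzero h F hq0]
    set z := Function.Periodic.invQParam h q with hz
    -- The growth bound is only given on a strip of width `h`; periodicity moves `z` into it without
    -- changing its imaginary part.
    let m := toIcoDiv hh 0 z.re
    have hm : F (z - m * h) = F z := hper.sub_int_mul_eq m
    have hre : (z - m * h).re = toIcoMod hh 0 z.re := by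
      rw [toIcoMod]
      simp [m]
    have him : (z - m * h).im = z.im := by simp
    have hmem := toIcoMod_mem_Ico hh 0 z.re
    have hb := hF (z - m * h) (by rw [him]; exact hq) (by rw [hre]; exact hmem.1)
      (by rw [hre]; simpa using hmem.2.le)
    rw [hm, him] at hb
    have hzim : z.im = h / (2 * Real.pi) * Real.log ‖q‖⁻¹ := by
      rw [hz, Function.Periodic.im_invQParam, Real.log_inv]
      ring
    have hz1 : 0 ≤ z.im := zero_le_one.trans hq
    refine hb.trans ?_
    rw [norm_pow, Real.norm_eq_abs, mul_assoc, ← mul_pow]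
    have h3 : h / (2 * Real.pi) * |Real.log ‖q‖⁻¹| = z.im := by
      rw [← abs_of_nonneg hz1, hzim, abs_mul, abs_of_pos (by positivity : 0 < h / (2 * Real.pi))]
    rw [h3]
    exact mul_le_mul_of_nonneg_right (le_abs_self C) (by positivity)
  · have h0 := hlog 0
    simp only [pow_zero] at h0
    refine (IsBigO.of_bound ‖Function.Periodic.cuspFunction h F 0‖
      (Eventually.of_forall fun q => ?_)).trans_isLittleO h0
    simp

/-- A periodic holomorphic function of moderate growth with vanishing constant term vanishes at
infinity. -/
theorem isZeroAtImInfty_of_growth {h : ℝ} (hh : 0 < h) {G : ℍ → ℂ}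
    (hper : Function.Periodic (G ∘ ofComplex) h) (hol : MDiff G) {C : ℝ} {M : ℕ}
    (hG : ∀ τ : ℍ, 1 ≤ τ.im → 0 ≤ τ.re → τ.re ≤ h → ‖G τ‖ ≤ C * τ.im ^ M)
    (hint : ∫ u in (0 : ℝ)..h, (G ∘ ofComplex) (u + Complex.I) = 0) : IsZeroAtImInfty G := by
  have hd : ∀ᶠ z in comap Complex.im atTop, DifferentiableAt ℂ (G ∘ ofComplex) z :=
    eventually_of_mem (preimage_mem_comap (Ioi_mem_atTop 0)) fun z hz =>
      mdifferentiableAt_iff_differentiableAt.mp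
        ((hol (ofComplex z)).comp z (mdifferentiableAt_ofComplex hz))
  have ho := isLittleO_cuspFunction hh hper (C := C) (M := M) fun z hz h0 h1 => by
    have hz' : 0 < z.im := zero_lt_one.trans_le hz
    rw [Function.comp_apply, ofComplex_apply_of_im_pos hz']
    exact hG ⟨z, hz'⟩ hz h0 h1
  have hlim := Complex.tendsto_limUnder_of_differentiable_on_punctured_nhds_of_isLittleO
    (Function.Periodic.eventually_differentiableAt_cuspFunction_nhds_ne_zero hh hper hd) ho
  have hG0 : Tendsto G atImInfty (𝓝 (limUnder (𝓝[≠] 0)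
      (Function.Periodic.cuspFunction h (G ∘ ofComplex)))) := by
    refine (hlim.comp ((Function.Periodic.qParam_tendsto hh).comp tendsto_coe_atImInfty)).congr ?_
    intro τ
    exact eq_cuspFunction τ hh.ne' hper
  have hbdd : IsBoundedAtImInfty G := hG0.isBigO_one ℝ
  have han := analyticAt_cuspFunction_zero hh hper hol hbdd
  -- The limit at infinity is the zeroth Fourier coefficient, and at height `1` this is the given
  -- integral up to a factor.
  have h0 := qExpansion_coeff_eq_intervalIntegral hh hper hol hbdd 0 (t := 1) one_pos
  rw [qExpansion_coeff_zero hh han hper, valueAtInfty, hG0.limUnder_eq] at h0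
  have h1 : ∫ u in (0 : ℝ)..h, 1 / Function.Periodic.qParam h (u + (1 : ℝ) * UpperHalfPlane.I) ^ 0 *
      G ⟨u + (1 : ℝ) * UpperHalfPlane.I, by simp⟩ = 0 := by
    rw [← hint]
    refine intervalIntegral.integral_congr fun u _ => ?_
    have hp : 0 < ((u : ℂ) + Complex.I).im := by simp
    simp only [pow_zero, div_one, one_mul, Function.comp_apply, ofComplex_apply_of_im_pos hp,
      Complex.ofReal_one, UpperHalfPlane.coe_I]
  rw [h1, mul_zero] at h0
  rw [h0] at hG0
  exact hG0

/-- `Γ` is commensurable with `Γ(N)`, and `Γ(N)` with `SL₂(ℤ)`. -/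
theorem isArithmetic_of_isCongruence {Γ : Subgroup SL(2, ℚ)} (hΓ : IsCongruence Γ) :
    (Γ.map (SpecialLinearGroup.mapGL ℝ)).IsArithmetic := by
  obtain ⟨N, hN, hle, hidx⟩ := hΓ
  have : NeZero N := ⟨hN.ne'⟩
  have hA : ((CongruenceSubgroup.Gamma N).map (SpecialLinearGroup.map (Int.castRingHom ℚ))).map
      (SpecialLinearGroup.mapGL ℝ) = (CongruenceSubgroup.Gamma N).map
        (SpecialLinearGroup.mapGL ℝ) := by
    rw [Subgroup.map_map]
    congr 1
  have hinj : Function.Injective (SpecialLinearGroup.mapGL ℝ : SL(2, ℚ) →* GL (Fin 2) ℝ) :=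
    SpecialLinearGroup.mapGL_injective
  refine ⟨Subgroup.Commensurable.trans (H := Γ.map (SpecialLinearGroup.mapGL ℝ))
    (K := (CongruenceSubgroup.Gamma N).map (SpecialLinearGroup.mapGL ℝ)) ⟨?_, ?_⟩
    Subgroup.IsArithmetic.is_commensurable⟩
  · rw [← hA, Subgroup.relIndex_map_map_of_injective _ _ hinj, Subgroup.relIndex_eq_one.2 hle]
    exact one_ne_zero
  · rw [← hA, Subgroup.relIndex_map_map_of_injective _ _ hinj]
    exact hidx

/-- The inclusion `SL₂(ℤ) → SL₂(ℚ)`. -/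
def toRat : SL(2, ℤ) →* SL(2, ℚ) := SpecialLinearGroup.map (Int.castRingHom ℚ)

/-- `Γ(N)` is normal in `SL₂(ℤ)`, so the same width `N` serves every cusp. -/
theorem exists_conj_nMat_mem {Γ : Subgroup SL(2, ℚ)} (hΓ : IsCongruence Γ) :
    ∃ N : ℕ, 0 < N ∧ ∀ γ : SL(2, ℤ), toRat γ * nMat (N : ℚ) * (toRat γ)⁻¹ ∈ Γ := by
  obtain ⟨N, hN, hle, -⟩ := hΓ
  refine ⟨N, hN, fun γ => hle ?_⟩
  let n : SL(2, ℤ) := ⟨!![1, N; 0, 1], by simp⟩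
  have hn : n ∈ CongruenceSubgroup.Gamma N := by
    rw [CongruenceSubgroup.Gamma_mem]
    simp [n]
  refine ⟨γ * n * γ⁻¹, (CongruenceSubgroup.Gamma_normal N).conj_mem n hn γ, ?_⟩
  rw [map_mul, map_mul, map_inv]
  congr 2
  apply Subtype.ext
  ext i j
  change ((n.1 i j : ℤ) : ℚ) = (nMat (N : ℚ)).1 i j
  fin_cases i <;> fin_cases j <;> simp [n, nMat]

theorem mapGL_eq (γ : SL(2, ℚ)) :
    (SpecialLinearGroup.mapGL ℝ γ : GL (Fin 2) ℝ) = (toReal γ : GL (Fin 2) ℝ) := rfl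

theorem mapGL_int_eq (γ : SL(2, ℤ)) :
    (SpecialLinearGroup.mapGL ℝ γ : GL (Fin 2) ℝ) = (toReal (toRat γ) : GL (Fin 2) ℝ) := by
  ext i j
  simp [toReal, toRat]

theorem toReal_nMat (h : ℚ) : toReal (nMat h) = nMat (h : ℝ) := by
  apply Subtype.ext
  ext i j
  change (((nMat h).1 i j : ℚ) : ℝ) = (nMat (h : ℝ)).1 i j
  fin_cases i <;> fin_cases j <;> simp [nMat]

/-! ### From lowest weight vectors to holomorphic cusp forms. -/

section Forward

variable {Γ : Subgroup SL(2, ℚ)} {k : ℤ} {Φ : Smooth}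

theorem mdifferentiable_tilde (hw : Φ ∈ wt k) (hL : ⁅Lel, Φ⁆ = 0) : MDiff (tilde k Φ.1) := by
  rw [UpperHalfPlane.mdifferentiable_iff]
  intro z hz
  have hz' : 0 < z.im := hz
  obtain ⟨a, b, hab, h1, -⟩ := exists_hasPartials_pull hw hz'
  have h2 : b = Complex.I * a := by
    rw [hL] at h1
    have h3 : pull (k - 2) (0 : Smooth).1 z = 0 := mul_zero _
    rw [h3] at h1
    have h4 : (z.im : ℂ) ^ 2 ≠ 0 := pow_ne_zero _ (Complex.ofReal_ne_zero.2 hz'.ne')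
    exact sub_eq_zero.1 ((mul_eq_zero.1 h1.symm).resolve_left h4)
  refine ((hab.differentiableAt h2).congr_of_eventuallyEq ?_).differentiableWithinAt
  filter_upwards [isOpen_upper.mem_nhds hz] with w hw
  rw [Function.comp_apply, ofComplex_apply_of_im_pos hw]
  exact tilde_eq_pull k Φ.1 ⟨w, hw⟩

theorem tilde_slash_eq (hw : Φ ∈ wt k) (hΓ : Φ ∈ leftInvariant Γ) {γ : SL(2, ℚ)} (hγ : γ ∈ Γ) :
    tilde k Φ.1 ∣[k] (toReal γ : GL (Fin 2) ℝ) = tilde k Φ.1 := by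
  funext τ
  rw [slash_tilde_apply hw, hΓ γ hγ, tilde_eq_pull]
  rfl

/-- The element `σ n(h) σ⁻¹` of `Γ` makes the slashed function `h`-periodic. Slow increase bounds it
by a power of `y` on a strip, and cuspidality kills its constant term. -/
theorem isZeroAtImInfty_tilde_slash (hw : Φ ∈ wt k) (hL : ⁅Lel, Φ⁆ = 0)
    (hΓ : Φ ∈ leftInvariant Γ) (hc : Φ ∈ cuspidal Γ) (hs : Φ ∈ slowlyIncreasing) {σ : SL(2, ℚ)}
    {h : ℚ} (hh : 0 < h) (hσ : σ * nMat h * σ⁻¹ ∈ Γ) :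
    IsZeroAtImInfty (tilde k Φ.1 ∣[k] (toReal σ : GL (Fin 2) ℝ)) := by
  have hhR : (0 : ℝ) < h := by exact_mod_cast hh
  obtain ⟨C, N, hCN⟩ := hs
  refine isZeroAtImInfty_of_growth (h := (h : ℝ)) hhR ?_
    ((mdifferentiable_tilde hw hL).slash k _)
    (C := |C| * (slNorm (toReal σ) * (2 + (h : ℝ) ^ 2)) ^ N) (M := k.natAbs + N) ?_ ?_
  · intro z
    rcases lt_or_ge 0 z.im with hz | hz
    · have hz' : 0 < (z + ((h : ℝ) : ℂ)).im := by simpa using hz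
      rw [Function.comp_apply, Function.comp_apply, ofComplex_apply_of_im_pos hz,
        ofComplex_apply_of_im_pos hz', slash_tilde_apply hw, slash_tilde_apply hw]
      have e1 : naMat (z + ((h : ℝ) : ℂ)) = nMat (h : ℝ) * naMat z := by
        rw [add_comm]
        exact naMat_add hz h
      have e2 : Φ.1 (toReal σ * naMat (z + ((h : ℝ) : ℂ))) = Φ.1 (toReal σ * naMat z) := by
        rw [← hΓ _ hσ (toReal σ * naMat z), e1, map_mul, map_mul, map_inv, toReal_nMat]
        group
      have e3 : (z + ((h : ℝ) : ℂ)).im = z.im := by simp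
      change (((z + ((h : ℝ) : ℂ)).im ^ (-(k : ℝ) / 2) : ℝ) : ℂ) *
        Φ.1 (toReal σ * naMat (z + ((h : ℝ) : ℂ))) =
        ((z.im ^ (-(k : ℝ) / 2) : ℝ) : ℂ) * Φ.1 (toReal σ * naMat z)
      rw [e2, e3]
    · have hz' : (z + ((h : ℝ) : ℂ)).im ≤ 0 := by simpa using hz
      rw [Function.comp_apply, Function.comp_apply, ofComplex_apply_of_im_nonpos hz,
        ofComplex_apply_of_im_nonpos hz']
  · intro τ hτ h0 h1
    rw [slash_tilde_apply hw, norm_mul, Complex.norm_real, Real.norm_of_nonneg (by positivity),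
      pow_add]
    have hpos : 0 ≤ slNorm (toReal σ) := Real.sqrt_nonneg _
    -- As the norm is at least `1`, it is bounded by its square, the height, and `1 + x² + y² ≤ (2 +
    -- h²) y²` on the part `y ≥ 1` of the strip.
    have hn1 : slNorm (naMat τ) ≤ (2 + (h : ℝ) ^ 2) * τ.im := by
      have h2 := one_le_slNorm (naMat τ)
      have h3 : slNorm (naMat τ) ^ 2 = height τ := slNorm_naMat τ.im_pos
      have h4 : height τ ≤ (2 + (h : ℝ) ^ 2) * τ.im := by
        refine (div_le_iff₀ τ.im_pos).2 ?_
        rw [Complex.sq_norm, Complex.normSq_apply]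
        change 1 + (τ.re * τ.re + τ.im * τ.im) ≤ (2 + (h : ℝ) ^ 2) * τ.im * τ.im
        have h5 : τ.re * τ.re ≤ (h : ℝ) ^ 2 := by nlinarith
        have h6 : 1 ≤ τ.im * τ.im := by nlinarith
        nlinarith [sq_nonneg (h : ℝ)]
      nlinarith
    have hA : τ.im ^ (-(k : ℝ) / 2) ≤ τ.im ^ k.natAbs := by
      rw [← Real.rpow_natCast]
      refine Real.rpow_le_rpow_of_exponent_le hτ ?_
      rw [Nat.cast_natAbs, Int.cast_abs]
      have := neg_abs_le (k : ℝ)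
      have := abs_nonneg (k : ℝ)
      linarith
    have hB : ‖Φ.1 (toReal σ * naMat τ)‖ ≤
        |C| * (slNorm (toReal σ) * ((2 + (h : ℝ) ^ 2) * τ.im)) ^ N := by
      refine (hCN _).trans (mul_le_mul (le_abs_self C) ?_ (by
        have := one_le_slNorm (toReal σ * naMat τ); positivity) (abs_nonneg C))
      have := one_le_slNorm (toReal σ * naMat τ)
      gcongr
      exact (slNorm_mul_le _ _).trans (mul_le_mul_of_nonneg_left hn1 hpos)
    refine (mul_le_mul hA hB (norm_nonneg _) (by have := τ.im_pos; positivity)).trans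
      (le_of_eq ?_)
    rw [← mul_assoc (slNorm (toReal σ)), mul_pow _ τ.im]
    ring
  -- Evaluating the constant term at `σ · naMat i` cancels `σ⁻¹` and leaves the integral at height
  -- `1`, where the factor `y^{-k/2}` is `1`.
  · have h0 := hc σ h hh hσ (toReal σ * naMat Complex.I)
    rw [← h0]
    refine intervalIntegral.integral_congr fun u _ => ?_
    have hp : 0 < ((u : ℂ) + Complex.I).im := by simp
    have him : ((u : ℂ) + Complex.I).im = 1 := by simp
    simp only [Function.comp_apply]
    rw [ofComplex_apply_of_im_pos hp, slash_tilde_apply hw]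
    change ((((u : ℂ) + Complex.I).im ^ (-(k : ℝ) / 2) : ℝ) : ℂ) *
      Φ.1 (toReal σ * naMat ((u : ℂ) + Complex.I)) = _
    rw [him, Real.one_rpow, Complex.ofReal_one, one_mul, naMat_add (by simp)]
    group

end Forward

/-- The cusp form attached to a lowest weight vector. -/
noncomputable def toCuspForm {Γ : Subgroup SL(2, ℚ)} (hΓ : IsCongruence Γ) {k : ℤ}
    {Φ : Smooth} (hΦ : Φ ∈ lowestWeight (nFiniteCuspForms Γ) k) : S Γ k where
  toFun := tilde k Φ.1
  slash_action_eq' := by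
    rintro _ ⟨γ, hγ, rfl⟩
    exact tilde_slash_eq hΦ.2.2 (mem_nFiniteCuspForms.1 hΦ.1).1 hγ
  holo' := mdifferentiable_tilde hΦ.2.2 hΦ.2.1
  zero_at_cusps' := by
    intro c hc
    have := isArithmetic_of_isCongruence hΓ
    -- Commensurable groups have the same cusps, so every cusp is `γ · ∞` with `γ` integral.
    obtain ⟨γ, rfl⟩ := isCusp_SL2Z_iff'.1
      ((Subgroup.IsArithmetic.isCusp_iff_isCusp_SL2Z _).1 hc)
    obtain ⟨N, hN, hmem⟩ := exists_conj_nMat_mem hΓ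
    obtain ⟨h1, -, -, h4, h5, -⟩ := mem_nFiniteCuspForms.1 hΦ.1
    rw [OnePoint.isZeroAt_iff rfl, mapGL_int_eq]
    exact isZeroAtImInfty_tilde_slash hΦ.2.2 hΦ.2.1 h1 h5 h4 (h := N) (by exact_mod_cast hN)
      (hmem γ)

theorem coe_toCuspForm {Γ : Subgroup SL(2, ℚ)} (hΓ : IsCongruence Γ) {k : ℤ}
    {Φ : Smooth} (hΦ : Φ ∈ lowestWeight (nFiniteCuspForms Γ) k) :
    ⇑(toCuspForm hΓ hΦ) = tilde k Φ.1 := rfl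

/-- There are no non-zero forms of negative weight, and a form of weight zero is a constant, which
must vanish at `∞`. -/
theorem cuspForm_eq_zero {Γ : Subgroup SL(2, ℚ)} (hΓ : IsCongruence Γ) {k : ℤ} (hk : k ≤ 0)
    (f : S Γ k) : f = 0 := by
  have := isArithmetic_of_isCongruence hΓ
  have hcusp : IsCusp OnePoint.infty (Γ.map (SpecialLinearGroup.mapGL ℝ)) :=
    (Subgroup.IsArithmetic.isCusp_iff_isCusp_SL2Z _).2 (isCusp_SL2Z_iff'.2 ⟨1, by simp⟩)
  let F : ModularForm (Γ.map (SpecialLinearGroup.mapGL ℝ)) k :=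
    { toSlashInvariantForm := f.toSlashInvariantForm
      holo' := f.holo'
      bdd_at_cusps' := fun hc g hg => (f.zero_at_cusps' hc g hg).isBoundedAtImInfty }
  have hF : ⇑F = ⇑f := rfl
  rcases hk.lt_or_eq with hk | rfl
  · have h1 := ModularForm.isZero_of_neg_weight hk F
    refine DFunLike.coe_injective ?_
    rw [← hF, h1]
    rfl
  · obtain ⟨c, hc⟩ := ModularForm.eq_const_of_weight_zero F
    have hz : IsZeroAtImInfty f := OnePoint.isZeroAt_infty_iff.1 (f.zero_at_cusps' hcusp)
    rw [← hF, hc] at hz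
    have h0 : c = 0 := tendsto_nhds_unique tendsto_const_nhds hz
    refine DFunLike.coe_injective ?_
    rw [← hF, hc, h0]
    rfl

theorem lowestWeight_eq_bot {Γ : Subgroup SL(2, ℚ)} (hΓ : IsCongruence Γ) {k : ℤ} (hk : k ≤ 0) :
    lowestWeight (nFiniteCuspForms Γ) k = ⊥ := by
  refine (Submodule.eq_bot_iff _).2 fun Φ hΦ => Subtype.ext ?_
  have h1 := congrArg (fun f : S Γ k => (⇑f : ℍ → ℂ)) (cuspForm_eq_zero hΓ hk (toCuspForm hΓ hΦ))
  rw [← lift_tilde hΦ.2.2, ← coe_toCuspForm hΓ hΦ, h1]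
  funext g
  rw [lift, slash_SL_apply]
  exact zero_mul _

end AutSL2

namespace AutSL2

open Matrix UpperHalfPlane Filter Topology
open scoped Manifold

/-! ### The automorphic form attached to a cusp form -/

theorem denom_ne_zero_of_mem_posDet {A : M2} (hA : A ∈ posDet) :
    (A 1 0 : ℂ) * Complex.I + A 1 1 ≠ 0 := by
  intro h
  have h0 : A 1 0 = 0 := by simpa using congrArg Complex.im h
  have h1 : A 1 1 = 0 := by simpa using congrArg Complex.re h
  have hd : 0 < (of A).det := hA
  rw [det_fin_two] at hd
  simp [h0, h1] at hd

/-- An explicit formula on all of `GL₂(ℝ)⁺`, from which smoothness can be read off: scaling drops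
out of the Möbius action and enters only the automorphy factor. -/
theorem ext_lift (k : ℤ) (f : ℍ → ℂ) {A : M2} (hA : A ∈ posDet) :
    0 < (((A 0 0 : ℂ) * Complex.I + A 0 1) / (A 1 0 * Complex.I + A 1 1)).im ∧
    ext (lift k f) A =
      (f ∘ ofComplex) ((A 0 0 * Complex.I + A 0 1) / (A 1 0 * Complex.I + A 1 1)) *
        (((Real.sqrt (of A).det)⁻¹ : ℝ) * (A 1 0 * Complex.I + A 1 1)) ^ (-k) := by
  have hd : 0 < (of A).det := hA
  have hs : (((Real.sqrt (of A).det)⁻¹ : ℝ) : ℂ) ≠ 0 :=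
    Complex.ofReal_ne_zero.2 (inv_pos.2 (Real.sqrt_pos.2 hd)).ne'
  have hn : ∀ i j, (((normalize A).1 i j : ℝ) : ℂ) =
      ((Real.sqrt (of A).det)⁻¹ : ℝ) * (A i j : ℂ) := by
    intro i j
    rw [normalize_val hd, ← Complex.ofReal_mul]
    rfl
  have h1 : (((normalize A : GL (Fin 2) ℝ) • UpperHalfPlane.I : ℍ) : ℂ) =
      (A 0 0 * Complex.I + A 0 1) / (A 1 0 * Complex.I + A 1 1) := by
    rw [coe_SL_smul, hn, hn, hn, hn, mul_assoc, mul_assoc, ← mul_add, ← mul_add,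
      mul_div_mul_left _ _ hs, UpperHalfPlane.coe_I]
  refine ⟨h1 ▸ UpperHalfPlane.im_pos _, ?_⟩
  rw [ext, lift, slash_SL_apply, ← h1, Function.comp_apply, ofComplex_apply, hn, hn, mul_assoc,
    ← mul_add, UpperHalfPlane.coe_I]

theorem lift_mem_smooth (k : ℤ) {f : ℍ → ℂ} (hf : MDiff f) : lift k f ∈ Smooth := by
  have hF : ContDiffOn ℝ ((⊤ : ℕ∞) : WithTop ℕ∞) (f ∘ ofComplex) upper :=
    ((UpperHalfPlane.mdifferentiable_iff.1 hf).contDiffOn isOpen_upper).restrict_scalars ℝ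
  have hc : ∀ i j, ContDiff ℝ ((⊤ : ℕ∞) : WithTop ℕ∞) fun A : M2 => (A i j : ℂ) := fun i j =>
    Complex.ofRealCLM.contDiff.comp (by fun_prop)
  have hl : ∀ i, ContDiff ℝ ((⊤ : ℕ∞) : WithTop ℕ∞) fun A : M2 =>
      (A i 0 : ℂ) * Complex.I + A i 1 := fun i =>
    ((hc i 0).mul contDiff_const).add (hc i 1)
  have hdet : ContDiff ℝ ((⊤ : ℕ∞) : WithTop ℕ∞) fun A : M2 => (of A).det := by
    simp only [det_fin_two, of_apply]
    fun_prop
  have hz : ∀ w : ℂ, w ≠ 0 → ContDiffAt ℝ ((⊤ : ℕ∞) : WithTop ℕ∞) (fun w : ℂ => w ^ (-k)) w :=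
    fun w hw => (AnalyticAt.contDiffAt ((analyticAt_id (𝕜 := ℂ) (z := w)).zpow hw)).restrict_scalars ℝ
  have hs : ContDiffOn ℝ ((⊤ : ℕ∞) : WithTop ℕ∞)
      (fun A : M2 => (((Real.sqrt (of A).det)⁻¹ : ℝ) : ℂ)) posDet := fun A hA =>
    (Complex.ofRealCLM.contDiff.contDiffAt.comp A
      ((hdet.contDiffAt.sqrt (ne_of_gt hA)).inv
        (Real.sqrt_pos.2 hA).ne')).contDiffWithinAt
  have h1 : ContDiffOn ℝ ((⊤ : ℕ∞) : WithTop ℕ∞) (fun A : M2 => (f ∘ ofComplex)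
      ((A 0 0 * Complex.I + A 0 1) / (A 1 0 * Complex.I + A 1 1))) posDet := by
    refine hF.comp ?_ fun A hA => (ext_lift k f hA).1
    simp only [div_eq_mul_inv]
    exact (hl 0).contDiffOn.mul
      ((hl 1).contDiffOn.inv fun A hA => denom_ne_zero_of_mem_posDet hA)
  have h2 : ContDiffOn ℝ ((⊤ : ℕ∞) : WithTop ℕ∞) (fun A : M2 =>
      ((((Real.sqrt (of A).det)⁻¹ : ℝ) : ℂ) * (A 1 0 * Complex.I + A 1 1)) ^ (-k)) posDet :=
    fun A hA => ContDiffAt.comp_contDiffWithinAt (g := fun w : ℂ => w ^ (-k)) A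
      (hz _ (mul_ne_zero (Complex.ofReal_ne_zero.2 (inv_pos.2 (Real.sqrt_pos.2 hA)).ne')
        (denom_ne_zero_of_mem_posDet hA))) ((hs.mul (hl 1).contDiffOn) A hA)
  exact (h1.mul h2).congr fun A hA => (ext_lift k f hA).2

/-- The function `g ↦ (f|ₖ g)(i)` for a holomorphic function `f`, as a smooth function. -/
noncomputable def liftSmooth (k : ℤ) {f : ℍ → ℂ} (hf : MDiff f) : Smooth :=
  ⟨lift k f, lift_mem_smooth k hf⟩

/-! ### Lifts of holomorphic functions as lowest weight vectors. -/

section Lift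

variable {k : ℤ} {f : ℍ → ℂ} (hf : MDiff f)

theorem liftSmooth_mem_wt : liftSmooth k hf ∈ wt k := fun θ =>
  Subtype.ext (funext fun g => lift_mul_rot k f g θ)

/-- In half-plane coordinates `L` is a multiple of `∂/∂z̄`, which kills `f`. -/
theorem lie_Lel_liftSmooth : ⁅Lel, liftSmooth k hf⁆ = 0 := by
  refine Subtype.ext (eq_of_pull_eq (wt_apply (lie_Lel_mem_wt (liftSmooth_mem_wt hf)))
    (wt_apply (zero_mem (wt (k - 2)))) fun τ => ?_)
  obtain ⟨a, b, hab, h1, -⟩ := exists_hasPartials_pull (liftSmooth_mem_wt (k := k) hf) τ.im_pos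
  have hd := (((UpperHalfPlane.mdifferentiable_iff.1 hf).differentiableAt
    (isOpen_upper.mem_nhds τ.im_pos)).hasDerivAt)
  have h2 := (HasPartials.of_hasDerivAt hd).congr_of_eventuallyEq
    (G := pull k (liftSmooth k hf).1) (by
      filter_upwards [isOpen_upper.mem_nhds τ.im_pos] with z hz
      rw [Function.comp_apply, ofComplex_apply_of_im_pos hz]
      exact pull_lift k f ⟨z, hz⟩)
  obtain ⟨rfl, rfl⟩ := hab.unique h2
  have h0 : pull (k - 2) (0 : Smooth).1 τ = 0 := mul_zero _
  rw [h1, sub_self, mul_zero, h0]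

theorem liftSmooth_mem_nFinite : liftSmooth k hf ∈ nFinite :=
  ⟨1, by rw [pow_one]; exact lie_Lel_liftSmooth hf⟩

theorem liftSmooth_mem_leftInvariant {Γ : Subgroup SL(2, ℚ)}
    (h : ∀ γ ∈ Γ, f ∣[k] (toReal γ : GL (Fin 2) ℝ) = f) : liftSmooth k hf ∈ leftInvariant Γ :=
  fun γ hγ g => by
    change lift k f _ = lift k f g
    rw [lift_mul, h γ hγ]

theorem liftSmooth_mem_slowlyIncreasing {C : ℝ} (h : ∀ τ : ℍ, ‖f τ‖ ≤ C / τ.im ^ (k / 2 : ℝ)) :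
    liftSmooth k hf ∈ slowlyIncreasing := by
  rw [slowlyIncreasing_iff_moderate (liftSmooth_mem_wt hf)]
  obtain ⟨D, hD, N, hN⟩ := Moderate.rpow_im (-(k / 2 : ℝ))
  refine ⟨|C| * D, by positivity, N, fun z hz => ?_⟩
  have hz' : 0 < z.im := hz
  have h1 := h ⟨z, hz⟩
  have h2 := hN z hz
  rw [Complex.norm_real, Real.norm_of_nonneg (by positivity)] at h2
  rw [show pull k (liftSmooth k hf).1 z = f ⟨z, hz⟩ from pull_lift k f ⟨z, hz⟩]
  refine h1.trans ?_
  change C / z.im ^ (k / 2 : ℝ) ≤ _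
  rw [div_eq_mul_inv, ← Real.rpow_neg hz'.le, mul_assoc]
  exact mul_le_mul (le_abs_self C) h2 (by positivity) (abs_nonneg C)

end Lift

/-! ### `𝒵`-finiteness of lowest weight vectors -/

/-- The endomorphisms that preserve `W` form a subalgebra, so the action of the enveloping algebra
factors through it once `𝔏` does. -/
theorem lift_apply_mem {𝔏 M : Type*} [LieRing 𝔏] [LieAlgebra ℂ 𝔏] [AddCommGroup M] [Module ℂ M]
    (ρ : 𝔏 →ₗ⁅ℂ⁆ Module.End ℂ M) {W : Submodule ℂ M} (hW : ∀ Z, ∀ m ∈ W, ρ Z m ∈ W)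
    (u : UniversalEnvelopingAlgebra ℂ 𝔏) {m : M} (h : m ∈ W) :
    UniversalEnvelopingAlgebra.lift ℂ ρ u m ∈ W := by
  let B : Subalgebra ℂ (Module.End ℂ M) :=
    { carrier := {T | ∀ m ∈ W, T m ∈ W}
      mul_mem' := fun ha hb m h => ha _ (hb _ h)
      add_mem' := fun ha hb m h => add_mem (ha _ h) (hb _ h)
      algebraMap_mem' := fun c m h => W.smul_mem c h }
  let ρ' : 𝔏 →ₗ⁅ℂ⁆ B :=
    { toFun := fun Z => ⟨ρ Z, hW Z⟩
      map_add' := fun X Y => Subtype.ext (map_add ρ X Y)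
      map_smul' := fun c X => Subtype.ext (map_smul ρ c X)
      map_lie' := fun {X Y} => Subtype.ext (ρ.map_lie X Y) }
  have hρ : B.val.comp (UniversalEnvelopingAlgebra.lift ℂ ρ') =
      UniversalEnvelopingAlgebra.lift ℂ ρ := by
    refine UniversalEnvelopingAlgebra.hom_ext ℂ (LieHom.ext fun Z => ?_)
    change (UniversalEnvelopingAlgebra.lift ℂ ρ' (UniversalEnvelopingAlgebra.ι ℂ Z)).1 =
      UniversalEnvelopingAlgebra.lift ℂ ρ (UniversalEnvelopingAlgebra.ι ℂ Z)
    rw [UniversalEnvelopingAlgebra.lift_ι_apply, UniversalEnvelopingAlgebra.lift_ι_apply]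
    rfl
  rw [← hρ]
  exact (UniversalEnvelopingAlgebra.lift ℂ ρ' u).2 m h

/-- A central `z` acts on `φ` by a scalar: `z φ` lies in the copy of `𝒟_{p,+}` generated by `φ` and
is killed by `L`, and there the kernel of `L` is a line. -/
theorem mem_zFinite_of_lowestWeight {p : ℕ} {φ : Smooth} (h : φ ∈ wt (p + 1))
    (hL : ⁅Lel, φ⁆ = 0) : φ ∈ zFinite := by
  by_cases h0 : φ = 0
  · rw [h0]
    exact zero_mem _
  refine Submodule.finiteDimensional_of_le (S₂ := Submodule.span ℂ {φ}) ?_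
  rintro _ ⟨z, hz, rfl⟩
  have hz' : z ∈ Subalgebra.center ℂ (UniversalEnvelopingAlgebra ℂ sl2C) := hz
  have hφ : seriesMap p φ (DiscreteSeries.vec p 0 1) = φ := by
    rw [seriesMap_vec, one_smul, raise_zero]
  obtain ⟨v, hv⟩ : envAction z φ ∈ LinearMap.range (seriesMap p φ) :=
    lift_apply_mem cLieHom (by
      rintro Z _ ⟨v, rfl⟩
      exact ⟨⁅Z, v⁆, seriesMap_lie h hL Z v⟩) z ⟨_, hφ⟩
  have hc : ⁅Lel, envAction z φ⁆ = 0 := by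
    rw [← envAction_ι, ← Module.End.mul_apply, ← map_mul,
      Subalgebra.mem_center_iff.1 hz', map_mul, Module.End.mul_apply, envAction_ι, hL, map_zero]
  have hv0 : DiscreteSeries.opL p v = 0 := by
    refine seriesMap_injective h hL h0 ?_
    rw [← lie_Lel_discreteSeries, seriesMap_lie h hL, hv, hc, map_zero]
  change envAction z φ ∈ _
  rw [← hv]
  refine Submodule.mem_span_singleton.2 ⟨coeff p 0 v, ?_⟩
  conv_rhs => rw [show v = _ from eq_vec_zero_of_opL hv0]
  rw [seriesMap_vec, raise_zero]

end AutSL2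

namespace AutSL2

open Matrix UpperHalfPlane Filter Topology
open scoped Manifold Pointwise

/-! ### From holomorphic cusp forms to lowest weight vectors. -/

section CuspForm

variable {Γ : Subgroup SL(2, ℚ)} {k : ℤ} (f : S Γ k)

theorem slash_toReal_eq {γ : SL(2, ℚ)} (hγ : γ ∈ Γ) :
    ⇑f ∣[k] (toReal γ : GL (Fin 2) ℝ) = f :=
  f.slash_action_eq' _ ⟨γ, hγ, rfl⟩

/-- This is the zeroth Fourier coefficient of `f|σ`, which is a cusp form for the conjugate group
`σ⁻¹ Γ σ` with period `h`. -/
theorem intervalIntegral_slash_eq_zero {σ : SL(2, ℚ)} {h : ℚ} (hh : 0 < h)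
    (hσ : σ * nMat h * σ⁻¹ ∈ Γ) {z : ℂ} (hz : 0 < z.im) :
    ∫ x in (0 : ℝ)..h, ((⇑f ∣[k] (toReal σ : GL (Fin 2) ℝ)) ∘ ofComplex) (x + z) = 0 := by
  have hhR : (0 : ℝ) < h := by exact_mod_cast hh
  let f' := CuspForm.translate f (toReal σ : GL (Fin 2) ℝ)
  have hf' : ⇑f' = ⇑f ∣[k] (toReal σ : GL (Fin 2) ℝ) := rfl
  have hp : (h : ℝ) ∈ (ConjAct.toConjAct (toReal σ : GL (Fin 2) ℝ)⁻¹ •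
      Γ.map (SpecialLinearGroup.mapGL ℝ)).strictPeriods := by
    rw [Subgroup.mem_strictPeriods_iff, Subgroup.mem_pointwise_smul_iff_inv_smul_mem]
    refine ⟨σ * nMat h * σ⁻¹, hσ, ?_⟩
    rw [map_inv, inv_inv, ConjAct.toConjAct_smul, mapGL_eq, map_mul, map_mul, map_inv, map_mul,
      map_mul, map_inv, toReal_nMat]
    congr 2
    ext i j
    change (nMat (h : ℝ)).1 i j = _
    fin_cases i <;> fin_cases j <;> simp [nMat, GeneralLinearGroup.upperRightHom]
  have hper : Function.Periodic (⇑f' ∘ ofComplex) (h : ℝ) :=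
    SlashInvariantFormClass.periodic_comp_ofComplex f' hp
  have h0 := CuspFormClass.qExpansion_coeff_zero f' hhR hp
  rw [ModularFormClass.qExpansion_coeff_eq_intervalIntegral f' hhR hp 0 hz] at h0
  have h1 := (mul_eq_zero.1 h0).resolve_left (by simpa using hh.ne')
  have h2 : ∫ x in (0 : ℝ)..h, (⇑f' ∘ ofComplex) ((x : ℂ) + z.im * Complex.I) = 0 := by
    rw [← h1]
    refine intervalIntegral.integral_congr fun u _ => ?_
    have hp : 0 < ((u : ℂ) + z.im * Complex.I).im := by simpa using hz
    simp only [pow_zero, div_one, one_mul, Function.comp_apply, ofComplex_apply_of_im_pos hp]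
  have hper' : Function.Periodic (fun x : ℝ => (⇑f' ∘ ofComplex) ((x : ℂ) + z.im * Complex.I))
      (h : ℝ) := fun x => by
    have := hper ((x : ℂ) + z.im * Complex.I)
    dsimp only
    rw [← this, Complex.ofReal_add, add_right_comm]
  -- The coefficient formula integrates along `Re = 0..h`; periodicity allows the start to be moved
  -- to `Re z`.
  have h3 := hper'.intervalIntegral_add_eq z.re 0
  rw [zero_add, h2, add_comm z.re] at h3
  rw [← h3, ← hf']
  have h4 := intervalIntegral.integral_comp_add_right (a := 0) (b := (h : ℝ))
    (fun x : ℝ => (⇑f' ∘ ofComplex) ((x : ℂ) + z.im * Complex.I)) z.re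
  rw [zero_add] at h4
  rw [← h4]
  refine intervalIntegral.integral_congr fun u _ => ?_
  congr 1
  rw [Complex.ofReal_add, add_assoc, Complex.re_add_im]

/-- Writing `σ⁻¹ g` as upper triangular times rotation turns the integrand into a constant multiple
of `(f|σ)(x + z)`. -/
theorem liftSmooth_mem_cuspidal : liftSmooth k f.holo' ∈ cuspidal Γ := by
  intro σ h hh hσ g
  obtain ⟨z, hz, θ, hg⟩ := exists_eq_naMat_mul_rot ((toReal σ)⁻¹ * g)
  have hz' : 0 < z.im := hz
  have h1 : ∀ x : ℝ, lift k f (toReal σ * nMat x * (toReal σ)⁻¹ * g) =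
      (Complex.exp (Complex.I * k * θ) * ((z.im ^ ((k : ℝ) / 2) : ℝ) : ℂ)) *
        ((⇑f ∣[k] (toReal σ : GL (Fin 2) ℝ)) ∘ ofComplex) (x + z) := by
    intro x
    have hx : 0 < ((x : ℂ) + z).im := by simpa using hz'
    have hx' : ((x : ℂ) + z).im = z.im := by simp
    rw [mul_assoc _ _ g, hg, ← mul_assoc, lift_mul_rot, mul_assoc (toReal σ), ← naMat_add hz',
      lift_mul, mul_assoc (Complex.exp _), Function.comp_apply, ofComplex_apply_of_im_pos hx]
    congr 1
    rw [show naMat ((x : ℂ) + z) = naMat ((⟨_, hx⟩ : ℍ) : ℂ) from rfl, lift_naMat]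
    congr 3
  change ∫ x in (0 : ℝ)..h, lift k f (toReal σ * nMat x * (toReal σ)⁻¹ * g) = 0
  simp only [h1]
  rw [intervalIntegral.integral_const_mul, intervalIntegral_slash_eq_zero f hh hσ hz', mul_zero]

end CuspForm

theorem liftSmooth_mem_lowestWeight {Γ : Subgroup SL(2, ℚ)} (hΓ : IsCongruence Γ) {p : ℕ}
    (f : S Γ (p + 1)) :
    liftSmooth (p + 1) f.holo' ∈ lowestWeight (nFiniteCuspForms Γ) (p + 1) := by
  have := isArithmetic_of_isCongruence hΓ
  obtain ⟨C, hC⟩ := CuspFormClass.exists_bound f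
  have hw : liftSmooth (p + 1) f.holo' ∈ wt (p + 1) := liftSmooth_mem_wt f.holo'
  have hL := lie_Lel_liftSmooth (k := (p + 1 : ℤ)) f.holo'
  exact mem_lowestWeight.2 ⟨mem_nFiniteCuspForms.2
    ⟨liftSmooth_mem_leftInvariant _ fun γ hγ => slash_toReal_eq f hγ, wt_le_kFinite _ hw,
      mem_zFinite_of_lowestWeight hw hL, liftSmooth_mem_slowlyIncreasing _ hC,
      liftSmooth_mem_cuspidal f, liftSmooth_mem_nFinite _⟩, hL, hw⟩

/-- Lowest weight vectors correspond to holomorphic cusp forms. -/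
noncomputable def lowestWeightEquiv {Γ : Subgroup SL(2, ℚ)} (hΓ : IsCongruence Γ) (p : ℕ) :
    lowestWeight (nFiniteCuspForms Γ) (p + 1) ≃ₗ[ℂ] S Γ (p + 1) where
  toFun Φ := toCuspForm hΓ Φ.2
  map_add' _ _ := DFunLike.coe_injective (funext fun _ => mul_add _ _ _)
  map_smul' _ _ := DFunLike.coe_injective (funext fun _ => mul_left_comm _ _ _)
  invFun f := ⟨liftSmooth (p + 1) f.holo', liftSmooth_mem_lowestWeight hΓ f⟩
  left_inv Φ := Subtype.ext (Subtype.ext (lift_tilde Φ.2.2.2))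
  right_inv _ := DFunLike.coe_injective (tilde_lift _ _)

end AutSL2

namespace AutSL2

open Matrix UpperHalfPlane Filter Topology Asymptotics

/-! ### Finite-dimensionality of spaces of cusp forms -/

/-- The cusp function is a power series in `q` starting at degree `m`, and `|q| = e^{-2πy/h}`. -/
theorem isBigO_atImInfty_of_qExpansion_coeff {h : ℝ} (hh : 0 < h) {𝒢 : Subgroup (GL (Fin 2) ℝ)}
    (hp : h ∈ 𝒢.strictPeriods) {k : ℤ} {F : Type*} [FunLike F ℍ ℂ] [ModularFormClass F 𝒢 k] (f : F)
    {m : ℕ} (hm : ∀ i < m, (qExpansion h f).coeff i = 0) :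
    ⇑f =O[atImInfty] fun τ => Real.exp (-2 * Real.pi * τ.im / h) ^ m := by
  have : Fact (IsCusp OnePoint.infty 𝒢) := ⟨𝒢.isCusp_of_mem_strictPeriods hh hp⟩
  have hper := SlashInvariantFormClass.periodic_comp_ofComplex f hp
  have hser := hasFPowerSeriesOnBall_cuspFunction hh
    (ModularFormClass.analyticAt_cuspFunction_zero f hh hp)
    (hasSum_qExpansion hh hper (ModularFormClass.holo f) (ModularFormClass.bdd_at_infty f))
  have h1 := hser.hasFPowerSeriesAt.isBigO_sub_partialSum_pow m
  have h2 : ∀ q : ℂ, (FormalMultilinearSeries.ofScalars ℂ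
      fun i => (qExpansion h f).coeff i).partialSum m q = 0 := fun q => by
    refine Finset.sum_eq_zero fun i hi => ?_
    simp [hm i (Finset.mem_range.1 hi)]
  simp only [h2, sub_zero, zero_add] at h1
  refine ((h1.comp_tendsto (qParam_tendsto_atImInfty hh)).congr' ?_ ?_)
  · exact Eventually.of_forall fun τ => eq_cuspFunction τ hh.ne' hper
  · refine Eventually.of_forall fun τ => ?_
    simp [Function.Periodic.norm_qParam]

theorem qExpansion_coeff_eq_zero_of_isBigO {k : ℤ} (F : ModularForm 𝒮ℒ k) {h : ℝ} {m n : ℕ}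
    (hh : 0 < h) (hn : n * h < m)
    (hF : ⇑F =O[atImInfty] fun τ => Real.exp (-2 * Real.pi * τ.im / h) ^ m) :
    (qExpansion 1 F).coeff n = 0 := by
  have hp : (1 : ℝ) ∈ (𝒮ℒ).strictPeriods := by simp
  obtain ⟨C, hC⟩ := hF.bound
  obtain ⟨A, hA⟩ := eventually_atTop.1 (eventually_comap.1 hC)
  have key : ∀ t : ℝ, max A 1 ≤ t → ‖(qExpansion 1 F).coeff n‖ ≤
      C * Real.exp (-(2 * Real.pi * (m / h - n) * t)) := by
    intro t ht
    have ht0 : 0 < t := by linarith [le_max_right A 1]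
    rw [ModularFormClass.qExpansion_coeff_eq_intervalIntegral F one_pos hp n ht0]
    simp only [Complex.ofReal_one, div_one, one_mul]
    have := intervalIntegral.norm_integral_le_of_norm_le_const (a := 0) (b := (1 : ℝ))
      (f := fun u : ℝ => 1 / Function.Periodic.qParam 1 (u + t * UpperHalfPlane.I) ^ n *
        F ⟨u + t * UpperHalfPlane.I, by simpa using ht0⟩)
      (C := C * Real.exp (-(2 * Real.pi * (m / h - n) * t))) ?_
    · simpa using this
    intro u _
    have hu := hA t ((le_max_left A 1).trans ht)
      ⟨u + t * UpperHalfPlane.I, by simpa using ht0⟩ (by simp)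
    have him : UpperHalfPlane.im ⟨u + t * UpperHalfPlane.I, by simpa using ht0⟩ = t := by simp
    rw [him, norm_pow, Real.norm_of_nonneg (Real.exp_nonneg _)] at hu
    have e1 : ((u : ℂ) + t * UpperHalfPlane.I).im = t := by simp
    rw [norm_mul, norm_div, norm_one, norm_pow, Function.Periodic.norm_qParam,
      show Real.exp (-2 * Real.pi * ((u : ℂ) + t * UpperHalfPlane.I).im / 1) =
        Real.exp (-2 * Real.pi * t / 1) by rw [e1]]
    refine (mul_le_mul_of_nonneg_left hu (by positivity)).trans (le_of_eq ?_)
    rw [one_div, ← Real.exp_nat_mul, ← Real.exp_nat_mul, ← Real.exp_neg, mul_left_comm,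
      ← Real.exp_add]
    congr 2
    field_simp
    ring
  have hpos : 0 < 2 * Real.pi * (m / h - n) := by
    have : (n : ℝ) < m / h := by rwa [lt_div_iff₀ hh]
    have := Real.pi_pos
    have : 0 < (m : ℝ) / h - n := by linarith
    positivity
  have hlim : Tendsto (fun t : ℝ => C * Real.exp (-(2 * Real.pi * (m / h - n) * t))) atTop
      (𝓝 (C * 0)) :=
    (Real.tendsto_exp_neg_atTop_nhds_zero.comp (tendsto_id.const_mul_atTop hpos)).const_mul C
  rw [mul_zero] at hlim
  exact norm_le_zero_iff.1 (ge_of_tendsto hlim (eventually_atTop.2 ⟨_, key⟩))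

/-- The norm to level one has weight `k` times the index. One of its factors is `f` and the others
are bounded at infinity, so it decays like `f`; the Sturm bound in level one then makes it vanish.
-/
theorem eq_zero_of_qExpansion_coeff {𝒢 : Subgroup (GL (Fin 2) ℝ)} [𝒢.IsArithmetic] {k : ℤ}
    {h : ℝ} (hh : 0 < h) (hp : h ∈ 𝒢.strictPeriods) (f : CuspForm 𝒢 k) {m : ℕ}
    (hm : (((k * Nat.card (𝒮ℒ ⧸ 𝒢.subgroupOf 𝒮ℒ)).toNat / 12 : ℕ) : ℝ) * h < m)
    (hf : ∀ i < m, (qExpansion h f).coeff i = 0) : f = 0 := by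
  classical
  have hO := isBigO_atImInfty_of_qExpansion_coeff hh hp f hf
  have hnorm : ⇑(ModularForm.norm 𝒮ℒ f) =O[atImInfty]
      fun τ => Real.exp (-2 * Real.pi * τ.im / h) ^ m := by
    let := Fintype.ofFinite (𝒮ℒ ⧸ 𝒢.subgroupOf 𝒮ℒ)
    rw [ModularForm.coe_norm]
    let q₀ : 𝒮ℒ ⧸ 𝒢.subgroupOf 𝒮ℒ := ⟦1⟧
    rw [← Finset.mul_prod_erase _ _ (Finset.mem_univ q₀)]
    have h1 : SlashInvariantForm.quotientFunc f q₀ = f := by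
      rw [SlashInvariantForm.quotientFunc_mk]
      simp
    have h2 : (∏ q ∈ Finset.univ.erase q₀, SlashInvariantForm.quotientFunc f q)
        =O[atImInfty] fun _ => (1 : ℝ) := by
      rw [show (fun _ : ℍ => (1 : ℝ)) = fun x => ∏ i ∈ Finset.univ.erase q₀, 1 by ext; simp,
        Finset.prod_fn]
      refine .finsetProd fun q _ => ?_
      induction q using Quotient.inductionOn with
      | h r =>
        rw [SlashInvariantForm.quotientFunc_mk]
        obtain ⟨γ, hγ⟩ := (inv_mem r.2 : r.1⁻¹ ∈ 𝒮ℒ)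
        rw [← hγ]
        exact ModularFormClass.bdd_at_infty_slash f γ
    rw [h1]
    exact (hO.mul h2).trans_eventuallyEq (Eventually.of_forall fun τ => mul_one _)
  have h0 : ModularForm.norm 𝒮ℒ f = 0 := by
    refine ModularForm.sturm_bound_levelOne ?_
    -- The order must strictly exceed the rounded-down bound, hence the `+ 1`; the coefficients to
    -- be killed are exactly those up to the bound.
    refine lt_of_lt_of_le ?_ (PowerSeries.nat_le_order _
      ((k * Nat.card (𝒮ℒ ⧸ 𝒢.subgroupOf 𝒮ℒ)).toNat / 12 + 1) fun i hi => ?_)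
    · exact_mod_cast Nat.lt_succ_self _
    · refine qExpansion_coeff_eq_zero_of_isBigO _ hh (lt_of_le_of_lt ?_ hm) hnorm
      gcongr
      omega
  exact DFunLike.coe_injective ((ModularForm.norm_eq_zero_iff 𝒮ℒ f).1 h0)

theorem finiteDimensional_cuspForm (𝒢 : Subgroup (GL (Fin 2) ℝ)) [𝒢.IsArithmetic]
    [𝒢.HasDetOne] (k : ℤ) : FiniteDimensional ℂ (CuspForm 𝒢 k) := by
  have hh : 0 < 𝒢.strictWidthInfty := 𝒢.strictWidthInfty_pos_iff.mpr Fact.out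
  have hp := 𝒢.strictWidthInfty_mem_strictPeriods
  set h := 𝒢.strictWidthInfty
  obtain ⟨m, hm⟩ := exists_nat_gt
    ((((k * Nat.card (𝒮ℒ ⧸ 𝒢.subgroupOf 𝒮ℒ)).toNat / 12 : ℕ) : ℝ) * h)
  let A : CuspForm 𝒢 k →ₗ[ℂ] (Fin m → ℂ) :=
    { toFun := fun f i => (qExpansion h f).coeff i
      map_add' := fun f g => funext fun i => by
        rw [FunLike.coe_add, ModularForm.qExpansion_add hh hp f g]
        simp
      map_smul' := fun c f => funext fun i => by
        rw [FunLike.coe_smul, ModularForm.qExpansion_smul hh hp c f]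
        simp }
  refine FiniteDimensional.of_injective A ((injective_iff_map_eq_zero A).2 fun f hf => ?_)
  exact eq_zero_of_qExpansion_coeff hh hp f hm fun i hi => congrFun hf ⟨i, hi⟩

end AutSL2

/-! ### The decomposition theorem, with `ℓ = p + 1`. -/

theorem mainTheorem4 (Γ : Subgroup SL(2, ℚ)) (hΓ : AutSL2.IsCongruence Γ) :
    (∀ p : ℕ, FiniteDimensional ℂ (AutSL2.S Γ (p + 1))) ∧
    ∃ V : AutSL2.GKSubmodule,
      V.toSubmodule = AutSL2.nFiniteCuspForms Γ ∧
      AutSL2.IsGKModule V.rep ∧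
      Nonempty (AutSL2.GKEquiv V.rep (AutSL2.sumRep
        fun i : (Σ p : ℕ, Fin (Module.finrank ℂ (AutSL2.S Γ (p + 1)))) => i.1)) ∧
      ∀ p : ℕ, ∃ T : AutSL2.lowestWeight (AutSL2.isotypic V p) (p + 1) ≃ₗ[ℂ] AutSL2.S Γ (p + 1),
        ∀ Φ : AutSL2.lowestWeight (AutSL2.isotypic V p) (p + 1),
          (⇑(T Φ) : UpperHalfPlane → ℂ) = AutSL2.tilde (p + 1) Φ.1.1 ∧
          ∀ g : SL(2, ℝ),
            ((⇑(T Φ) : UpperHalfPlane → ℂ) ∣[(p + 1 : ℤ)] (g : GL (Fin 2) ℝ)) UpperHalfPlane.I =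
              Φ.1.1 g := by
  have := AutSL2.isArithmetic_of_isCongruence hΓ
  have hfin : ∀ p : ℕ, FiniteDimensional ℂ (AutSL2.S Γ (p + 1)) := fun p =>
    AutSL2.finiteDimensional_cuspForm _ _
  refine ⟨hfin, AutSL2.cuspModule Γ, rfl, ?_, ?_, fun p => ?_⟩
  · exact AutSL2.isGKModule_of_weights _
      (fun _ h => AutSL2.mem_iSup_wt_inf_nFiniteCuspForms h)
      fun _ h => (AutSL2.mem_nFiniteCuspForms.1 h).2.1
  · exact AutSL2.nonempty_gkEquiv_sumRep (AutSL2.cuspModule Γ)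
      (fun _ h => AutSL2.mem_iSup_wt_inf_nFiniteCuspForms h)
      (fun _ h => (AutSL2.mem_nFiniteCuspForms.1 h).2.2.2.2.2)
      (fun _ hn => AutSL2.lowestWeight_eq_bot hΓ hn) _
      -- A basis of cusp forms, carried over to lowest weight vectors, indexes the summands, so the
      -- multiplicity of `𝒟_{p,+}` is `dim S_{p+1}(Γ)`.
      fun p => (Module.finBasis ℂ (AutSL2.S Γ (p + 1))).map (AutSL2.lowestWeightEquiv hΓ p).symm
  · exact ⟨(LinearEquiv.ofEq _ _ (AutSL2.lowestWeight_isotypic (AutSL2.cuspModule Γ) p)).trans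
      (AutSL2.lowestWeightEquiv hΓ p), fun Φ => ⟨rfl, fun g =>
        congrFun (AutSL2.lift_tilde (AutSL2.mem_lowestWeight.1 Φ.2).2.2) g⟩⟩
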